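/- **Setting.** Let $n\ge 1$. Number the vertices of the balanced binary tree with $n$ vertices level by level as $0,1,\dots,n-1$ (root $0$; the parent of $v\ge1$ is $\lfloor (v-1)/2\rfloor$). Give each non-root vertex $i$ a bit $x_i$ and the edge from $i$ to its parent a bit $d_i$ ($1\le i\le n-1$), and let $h(d)_i$ be the parity of the bits $d_j$ on the path from the root to $i$. The binary tree poor man's GHZ state on $2n-1$ qubits ($n-1$ edge qubits, $n-1$ non-root vertex qubits, and one last (root) qubit) is $$|\mathrm{BPM}_n\rangle=\sum_{d\in\{0,1\}^{n-1}}\frac1{2^{(n-1)/2}}\,|d\rangle\otimes\frac1{\sqrt2}\bigl(|h(d)\,0\rangle+|\overline{h(d)}\,1\rangle\bigr).$$ For a positive integer $p$ and $s\in\mathbb Z/p$ let $\mathrm{majmod}_{p,s}(k)=0$ if the residue of $k+s$ in $\{0,\dots,p-1\}$ is $<p/2$, and $1$ otherwise; let $$\mathrm{pmmajmod}_{p,s}(d,x)=\mathrm{majmod}_{p,s}\Bigl(\sum_{i=1}^{n-1}x_i(-1)^{h(d)_i}\Bigr)\oplus \mathrm{parity}(x).$$ $Z=(d,x)$ denotes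 a uniformly random string of $2n-2$ bits. **Gates.** With $X$ the Pauli matrix, $A_{k,\theta}$ is the operator on $k$ qubits $$A_{k,\theta}|x_1,\dots,x_k\rangle=e^{i\theta x_kX}|x_1\rangle\otimes e^{i\theta x_1X}|x_2\rangle\otimes\dots\otimes e^{i\theta x_{k-1}X}|x_k\rangle .$$ For a set $B_k\subseteq\{0,1\}^k$ containing exactly one of $x,\bar x$ for each $x$, $U_{k,\theta}|x\rangle=A_{k,\theta}|x\rangle$ if $x\in B_k$, and otherwise $$U_{k,\theta}|x\rangle=\frac{A_{k,\theta}|x\rangle+(-1)^{k+1}i^{\,k+2|x|}\sin^k(\theta)\,A_{k,\theta}|\bar x\rangle}{\sqrt{1-\sin^{2k}\theta}} .$$ $C_k|x_1,\dots,x_k\rangle=|x_k,x_1,\dots,x_{k-1}\rangle$ is the cyclic shift. For a family $G=(G_k)_k$ of operators on $k$ qubits let $W_{n,m,p,s}(G)$ be the following operator on the $2n-1$ qubits: Hadamard gates on all $n$ vertex qubits; then, the non-root vertex qubits $1,\dots,n-1$ being cut into consecutive blocks of $m$ qubits (a remainder of fewer than $m$ qubits forms a last, shorter block), $G_k$ on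 every block of size $k$, and $\exp\bigl(iX(\tfrac\pi4-\tfrac{\pi s}p)\bigr)$ on the last qubit (with $s$ represented in $\{0,\dots,p-1\}$); then $C_k$ on every block of size $k$. A circuit is a sequence of layers of gates acting on disjoint sets of qubits; its depth is the number of layers. **Theorem.** 1. Let $c\in(0,1/2)$ and $m=\lceil 2/c+1\rceil$. There is $D$ (depending only on $c$) such that for all $a,b>0$ there are $K,n_0$ (depending only on $a,b,c$) with the following property. For all $n\ge n_0$, all integers $p$ with $a\,n^c\le p\le b\,n^c$ (in particular for $p=n^c$ whenever this is an integer), all $s\in\mathbb Z/p$ and all choices of the sets $B_k$ ($k\ge1$), there is a circuit of one- and two-qubit unitary gates on $2n-1$ qubits, of depth at most $D$, which consists of a first part mapping $|0^{2n-1}\rangle$ to $|\mathrm{BPM}_n\rangle$ and a second part implementing exactly the operator $W_{n,m,p,s}\bigl((U_{k,\pi/p}^\dagger)_k\bigr)$. Measured in the computational basis, its output on $|0^{2n-1}\rangle$ is a random string $(Z',Y)$ of $2n-1$ bits ($Z'$ from the first $2n-2$ qubits, $Y$ from the last) with $$d_{TV}\bigl((Z',Y),(Z,\mathrm{pmmajmod}_{p,s}(Z))\bigr)\le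 \frac12-\frac1\pi+K\,n^{-c}.$$ 2. There are absolute constants $D,K$ such that for all integers $n\ge1$, $m\ge1$, all $p\ge1$ with $p\ne2$, and all $s\in\mathbb Z/p$, there is a circuit of depth at most $D$ whose gates are one- and two-qubit unitary gates and the (non-unitary) operations $A_{k,\pi/p}^\dagger$ with $1\le k\le m$, which consists of a first part mapping $|0^{2n-1}\rangle$ to $|\mathrm{BPM}_n\rangle$ and a second part implementing exactly $W_{n,m,p,s}\bigl((A_{k,\pi/p}^\dagger)_k\bigr)$. The squared moduli of the amplitudes of its output on $|0^{2n-1}\rangle$ sum to $1$, and the resulting distribution $P$ of $(Z',Y)$ satisfies $$d_{TV}\bigl(P,(Z,\mathrm{pmmajmod}_{p,s}(Z))\bigr)\le\frac12-\frac1\pi+\frac1{2p}+K\,p^{3/2}e^{-n/(4p^2)} .$$ -/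

import Mathlib

noncomputable section

namespace ShallowSampling

/-! ## State vectors, gates, circuits -/

/-- A (not necessarily normalised) state vector of qubits indexed by `ι`: its amplitudes in the
computational basis. -/
abbrev State (ι : Type) := (ι → Bool) → ℂ

/-- A matrix on `k` qubits, in the computational basis (row: output, column: input). -/
abbrev QMat (k : ℕ) := Matrix (Fin k → Bool) (Fin k → Bool) ℂ

/-- The all zeros state. -/
def zeroState (ι : Type) [Fintype ι] : State ι :=
  fun z => if z = fun _ => false then 1 else 0

/-- A gate: a linear operator on `arity` qubits, placed on distinct wires. -/
structure Gate (ι : Type) where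
  arity : ℕ
  wires : Fin arity ↪ ι
  mat : QMat arity

/-- The action of a gate, tensored with the identity on the remaining wires.
`Function.extend g.wires y z` is the bit string `z` with the bits on the wires of `g` replaced
by `y`. -/
def Gate.apply {ι : Type} (g : Gate ι) (ψ : State ι) : State ι :=
  fun z => ∑ y : Fin g.arity → Bool,
    g.mat (fun j => z (g.wires j)) y * ψ (Function.extend g.wires y z)

/-- A layer is a list of gates (to be performed in parallel), a circuit a list of layers,
the first layer acting first. -/
abbrev Layer (ι : Type) := List (Gate ι)

abbrev Circuit (ι : Type) := List (Layer ι)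

def Layer.run {ι : Type} (L : Layer ι) (ψ : State ι) : State ι :=
  L.foldl (fun φ g => g.apply φ) ψ

def Circuit.run {ι : Type} (C : Circuit ι) (ψ : State ι) : State ι :=
  C.foldl (fun φ L => Layer.run L φ) ψ

/-- The depth is the number of layers. -/
def Circuit.depth {ι : Type} (C : Circuit ι) : ℕ := C.length

/-- `C` is a legal circuit over the gate set `S`: every gate belongs to `S`, and any two gates
in the same layer act on disjoint sets of wires. -/
def Circuit.IsOver {ι : Type} (S : Gate ι → Prop) (C : Circuit ι) : Prop :=
  ∀ L ∈ C, (∀ g ∈ L, S g) ∧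
    L.Pairwise fun g h => Disjoint (Set.range g.wires) (Set.range h.wires)

/-- One- and two-qubit unitary gates. -/
def IsOneTwoUnitary {ι : Type} (g : Gate ι) : Prop :=
  (g.arity = 1 ∨ g.arity = 2) ∧ g.mat ∈ Matrix.unitaryGroup (Fin g.arity → Bool) ℂ

/-- The weights of a computational basis measurement. -/
def born {ι : Type} (ψ : State ι) : (ι → Bool) → ℝ := fun z => ‖ψ z‖ ^ 2

def IsProbDist {α : Type} [Fintype α] (P : α → ℝ) : Prop :=
  (∀ z, 0 ≤ P z) ∧ ∑ z, P z = 1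

/-- Total variation distance. -/
def tvDist {α : Type} [Fintype α] (P Q : α → ℝ) : ℝ := (1 / 2) * ∑ z, |P z - Q z|

/-! ## Particular gates -/

/-- `exp(iφX) = cos φ · I + i sin φ · X`. -/
def rotX (φ : ℝ) : Matrix Bool Bool ℂ :=
  Matrix.of fun y x => if y = x then (Real.cos φ : ℂ) else Complex.I * (Real.sin φ : ℂ)

def hadamard : Matrix Bool Bool ℂ :=
  Matrix.of fun y x => if y && x then -(1 / (Real.sqrt 2 : ℂ)) else 1 / (Real.sqrt 2 : ℂ)

/-- A one-qubit gate on the wire `w`. -/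
def oneQubitGate {ι : Type} (w : ι) (M : Matrix Bool Bool ℂ) : Gate ι where
  arity := 1
  wires := ⟨fun _ => w, fun _ _ _ => Subsingleton.elim _ _⟩
  mat := Matrix.of fun y x => M (y 0) (x 0)

/-- `A_{k,θ} |x₁, …, x_k⟩ = exp(iθ x_k X)|x₁⟩ ⊗ exp(iθ x₁ X)|x₂⟩ ⊗ … ⊗ exp(iθ x_{k-1} X)|x_k⟩`;
`(finRotate k).symm j` is the cyclic predecessor of `j`. -/
def aMat (k : ℕ) (θ : ℝ) : QMat k :=
  Matrix.of fun y x => ∏ j : Fin k,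
    rotX (if x ((finRotate k).symm j) then θ else 0) (y j) (x j)

/-- The cyclic shift `C_k |x₁, …, x_k⟩ = |x_k, x₁, …, x_{k-1}⟩`. -/
def shiftMat (k : ℕ) : QMat k :=
  Matrix.of fun y x => if y = fun j => x ((finRotate k).symm j) then 1 else 0

/-- The bitwise complement of a bit string. -/
def flipAll {α : Type} (x : α → Bool) : α → Bool := fun j => !(x j)

/-- The Hamming weight of a bit string. -/
def weight {α : Type} [Fintype α] (x : α → Bool) : ℕ :=
  (Finset.univ.filter fun j => x j = true).card

/-- `B` contains exactly one of `x`, `x̄` for every bit string `x` of length `k`. -/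
def IsHalf {k : ℕ} (B : Finset (Fin k → Bool)) : Prop :=
  ∀ x : Fin k → Bool, x ∈ B ↔ flipAll x ∉ B

/-- `U_{k,θ}`, the Gram–Schmidt orthonormalisation of `A_{k,θ}`: it maps `|x⟩` to `A|x⟩` for
`x ∈ B` and to `(A|x⟩ + (-1)^{k+1} i^{k+2|x|} sin^k θ · A|x̄⟩) / √(1 - sin^{2k} θ)` otherwise. -/
def uMat (k : ℕ) (θ : ℝ) (B : Finset (Fin k → Bool)) : QMat k :=
  Matrix.of fun y x =>
    if x ∈ B then aMat k θ y x
    else (aMat k θ y x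
        + (-1) ^ (k + 1) * Complex.I ^ (k + 2 * weight x) * (Real.sin θ : ℂ) ^ k
          * aMat k θ y (flipAll x))
      / (Real.sqrt (1 - Real.sin θ ^ (2 * k)) : ℂ)

/-! ## The balanced binary tree and the binary tree poor man's GHZ state -/

/-- The path from the root `0` to the vertex `v` of the balanced binary tree whose vertices
`0, 1, 2, …` are numbered level by level (the parent of `v ≥ 1` is `(v - 1) / 2`), as the list of
its edges; the edge between `v` and its parent has the number `v`. -/
def rootPath (v : ℕ) : List ℕ :=
  if v = 0 then [] else v :: rootPath ((v - 1) / 2)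
termination_by v
decreasing_by omega

/-- The parity of the edge variables along the path from the root to each non-root vertex of the
tree with `n` vertices. The vertex variable `x_i` and the edge variable `d_i`, `1 ≤ i ≤ n - 1`,
have the index `i - 1` in `Fin (n - 1)`. -/
def pathSum {n : ℕ} (d : Fin (n - 1) → Bool) : Fin (n - 1) → Bool := fun i =>
  decide (Odd (Finset.univ.filter fun j : Fin (n - 1) =>
    (j : ℕ) + 1 ∈ rootPath ((i : ℕ) + 1) ∧ d j = true).card)

/-- The `2n - 1` qubits: `n - 1` edge qubits, `n - 1` vertex qubits, and the last vertex qubit,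
which belongs to the root. -/
abbrev Qubit (n : ℕ) := (Fin (n - 1) ⊕ Fin (n - 1)) ⊕ Unit

abbrev edgeQ {n : ℕ} (i : Fin (n - 1)) : Qubit n := Sum.inl (Sum.inl i)
abbrev vertexQ {n : ℕ} (i : Fin (n - 1)) : Qubit n := Sum.inl (Sum.inr i)
abbrev lastQ (n : ℕ) : Qubit n := Sum.inr ()

theorem card_qubit (n : ℕ) (hn : 1 ≤ n) : Fintype.card (Qubit n) = 2 * n - 1 := by
  simp only [Fintype.card_sum, Fintype.card_fin, Fintype.card_unit]
  omega

def edgeBits {n : ℕ} (z : Qubit n → Bool) : Fin (n - 1) → Bool := fun i => z (edgeQ i)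
def vertexBits {n : ℕ} (z : Qubit n → Bool) : Fin (n - 1) → Bool := fun i => z (vertexQ i)
def lastBit {n : ℕ} (z : Qubit n → Bool) : Bool := z (lastQ n)

/-- The binary tree poor man's GHZ state
`∑_d 2^{-(n-1)/2} |d⟩ ⊗ (|h(d), 0⟩ + |complement of h(d), 1⟩)/√2` with `h = pathSum`. -/
def bpmState (n : ℕ) : State (Qubit n) := fun z =>
  (1 / (Real.sqrt 2 : ℂ)) ^ (n - 1) * (1 / (Real.sqrt 2 : ℂ)) *
    ((if vertexBits z = pathSum (edgeBits z) ∧ lastBit z = false then 1 else 0)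
      + (if vertexBits z = flipAll (pathSum (edgeBits z)) ∧ lastBit z = true then 1 else 0))

/-! ## The sampling circuits, as applied to the poor man's GHZ state -/

/-- The non-root vertex qubits are cut into consecutive blocks of `m` qubits; a remainder of fewer
than `m` qubits forms a last, shorter block. This is the size of block number `b`. -/
def blockSize (n m b : ℕ) : ℕ := min m (n - 1 - b * m)

def numBlocks (n m : ℕ) : ℕ := ((n - 1) + (m - 1)) / m

def blockWires (n m b : ℕ) : Fin (blockSize n m b) ↪ Qubit n where
  toFun j := vertexQ ⟨b * m + j, by
    have h := j.isLt
    unfold blockSize at h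
    omega⟩
  inj' := by
    intro i j h
    simp only [vertexQ, Sum.inl.injEq, Sum.inr.injEq, Fin.mk.injEq] at h
    exact Fin.ext (by omega)

/-- Apply to every block of vertex qubits the operator given for its size. -/
def blockLayer (n m : ℕ) (M : ∀ k : ℕ, QMat k) : Layer (Qubit n) :=
  (List.range (numBlocks n m)).map fun b => ⟨blockSize n m b, blockWires n m b, M (blockSize n m b)⟩

def hadamardLayer (n : ℕ) : Layer (Qubit n) :=
  (List.ofFn fun i : Fin (n - 1) => oneQubitGate (vertexQ i) hadamard)
    ++ [oneQubitGate (lastQ n) hadamard]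

/-- Hadamard gates on all vertex qubits; then the operators `M` on the blocks of non-root vertex
qubits and `exp(iX(π/4 - πs/p))` on the last qubit; then the cyclic shifts on the blocks. -/
def mainCircuit (n m p : ℕ) (s : ZMod p) (M : ∀ k : ℕ, QMat k) : Circuit (Qubit n) :=
  [hadamardLayer n,
    blockLayer n m M
      ++ [oneQubitGate (lastQ n) (rotX (Real.pi / 4 - Real.pi * (s.val : ℝ) / (p : ℝ)))],
    blockLayer n m shiftMat]

/-- The circuit with the gates `U_{m,π/p}†`. -/
def unitaryCircuit (n m p : ℕ) (s : ZMod p) (B : ∀ k : ℕ, Finset (Fin k → Bool)) :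
    Circuit (Qubit n) :=
  mainCircuit n m p s fun k => (uMat k (Real.pi / (p : ℝ)) (B k)).conjTranspose

/-- The circuit with the operations `A_{m,π/p}†`. -/
def nonunitaryCircuit (n m p : ℕ) (s : ZMod p) : Circuit (Qubit n) :=
  mainCircuit n m p s fun k => (aMat k (Real.pi / (p : ℝ))).conjTranspose

/-- The operations `A_{k,θ}†` with `1 ≤ k ≤ m`. -/
def IsAdjointA {ι : Type} (m : ℕ) (θ : ℝ) (g : Gate ι) : Prop :=
  1 ≤ g.arity ∧ g.arity ≤ m ∧ g.mat = (aMat g.arity θ).conjTranspose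

/-! ## The target distribution -/

/-- `majmod_{p,s}(k)`: `0` if `k + s mod p`, taken in `{0, …, p - 1}`, is `< p/2`, and `1`
if it is `> p/2` (and also if it equals `p/2`, which happens only for even `p`). -/
def majmod (p : ℕ) (s : ZMod p) (k : ℤ) : Bool :=
  decide (¬ (2 * ((k : ZMod p) + s).val < p))

def parity {α : Type} [Fintype α] (x : α → Bool) : Bool := decide (Odd (weight x))

/-- `pmmajmod_{p,s}(d, x) = majmod_{p,s}(∑ᵢ xᵢ (-1)^{h(d)ᵢ}) ⊕ parity(x)`. -/
def pmmajmod {n : ℕ} (p : ℕ) (s : ZMod p) (d x : Fin (n - 1) → Bool) : Bool :=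
  xor (majmod p s (∑ i, if x i then (if pathSum d i then -1 else 1) else 0)) (parity x)

/-- The distribution of `(Z, pmmajmod_{p,s}(Z))` for a uniformly random `Z = (d, x)` of
`2n - 2` bits. -/
def targetDist (n p : ℕ) (s : ZMod p) : (Qubit n → Bool) → ℝ := fun z =>
  if lastBit z = pmmajmod p s (edgeBits z) (vertexBits z) then 1 / 2 ^ (2 * (n - 1)) else 0

end ShallowSampling

end

open ShallowSampling

/-!
# Shallow circuits sampling `(Z, pmmajmod (Z))`

**The poor man's GHZ state** is prepared in four layers: all vertex qubits are put into the state
`|+⟩`, and the sum of the bits at the two ends of every edge is written into the edge qubit. The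
edge bits then determine the vertex bits up to a complementation, as the path parities of the tree
(`pathSum_eq_xor`, `run_prepCircuit`).

**The circuit with the operations `A†`.** After the Hadamard gates, each of the two branches of the
state is, for fixed edge bits `d`, a product of the eigenvectors `|±⟩` of `X`. Therefore `A†` acts
on the amplitudes of a branch as a phase (`aMat_conjTranspose_character`): the bit at the cyclic
predecessor of `j` rotates the qubit `j`, whose sign is given by `h(d)_j`. The shift which follows
moves this bit to the position `j`, so that it is output as `x_j`, and the phases of all blocks
multiply to `exp (± i θ S)` with `S = ∑ᵢ xᵢ (-1) ^ h(d)ᵢ`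
(`prod_blockPhase`). The two branches interfere in the last qubit, and given `Z` it equals the
parity of `x` with probability `(1 + sin (2π (S + s) / p)) / 2` (`born_run_nonunitaryCircuit`).
Since `majmod` records the sign of this sine, the distance to the target is the mean of
`(1 - |sin (2π (S + s) / p)|) / 2`. As `d` runs over all bit strings so does `h(d)`, hence `S` is a
sum of independent bounded steps, and Fourier analysis on `ℤ/p` shows that it is equidistributed
modulo `p` up to an exponentially small error (`abs_mean_sub_le`). The mean of `|sin (2π r / p)|`
over the residues is a cotangent sum, and is at least `2/π - 1/p` (`le_mean_bias`).

**The circuit with the unitary gates `U†`.** The columns of `A` are unit vectors, and orthogonal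
except for those of complementary bit strings, whose inner product has the modulus `|sin θ| ^ k`
(`aMat_gram`). Thus the Gram–Schmidt correction `U` is unitary and differs from `A` by
`O(|sin θ| ^ k)`. The blocks are long enough that the differences of all blocks, taken together,
are `O(n ^ (-c))` (`l2norm_run_sub_run_le`, `sum_block_errors_le`, `block_error_le`), and a small
distance of states bounds the distance of the distributions (`tvDist_born_le`).

**Depth.** Every unitary on `k` qubits is exactly a product of one- and two-qubit gates whose number
depends on `k` alone (`exists_circuit_of_unitary`): Householder reflections reduce it to unitaries
`1 + c w wᴴ`, these become diagonal once `w` has been moved to a basis state, and diagonal unitaries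
are products of Walsh phases, which are conjugate to one-qubit phases under controlled NOT gates.
Blocks are treated in parallel (`exists_parallel_circuit`), and cyclic shifts of any size take two
layers of swaps, being products of two reflections (`exists_shift_circuit`).
-/

noncomputable section

namespace ShallowSampling

/-! ### Replacing bits on a set of wires -/

section Wires

variable {ι : Type} {k l : ℕ}

theorem extend_wires_apply (e : Fin k ↪ ι) (y : Fin k → Bool) (z : ι → Bool) (j : Fin k) :
    Function.extend e y z (e j) = y j :=
  e.injective.extend_apply y z j

theorem extend_wires_of_notMem (e : Fin k ↪ ι) (y : Fin k → Bool) (z : ι → Bool) {q : ι}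
    (hq : q ∉ Set.range e) : Function.extend e y z q = z q :=
  Function.extend_apply' y z q hq

theorem extend_extend_wires (e : Fin k ↪ ι) (y y' : Fin k → Bool) (z : ι → Bool) :
    Function.extend e y (Function.extend e y' z) = Function.extend e y z := by
  funext q
  by_cases hq : q ∈ Set.range e
  · obtain ⟨j, rfl⟩ := hq
    simp only [extend_wires_apply]
  · simp only [extend_wires_of_notMem e _ _ hq]

theorem extend_wires_self (e : Fin k ↪ ι) (z : ι → Bool) :
    Function.extend e (fun j => z (e j)) z = z := by
  funext q
  by_cases hq : q ∈ Set.range e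
  · obtain ⟨j, rfl⟩ := hq
    simp only [extend_wires_apply]
  · simp only [extend_wires_of_notMem e _ _ hq]

theorem extend_wires_comm (e : Fin k ↪ ι) (f : Fin l ↪ ι)
    (hd : Disjoint (Set.range e) (Set.range f)) (y : Fin k → Bool) (x : Fin l → Bool)
    (z : ι → Bool) :
    Function.extend e y (Function.extend f x z) = Function.extend f x (Function.extend e y z) := by
  funext q
  by_cases hq : q ∈ Set.range e
  · have hf : q ∉ Set.range f := Set.disjoint_left.1 hd hq
    obtain ⟨j, rfl⟩ := hq
    rw [extend_wires_of_notMem f _ _ hf]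
    simp only [extend_wires_apply]
  · by_cases hf : q ∈ Set.range f
    · rw [extend_wires_of_notMem e _ _ hq]
      obtain ⟨j, rfl⟩ := hf
      simp only [extend_wires_apply]
    · simp only [extend_wires_of_notMem e _ _ hq, extend_wires_of_notMem f _ _ hf]

theorem extend_wires_trans (e : Fin k ↪ ι) (w : Fin l ↪ Fin k) (x : Fin l → Bool)
    (y : Fin k → Bool) (z : ι → Bool) :
    Function.extend (w.trans e) x (Function.extend e y z)
      = Function.extend e (Function.extend w x y) z := by
  funext q
  by_cases hq : q ∈ Set.range e
  · obtain ⟨j, rfl⟩ := hq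
    rw [extend_wires_apply]
    by_cases hj : j ∈ Set.range w
    · obtain ⟨i, rfl⟩ := hj
      rw [extend_wires_apply]
      exact extend_wires_apply (w.trans e) x _ i
    · rw [extend_wires_of_notMem w _ _ hj, extend_wires_of_notMem, extend_wires_apply]
      rintro ⟨i, hi⟩
      exact hj ⟨i, e.injective hi⟩
  · rw [extend_wires_of_notMem e _ _ hq, extend_wires_of_notMem, extend_wires_of_notMem e _ _ hq]
    rintro ⟨i, hi⟩
    exact hq ⟨w i, hi⟩

/-- Exchanging the bits `z ∘ e` with a free string `y` is an involution on the pairs `(z, y)`,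
so a sum over all pairs may be rewritten along it. -/
theorem sum_sum_extend [Fintype ι] [DecidableEq ι] {R : Type*} [AddCommMonoid R] (e : Fin k ↪ ι)
    (F : (ι → Bool) → (Fin k → Bool) → R) :
    ∑ z, ∑ y, F (Function.extend e y z) (fun j => z (e j)) = ∑ z, ∑ y, F z y := by
  rw [← Fintype.sum_prod_type' (f := F),
    ← Fintype.sum_prod_type' (f := fun z y => F (Function.extend e y z) (fun j => z (e j)))]
  have hinv : Function.Involutive (fun p : (ι → Bool) × (Fin k → Bool) =>
      (Function.extend e p.2 p.1, fun j => p.1 (e j))) := by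
    rintro ⟨z, y⟩
    simp only [extend_wires_apply, extend_extend_wires, extend_wires_self]
  exact Fintype.sum_equiv hinv.toPerm _ _ fun _ => rfl

end Wires

/-! ### The action of gates, layers and circuits -/

section Action

variable {ι : Type} {k l : ℕ}

/-- The operator `M` on `k` qubits, placed on the wires `e`. -/
def onWires (e : Fin k ↪ ι) (M : QMat k) : Gate ι := ⟨k, e, M⟩

theorem onWires_apply (e : Fin k ↪ ι) (M : QMat k) (ψ : State ι) (z : ι → Bool) :
    (onWires e M).apply ψ z
      = ∑ y : Fin k → Bool, M (fun j => z (e j)) y * ψ (Function.extend e y z) := rfl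

theorem onWires_mul_apply (e : Fin k ↪ ι) (M N : QMat k) (ψ : State ι) :
    (onWires e (M * N)).apply ψ = (onWires e M).apply ((onWires e N).apply ψ) := by
  funext z
  simp only [onWires_apply, extend_extend_wires, extend_wires_apply, Matrix.mul_apply,
    Finset.sum_mul, Finset.mul_sum]
  rw [Finset.sum_comm]
  exact Finset.sum_congr rfl fun _ _ => Finset.sum_congr rfl fun _ _ => by ring

theorem onWires_one_apply (e : Fin k ↪ ι) (ψ : State ι) : (onWires e 1).apply ψ = ψ := by
  funext z
  simp [onWires_apply, Matrix.one_apply, extend_wires_self]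

theorem onWires_sub_apply (e : Fin k ↪ ι) (M N : QMat k) (ψ : State ι) :
    (onWires e (M - N)).apply ψ = (onWires e M).apply ψ - (onWires e N).apply ψ := by
  funext z
  simp [onWires_apply, sub_mul, Finset.sum_sub_distrib]

theorem Gate.apply_add (g : Gate ι) (ψ φ : State ι) :
    g.apply (ψ + φ) = g.apply ψ + g.apply φ := by
  funext z
  simp [Gate.apply, mul_add, Finset.sum_add_distrib]

theorem Gate.apply_sub (g : Gate ι) (ψ φ : State ι) :
    g.apply (ψ - φ) = g.apply ψ - g.apply φ := by
  funext z
  simp [Gate.apply, mul_sub, Finset.sum_sub_distrib]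

/-- Operators on disjoint sets of wires commute. -/
theorem Gate.apply_comm (g h : Gate ι) (hd : Disjoint (Set.range g.wires) (Set.range h.wires))
    (ψ : State ι) : g.apply (h.apply ψ) = h.apply (g.apply ψ) := by
  funext z
  have h1 : ∀ y j, Function.extend g.wires y z (h.wires j) = z (h.wires j) := fun y j =>
    extend_wires_of_notMem _ _ _ fun hq => Set.disjoint_left.1 hd hq ⟨j, rfl⟩
  have h2 : ∀ y j, Function.extend h.wires y z (g.wires j) = z (g.wires j) := fun y j =>
    extend_wires_of_notMem _ _ _ fun hq => Set.disjoint_left.1 hd ⟨j, rfl⟩ hq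
  simp only [Gate.apply, h1, h2, Finset.mul_sum]
  rw [Finset.sum_comm]
  refine Finset.sum_congr rfl fun x _ => Finset.sum_congr rfl fun y _ => ?_
  rw [extend_wires_comm _ _ hd]
  ring

theorem Layer.run_nil (ψ : State ι) : Layer.run [] ψ = ψ := rfl

theorem Layer.run_cons (g : Gate ι) (L : Layer ι) (ψ : State ι) :
    Layer.run (g :: L) ψ = Layer.run L (g.apply ψ) := rfl

theorem Layer.run_append (L L' : Layer ι) (ψ : State ι) :
    Layer.run (L ++ L') ψ = Layer.run L' (Layer.run L ψ) := List.foldl_append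

theorem Layer.run_add (L : Layer ι) (ψ φ : State ι) :
    Layer.run L (ψ + φ) = Layer.run L ψ + Layer.run L φ := by
  induction L generalizing ψ φ with
  | nil => rfl
  | cons g L ih => simp only [Layer.run_cons, Gate.apply_add, ih]

theorem Circuit.run_nil (ψ : State ι) : Circuit.run [] ψ = ψ := rfl

theorem Circuit.run_cons (L : Layer ι) (C : Circuit ι) (ψ : State ι) :
    Circuit.run (L :: C) ψ = Circuit.run C (Layer.run L ψ) := rfl

theorem Circuit.run_append (C C' : Circuit ι) (ψ : State ι) :
    Circuit.run (C ++ C') ψ = Circuit.run C' (Circuit.run C ψ) := List.foldl_append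

theorem Circuit.run_add (C : Circuit ι) (ψ φ : State ι) :
    Circuit.run C (ψ + φ) = Circuit.run C ψ + Circuit.run C φ := by
  induction C generalizing ψ φ with
  | nil => rfl
  | cons L C ih => simp only [Circuit.run_cons, Layer.run_add, ih]

theorem Layer.run_gate_comm (g : Gate ι) (L : Layer ι)
    (hd : ∀ h ∈ L, Disjoint (Set.range g.wires) (Set.range h.wires)) (ψ : State ι) :
    Layer.run L (g.apply ψ) = g.apply (Layer.run L ψ) := by
  induction L generalizing ψ with
  | nil => rfl
  | cons h L ih =>
    rw [Layer.run_cons, Layer.run_cons, ← ih fun h' hh' => hd h' (List.mem_cons_of_mem _ hh'),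
      Gate.apply_comm g h (hd h List.mem_cons_self)]

theorem Layer.run_comm (L L' : Layer ι)
    (hd : ∀ g ∈ L, ∀ h ∈ L', Disjoint (Set.range g.wires) (Set.range h.wires)) (ψ : State ι) :
    Layer.run L' (Layer.run L ψ) = Layer.run L (Layer.run L' ψ) := by
  induction L generalizing ψ with
  | nil => rfl
  | cons g L ih =>
    rw [Layer.run_cons, Layer.run_cons, ih fun g' hg' => hd g' (List.mem_cons_of_mem _ hg'),
      Layer.run_gate_comm g L' (hd g List.mem_cons_self)]

/-- All gates of the circuit `C` are disjoint from all gates of the circuit `C'`. -/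
def Circuit.WiresDisjoint (C C' : Circuit ι) : Prop :=
  ∀ L ∈ C, ∀ L' ∈ C', ∀ g ∈ L, ∀ h ∈ L', Disjoint (Set.range g.wires) (Set.range h.wires)

theorem Circuit.run_layer_comm (L : Layer ι) (C : Circuit ι)
    (hd : ∀ L' ∈ C, ∀ g ∈ L, ∀ h ∈ L', Disjoint (Set.range g.wires) (Set.range h.wires))
    (ψ : State ι) : Circuit.run C (Layer.run L ψ) = Layer.run L (Circuit.run C ψ) := by
  induction C generalizing ψ with
  | nil => rfl
  | cons L' C ih =>
    rw [Circuit.run_cons, Circuit.run_cons, ← ih fun M hM => hd M (List.mem_cons_of_mem _ hM),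
      Layer.run_comm L L' (hd L' List.mem_cons_self)]

/-- Parallel execution: two circuits of equal length on disjoint sets of wires may be run layer
by layer at the same time. -/
theorem Circuit.run_zipWith (C C' : Circuit ι) (hlen : C.length = C'.length)
    (hd : Circuit.WiresDisjoint C C') (ψ : State ι) :
    Circuit.run (List.zipWith (· ++ ·) C C') ψ = Circuit.run C' (Circuit.run C ψ) := by
  induction C generalizing C' ψ with
  | nil =>
    obtain rfl : C' = [] := List.length_eq_zero_iff.1 hlen.symm
    rfl
  | cons L C ih =>
    obtain _ | ⟨L', C'⟩ := C'
    · simp at hlen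
    · simp only [List.length_cons, add_left_inj] at hlen
      simp only [List.zipWith_cons_cons, Circuit.run_cons, Layer.run_append]
      rw [ih C' hlen fun M hM M' hM' => hd M (List.mem_cons_of_mem _ hM) M'
        (List.mem_cons_of_mem _ hM'), Circuit.run_layer_comm L' C]
      intro M hM g hg h hh
      exact (hd M (List.mem_cons_of_mem _ hM) L' List.mem_cons_self h hh g hg).symm

theorem Circuit.isOver_append {S : Gate ι → Prop} {C C' : Circuit ι} (h : C.IsOver S)
    (h' : C'.IsOver S) : Circuit.IsOver S (C ++ C') := by
  intro L hL
  rcases List.mem_append.1 hL with hL | hL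
  · exact h L hL
  · exact h' L hL

theorem Circuit.IsOver.mono {S T : Gate ι → Prop} {C : Circuit ι} (h : C.IsOver S)
    (hST : ∀ g, S g → T g) : C.IsOver T :=
  fun L hL => ⟨fun g hg => hST g ((h L hL).1 g hg), (h L hL).2⟩

theorem Circuit.isOver_zipWith {S : Gate ι → Prop} {C C' : Circuit ι} (h : C.IsOver S)
    (h' : C'.IsOver S) (hd : Circuit.WiresDisjoint C C') :
    Circuit.IsOver S (List.zipWith (· ++ ·) C C') := by
  intro M hM
  obtain ⟨L, hL, L', hL', rfl⟩ : ∃ L ∈ C, ∃ L' ∈ C', M = L ++ L' := by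
    clear h h' hd
    induction C generalizing C' with
    | nil => simp at hM
    | cons L C ih =>
      obtain _ | ⟨L', C'⟩ := C'
      · simp at hM
      · rcases List.mem_cons.1 (by simpa using hM) with rfl | hM
        · exact ⟨L, List.mem_cons_self, L', List.mem_cons_self, rfl⟩
        · obtain ⟨N, hN, N', hN', rfl⟩ := ih hM
          exact ⟨N, List.mem_cons_of_mem _ hN, N', List.mem_cons_of_mem _ hN', rfl⟩
  refine ⟨fun g hg => ?_, List.pairwise_append.2 ⟨(h L hL).2, (h' L' hL').2,
    fun g hg g' hg' => hd L hL L' hL' g hg g' hg'⟩⟩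
  rcases List.mem_append.1 hg with hg | hg
  · exact (h L hL).1 g hg
  · exact (h' L' hL').1 g hg

end Action

/-! ### Circuits on a block of wires -/

section Blocks

variable {ι : Type} {k : ℕ}

/-- A gate on `Fin k`, transported along an embedding of wires. -/
def Gate.map (e : Fin k ↪ ι) (g : Gate (Fin k)) : Gate ι := onWires (g.wires.trans e) g.mat

/-- A circuit on `Fin k`, transported gate by gate along an embedding of wires. -/
def Circuit.map (e : Fin k ↪ ι) (C : Circuit (Fin k)) : Circuit ι :=
  List.map (List.map (Gate.map e)) C

/-- The state of the wires `e` when the other bits are fixed to those of `z`. -/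
def slice (e : Fin k ↪ ι) (ψ : State ι) (z : ι → Bool) : State (Fin k) :=
  fun y => ψ (Function.extend e y z)

theorem slice_gate_map (e : Fin k ↪ ι) (g : Gate (Fin k)) (ψ : State ι) (z : ι → Bool) :
    slice e ((g.map e).apply ψ) z = g.apply (slice e ψ z) := by
  funext y
  rw [slice, Gate.map, onWires_apply, Gate.apply]
  simp only [Function.Embedding.trans_apply, extend_wires_apply, extend_wires_trans, slice]

theorem slice_layer_map (e : Fin k ↪ ι) (L : Layer (Fin k)) (ψ : State ι) (z : ι → Bool) :
    slice e (Layer.run (L.map (Gate.map e)) ψ) z = Layer.run L (slice e ψ z) := by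
  induction L generalizing ψ with
  | nil => rfl
  | cons g L ih => rw [List.map_cons, Layer.run_cons, Layer.run_cons, ih, slice_gate_map]

theorem slice_circuit_map (e : Fin k ↪ ι) (C : Circuit (Fin k)) (ψ : State ι) (z : ι → Bool) :
    slice e (Circuit.run (C.map e) ψ) z = Circuit.run C (slice e ψ z) := by
  induction C generalizing ψ with
  | nil => rfl
  | cons L C ih =>
    rw [Circuit.map, List.map_cons, Circuit.run_cons, Circuit.run_cons, ← Circuit.map, ih,
      slice_layer_map]

/-- A circuit on `k` qubits which implements the matrix `M` implements the operator `M` on any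
`k` wires. -/
theorem Circuit.run_map_eq (e : Fin k ↪ ι) (C : Circuit (Fin k)) (M : QMat k)
    (hC : ∀ φ, C.run φ = M.mulVec φ) (ψ : State ι) :
    Circuit.run (C.map e) ψ = (onWires e M).apply ψ := by
  funext z
  have h := congrFun (slice_circuit_map e C ψ z) (fun j => z (e j))
  rw [hC, slice, extend_wires_self] at h
  rw [h]
  rfl

theorem Gate.range_map_wires (e : Fin k ↪ ι) (g : Gate (Fin k)) :
    Set.range (g.map e).wires = e '' Set.range g.wires := by
  change Set.range (g.wires.trans e) = _
  rw [← Set.range_comp]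
  rfl

theorem Gate.range_map_wires_subset (e : Fin k ↪ ι) (g : Gate (Fin k)) :
    Set.range (g.map e).wires ⊆ Set.range e := by
  rw [Gate.range_map_wires]
  exact Set.image_subset_range _ _

theorem Circuit.isOver_map {e : Fin k ↪ ι} {C : Circuit (Fin k)} (h : C.IsOver IsOneTwoUnitary) :
    Circuit.IsOver IsOneTwoUnitary (C.map e) := by
  intro M hM
  obtain ⟨L, hL, rfl⟩ := List.mem_map.1 hM
  refine ⟨fun g hg => ?_, List.pairwise_map.2 ((h L hL).2.imp fun {g g'} hd => ?_)⟩
  · obtain ⟨g', hg', rfl⟩ := List.mem_map.1 hg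
    exact (h L hL).1 g' hg'
  · rw [Gate.range_map_wires, Gate.range_map_wires]
    exact (Set.disjoint_image_iff e.injective).2 hd

/-- The operators `M i` on disjoint blocks of wires `e i` can be performed in parallel by circuits
of a common length `N`. -/
theorem exists_parallel_circuit {β : Type} (l : List β) (κ : β → ℕ) (e : ∀ b, Fin (κ b) ↪ ι)
    (M : ∀ b, QMat (κ b)) (N : ℕ)
    (hdisj : l.Pairwise fun b b' => Disjoint (Set.range (e b)) (Set.range (e b')))
    (hM : ∀ b ∈ l, ∃ C : Circuit (Fin (κ b)), C.IsOver IsOneTwoUnitary ∧ C.length = N ∧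
      ∀ φ, C.run φ = (M b).mulVec φ) :
    ∃ C : Circuit ι, C.IsOver IsOneTwoUnitary ∧ C.length = N ∧
      (∀ L ∈ C, ∀ g ∈ L, ∃ b ∈ l, Set.range g.wires ⊆ Set.range (e b)) ∧
      ∀ ψ, C.run ψ = Layer.run (l.map fun b => onWires (e b) (M b)) ψ := by
  induction l with
  | nil =>
    refine ⟨List.replicate N [], ?_, List.length_replicate, ?_, fun ψ => ?_⟩
    · intro L hL
      obtain rfl := List.eq_of_mem_replicate hL
      simp
    · intro L hL
      obtain rfl := List.eq_of_mem_replicate hL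
      simp
    · induction N with
      | zero => rfl
      | succ N ih => exact ih (by simp)
  | cons b l ih =>
    rw [List.pairwise_cons] at hdisj
    obtain ⟨C, hC, hlen, hran, hrun⟩ := ih hdisj.2 fun b' hb' => hM b' (List.mem_cons_of_mem _ hb')
    obtain ⟨Cb, hCb, hlenb, hrunb⟩ := hM b List.mem_cons_self
    have hranb : ∀ L ∈ Cb.map (e b), ∀ g ∈ L, Set.range g.wires ⊆ Set.range (e b) := by
      intro L hL g hg
      obtain ⟨L', _, rfl⟩ := List.mem_map.1 hL
      obtain ⟨g', _, rfl⟩ := List.mem_map.1 hg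
      exact Gate.range_map_wires_subset _ _
    have hd : Circuit.WiresDisjoint (Cb.map (e b)) C := by
      intro L hL L' hL' g hg h hh
      obtain ⟨b', hb', hsub⟩ := hran L' hL' h hh
      exact (hdisj.1 b' hb').mono (hranb L hL g hg) hsub
    have hlen' : (Cb.map (e b)).length = C.length := by
      rw [hlen, Circuit.map, List.length_map, hlenb]
    refine ⟨List.zipWith (· ++ ·) (Cb.map (e b)) C,
      Circuit.isOver_zipWith (Circuit.isOver_map hCb) hC hd, ?_, ?_, fun ψ => ?_⟩
    · rw [List.length_zipWith, hlen', hlen, min_self]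
    · intro L hL g hg
      obtain ⟨i, hi, rfl⟩ := List.getElem_of_mem hL
      rw [List.getElem_zipWith] at hg
      rcases List.mem_append.1 hg with hg | hg
      · exact ⟨b, List.mem_cons_self, hranb _ (List.getElem_mem _) g hg⟩
      · obtain ⟨b', hb', hsub⟩ := hran _ (List.getElem_mem _) g hg
        exact ⟨b', List.mem_cons_of_mem _ hb', hsub⟩
    · rw [Circuit.run_zipWith _ _ hlen' hd, hrun, Circuit.run_map_eq (e b) Cb (M b) hrunb]
      rfl

end Blocks

/-! ### Norms of state vectors -/

section Norm

variable {ι : Type} [Fintype ι] {k : ℕ}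

/-- The Hilbert space norm of a state vector. -/
def l2norm {α : Type} [Fintype α] (ψ : α → ℂ) : ℝ := Real.sqrt (∑ z, ‖ψ z‖ ^ 2)

theorem l2norm_eq {α : Type} [Fintype α] (ψ : α → ℂ) :
    l2norm ψ = ‖(WithLp.toLp 2 ψ : EuclideanSpace ℂ α)‖ := by
  rw [EuclideanSpace.norm_eq]
  rfl

theorem l2norm_nonneg {α : Type} [Fintype α] (ψ : α → ℂ) : 0 ≤ l2norm ψ := Real.sqrt_nonneg _

theorem l2norm_sq {α : Type} [Fintype α] (ψ : α → ℂ) : l2norm ψ ^ 2 = ∑ z, ‖ψ z‖ ^ 2 :=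
  Real.sq_sqrt (Finset.sum_nonneg fun _ _ => sq_nonneg _)

theorem l2norm_add_le {α : Type} [Fintype α] (ψ φ : α → ℂ) :
    l2norm (ψ + φ) ≤ l2norm ψ + l2norm φ := by
  simp only [l2norm_eq, WithLp.toLp_add]
  exact norm_add_le _ _

variable [DecidableEq ι]

theorem inner_onWires_apply (e : Fin k ↪ ι) (M : QMat k) (φ ψ : State ι) :
    ∑ z, star ((onWires e M).apply φ z) * ψ z
      = ∑ z, star (φ z) * (onWires e M.conjTranspose).apply ψ z := by
  simp only [onWires_apply, star_sum, Finset.sum_mul, Finset.mul_sum, star_mul']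
  rw [← sum_sum_extend e]
  refine Finset.sum_congr rfl fun z _ => Finset.sum_congr rfl fun y _ => ?_
  simp only [extend_extend_wires, extend_wires_apply, extend_wires_self, Matrix.conjTranspose_apply]
  ring

theorem l2norm_gate_apply (g : Gate ι)
    (hg : g.mat ∈ Matrix.unitaryGroup (Fin g.arity → Bool) ℂ) (ψ : State ι) :
    l2norm (g.apply ψ) = l2norm ψ := by
  have h := inner_onWires_apply g.wires g.mat ψ ((onWires g.wires g.mat).apply ψ)
  rw [← onWires_mul_apply, ← Matrix.star_eq_conjTranspose, Matrix.mem_unitaryGroup_iff'.1 hg,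
    onWires_one_apply] at h
  have h2 : ∀ φ : State ι, ∑ z, star (φ z) * φ z = ((∑ z, ‖φ z‖ ^ 2 : ℝ) : ℂ) := by
    intro φ
    push_cast
    exact Finset.sum_congr rfl fun z _ => Complex.conj_mul' _
  rw [h2, h2, Complex.ofReal_inj] at h
  exact congrArg Real.sqrt h

theorem l2norm_layer_run (L : Layer ι)
    (hL : ∀ g ∈ L, g.mat ∈ Matrix.unitaryGroup (Fin g.arity → Bool) ℂ) (ψ : State ι) :
    l2norm (Layer.run L ψ) = l2norm ψ := by
  induction L generalizing ψ with
  | nil => rfl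
  | cons g L ih =>
    rw [Layer.run_cons, ih fun h hh => hL h (List.mem_cons_of_mem _ hh),
      l2norm_gate_apply g (hL g List.mem_cons_self)]

theorem l2norm_circuit_run (C : Circuit ι) (hC : C.IsOver IsOneTwoUnitary) (ψ : State ι) :
    l2norm (C.run ψ) = l2norm ψ := by
  induction C generalizing ψ with
  | nil => rfl
  | cons L C ih =>
    rw [Circuit.run_cons, ih fun M hM => hC M (List.mem_cons_of_mem _ hM),
      l2norm_layer_run L fun g hg => ((hC L List.mem_cons_self).1 g hg).2]

theorem l2norm_zeroState : l2norm (zeroState ι) = 1 := by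
  rw [l2norm, Real.sqrt_eq_one, Finset.sum_eq_single (fun _ => false)]
  · simp [zeroState]
  · intro z _ hz
    simp [zeroState, hz]
  · simp

/-- An operator on `k` qubits with entries of modulus at most `ε` has norm at most `2 ^ k * ε`. -/
theorem l2norm_onWires_apply_le (e : Fin k ↪ ι) (M : QMat k) {ε : ℝ} (hε : 0 ≤ ε)
    (hM : ∀ x y, ‖M x y‖ ≤ ε) (ψ : State ι) :
    l2norm ((onWires e M).apply ψ) ≤ 2 ^ k * ε * l2norm ψ := by
  have hcard : (Finset.univ : Finset (Fin k → Bool)).card = 2 ^ k := by simp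
  have hpt : ∀ z, ‖(onWires e M).apply ψ z‖ ^ 2
      ≤ ε ^ 2 * 2 ^ k * ∑ y : Fin k → Bool, ‖ψ (Function.extend e y z)‖ ^ 2 := by
    intro z
    have h1 : ‖(onWires e M).apply ψ z‖ ≤ ε * ∑ y : Fin k → Bool, ‖ψ (Function.extend e y z)‖ := by
      rw [onWires_apply, Finset.mul_sum]
      refine (norm_sum_le _ _).trans (Finset.sum_le_sum fun y _ => ?_)
      rw [norm_mul]
      exact mul_le_mul_of_nonneg_right (hM _ _) (norm_nonneg _)
    have h2 := sq_sum_le_card_mul_sum_sq (s := (Finset.univ : Finset (Fin k → Bool)))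
      (f := fun y => ‖ψ (Function.extend e y z)‖)
    rw [hcard] at h2
    push_cast at h2
    calc _ ≤ (ε * ∑ y : Fin k → Bool, ‖ψ (Function.extend e y z)‖) ^ 2 :=
          pow_le_pow_left₀ (norm_nonneg _) h1 2
      _ = ε ^ 2 * (∑ y : Fin k → Bool, ‖ψ (Function.extend e y z)‖) ^ 2 := by ring
      _ ≤ ε ^ 2 * (2 ^ k * ∑ y : Fin k → Bool, ‖ψ (Function.extend e y z)‖ ^ 2) :=
          mul_le_mul_of_nonneg_left h2 (sq_nonneg _)
      _ = _ := by ring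
  have hsum : ∑ z, ‖(onWires e M).apply ψ z‖ ^ 2 ≤ (2 ^ k * ε) ^ 2 * ∑ z, ‖ψ z‖ ^ 2 := by
    refine (Finset.sum_le_sum fun z _ => hpt z).trans (le_of_eq ?_)
    rw [← Finset.mul_sum, sum_sum_extend e fun z _ => ‖ψ z‖ ^ 2]
    simp only [Finset.sum_const, hcard, nsmul_eq_mul]
    rw [← Finset.mul_sum]
    push_cast
    ring
  rw [l2norm, l2norm, ← Real.sqrt_sq (by positivity : 0 ≤ 2 ^ k * ε), ← Real.sqrt_mul (sq_nonneg _)]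
  exact Real.sqrt_le_sqrt hsum

theorem isProbDist_born_of_l2norm {ψ : State ι} (hψ : l2norm ψ = 1) : IsProbDist (born ψ) :=
  ⟨fun _ => sq_nonneg _, by rw [← one_pow 2, ← hψ, l2norm_sq]; rfl⟩

theorem sum_norm_mul_norm_le {α : Type} [Fintype α] (ψ φ : α → ℂ) :
    ∑ z, ‖ψ z‖ * ‖φ z‖ ≤ l2norm ψ * l2norm φ := by
  have h := Finset.sum_mul_sq_le_sq_mul_sq Finset.univ (fun z => ‖ψ z‖) (fun z => ‖φ z‖)
  rw [← l2norm_sq, ← l2norm_sq, ← mul_pow] at h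
  exact abs_le_of_sq_le_sq' h (mul_nonneg (l2norm_nonneg _) (l2norm_nonneg _)) |>.2

/-- Measuring two normalised states gives distributions at total variation distance at most the
norm of the difference of the states. -/
theorem tvDist_born_le {ψ φ : State ι} (hψ : l2norm ψ = 1) (hφ : l2norm φ = 1) :
    tvDist (born ψ) (born φ) ≤ l2norm (ψ - φ) := by
  have hpt : ∀ z, |born ψ z - born φ z|
      ≤ ‖(ψ - φ) z‖ * ‖ψ z‖ + ‖(ψ - φ) z‖ * ‖φ z‖ := by
    intro z
    have h : |‖ψ z‖ - ‖φ z‖| ≤ ‖(ψ - φ) z‖ := abs_norm_sub_norm_le _ _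
    have h2 : born ψ z - born φ z = (‖ψ z‖ - ‖φ z‖) * (‖ψ z‖ + ‖φ z‖) := by
      simp only [born]; ring
    rw [h2, abs_mul, abs_of_nonneg (by positivity : 0 ≤ ‖ψ z‖ + ‖φ z‖), ← mul_add]
    exact mul_le_mul_of_nonneg_right h (by positivity)
  have h1 := sum_norm_mul_norm_le (ψ - φ) ψ
  have h2 := sum_norm_mul_norm_le (ψ - φ) φ
  rw [hψ] at h1
  rw [hφ] at h2
  have h3 := Finset.sum_le_sum fun z (_ : z ∈ Finset.univ) => hpt z
  rw [Finset.sum_add_distrib] at h3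
  rw [tvDist]
  linarith

theorem tvDist_triangle {α : Type} [Fintype α] (P Q R : α → ℝ) :
    tvDist P R ≤ tvDist P Q + tvDist Q R := by
  rw [tvDist, tvDist, tvDist, ← mul_add, ← Finset.sum_add_distrib]
  exact mul_le_mul_of_nonneg_left (Finset.sum_le_sum fun z _ => abs_sub_le _ _ _) (by norm_num)

end Norm

/-! ### One- and two-qubit gates -/

section Gates

variable {ι : Type}

theorem oneQubitGate_apply [DecidableEq ι] (w : ι) (V : Matrix Bool Bool ℂ) (ψ : State ι)
    (z : ι → Bool) :
    (oneQubitGate w V).apply ψ z = ∑ b, V (z w) b * ψ (Function.update z w b) := by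
  rw [Gate.apply]
  refine Fintype.sum_equiv (Equiv.funUnique (Fin 1) Bool) _ _ fun y => ?_
  have h : Function.extend (oneQubitGate w V).wires y z = Function.update z w (y 0) := by
    funext q
    by_cases hq : q = w
    · subst hq
      rw [Function.update_self]
      exact extend_wires_apply (oneQubitGate q V).wires y z (0 : Fin 1)
    · rw [Function.update_of_ne hq]
      exact extend_wires_of_notMem _ _ _ fun ⟨_, hj⟩ => hq hj.symm
  rw [h]
  rfl

theorem isOneTwoUnitary_oneQubitGate (w : ι) {V : Matrix Bool Bool ℂ}
    (hV : V ∈ Matrix.unitaryGroup Bool ℂ) : IsOneTwoUnitary (oneQubitGate w V) := by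
  refine ⟨Or.inl rfl, ?_⟩
  change V.submatrix (Equiv.funUnique (Fin 1) Bool) (Equiv.funUnique (Fin 1) Bool)
    ∈ Matrix.unitaryGroup (Fin 1 → Bool) ℂ
  rw [Matrix.mem_unitaryGroup_iff, Matrix.star_eq_conjTranspose, Matrix.conjTranspose_submatrix,
    Matrix.submatrix_mul_equiv, ← Matrix.star_eq_conjTranspose, Matrix.mem_unitaryGroup_iff.1 hV,
    Matrix.submatrix_one_equiv]

theorem range_oneQubitGate_wires (w : ι) (V : Matrix Bool Bool ℂ) :
    Set.range (oneQubitGate w V).wires = {w} := by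
  ext q
  simp only [Set.mem_range, Set.mem_singleton_iff]
  exact ⟨fun ⟨_, h⟩ => h.symm, fun h => ⟨(0 : Fin 1), h.symm⟩⟩

theorem hadamard_mem_unitaryGroup : hadamard ∈ Matrix.unitaryGroup Bool ℂ := by
  have h2 : (Real.sqrt 2 : ℂ) * (Real.sqrt 2 : ℂ) = 2 := by
    rw [← Complex.ofReal_mul, Real.mul_self_sqrt (by norm_num)]
    norm_num
  have h0 : (Real.sqrt 2 : ℂ) ≠ 0 := fun h => by simp [h] at h2
  rw [Matrix.mem_unitaryGroup_iff]
  ext a b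
  cases a <;> cases b <;>
    (simp [Matrix.mul_apply, hadamard, ← mul_inv, h2]; try norm_num)

theorem rotX_mem_unitaryGroup (φ : ℝ) : rotX φ ∈ Matrix.unitaryGroup Bool ℂ := by
  have h : (Real.cos φ : ℂ) * Real.cos φ + Real.sin φ * Real.sin φ = 1 := by
    rw [← Complex.ofReal_mul, ← Complex.ofReal_mul, ← Complex.ofReal_add, ← sq, ← sq,
      Real.cos_sq_add_sin_sq, Complex.ofReal_one]
  rw [Matrix.mem_unitaryGroup_iff]
  ext a b
  cases a <;> cases b <;>
    simp only [Matrix.mul_apply, Fintype.sum_bool, rotX, Matrix.of_apply, Matrix.star_apply,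
      Matrix.one_apply, if_true, reduceCtorEq, if_false, RCLike.star_def, map_mul, Complex.conj_I,
      Complex.conj_ofReal]
  · linear_combination h - (Real.sin φ : ℂ) ^ 2 * Complex.I_sq
  · ring
  · ring
  · linear_combination h - (Real.sin φ : ℂ) ^ 2 * Complex.I_sq

/-- A reversible classical operation `σ` on the bits of the wires `w`. -/
def permGate {k : ℕ} (w : Fin k ↪ ι) (σ : Equiv.Perm (Fin k → Bool)) : Gate ι :=
  onWires w (Matrix.of fun y x => if x = σ y then 1 else 0)

theorem permGate_apply {k : ℕ} (w : Fin k ↪ ι) (σ : Equiv.Perm (Fin k → Bool)) (ψ : State ι)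
    (z : ι → Bool) :
    (permGate w σ).apply ψ z = ψ (Function.extend w (σ fun j => z (w j)) z) := by
  simp [permGate, onWires_apply]

theorem permGate_mat_mem {k : ℕ} (w : Fin k ↪ ι) (σ : Equiv.Perm (Fin k → Bool)) :
    (permGate w σ).mat ∈ Matrix.unitaryGroup (Fin k → Bool) ℂ := by
  change (Matrix.of fun y x => if x = σ y then 1 else 0 : QMat k)
    ∈ Matrix.unitaryGroup (Fin k → Bool) ℂ
  rw [Matrix.mem_unitaryGroup_iff]
  ext x y
  simp [Matrix.mul_apply, Matrix.star_apply, Matrix.one_apply, eq_comm]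

/-- Two distinct wires. -/
def pairWires (a b : ι) (h : a ≠ b) : Fin 2 ↪ ι where
  toFun := ![a, b]
  inj' := by
    intro i j hij
    fin_cases i <;> fin_cases j <;> simp_all [eq_comm]

theorem pairWires_zero (a b : ι) (h : a ≠ b) : pairWires a b h 0 = a := rfl

theorem pairWires_one (a b : ι) (h : a ≠ b) : pairWires a b h 1 = b := rfl

theorem range_pairWires (a b : ι) (h : a ≠ b) : Set.range (pairWires a b h) = {a, b} := by
  change Set.range ![a, b] = _
  simp [Matrix.range_cons, Matrix.range_empty, Set.pair_comm]

theorem extend_pairWires [DecidableEq ι] (a b : ι) (h : a ≠ b) (y : Fin 2 → Bool)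
    (z : ι → Bool) : Function.extend (pairWires a b h) y z
      = Function.update (Function.update z a (y 0)) b (y 1) := by
  funext q
  by_cases hb : q = b
  · subst hb
    rw [Function.update_self]
    exact extend_wires_apply (pairWires a q h) y z 1
  · rw [Function.update_of_ne hb]
    by_cases ha : q = a
    · subst ha
      rw [Function.update_self]
      exact extend_wires_apply (pairWires q b h) y z 0
    · rw [Function.update_of_ne ha]
      refine extend_wires_of_notMem _ _ _ ?_
      simp [range_pairWires, ha, hb]

/-- The controlled NOT gate with control `a` and target `b`. -/
def cnotGate (a b : ι) (h : a ≠ b) : Gate ι :=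
  permGate (pairWires a b h)
    (Function.Involutive.toPerm (fun y => ![y 0, xor (y 1) (y 0)]) fun y => by
      funext j; fin_cases j <;> simp)

theorem cnotGate_apply [DecidableEq ι] (a b : ι) (h : a ≠ b) (ψ : State ι) (z : ι → Bool) :
    (cnotGate a b h).apply ψ z = ψ (Function.update z b (xor (z b) (z a))) := by
  rw [cnotGate, permGate_apply, extend_pairWires]
  simp [pairWires_zero, pairWires_one, Function.Involutive.toPerm]

theorem isOneTwoUnitary_cnotGate (a b : ι) (h : a ≠ b) : IsOneTwoUnitary (cnotGate a b h) :=
  ⟨Or.inr rfl, permGate_mat_mem _ _⟩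

theorem range_cnotGate_wires (a b : ι) (h : a ≠ b) :
    Set.range (cnotGate a b h).wires = {a, b} := range_pairWires a b h

/-- The gate exchanging the qubits `a` and `b`. -/
def swapGate (a b : ι) (h : a ≠ b) : Gate ι :=
  permGate (pairWires a b h)
    (Function.Involutive.toPerm (fun y => ![y 1, y 0]) fun y => by
      funext j; fin_cases j <;> simp)

theorem swapGate_apply [DecidableEq ι] (a b : ι) (h : a ≠ b) (ψ : State ι) (z : ι → Bool) :
    (swapGate a b h).apply ψ z = ψ (z ∘ Equiv.swap a b) := by
  rw [swapGate, permGate_apply, extend_pairWires]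
  congr 1
  funext q
  by_cases hb : q = b
  · subst hb
    simp [pairWires_zero, pairWires_one, Function.Involutive.toPerm]
  · by_cases ha : q = a
    · subst ha
      simp [pairWires_zero, pairWires_one, h, Function.Involutive.toPerm]
    · simp [ha, hb, Equiv.swap_apply_of_ne_of_ne]

theorem isOneTwoUnitary_swapGate (a b : ι) (h : a ≠ b) : IsOneTwoUnitary (swapGate a b h) :=
  ⟨Or.inr rfl, permGate_mat_mem _ _⟩

theorem range_swapGate_wires (a b : ι) (h : a ≠ b) :
    Set.range (swapGate a b h).wires = {a, b} := range_pairWires a b h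

end Gates

/-! ### Exact universality of one- and two-qubit gates -/

section Universality

variable {k : ℕ}

/-- The matrix of a gate on `k` qubits, the idle wires included. -/
def Gate.opMat (g : Gate (Fin k)) : QMat k := Matrix.of fun x y => g.apply (Pi.single y 1) x

theorem Gate.opMat_mulVec (g : Gate (Fin k)) (ψ : State (Fin k)) :
    g.opMat.mulVec ψ = g.apply ψ := by
  funext x
  simp only [Matrix.mulVec, dotProduct, opMat, Matrix.of_apply, Gate.apply, Finset.sum_mul]
  rw [Finset.sum_comm]
  refine Finset.sum_congr rfl fun y _ => ?_
  simp [Pi.single_apply]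

/-- `M` is a product of at most `N` one- and two-qubit unitary gates. -/
def Synth (N : ℕ) (M : QMat k) : Prop :=
  ∃ l : List (Gate (Fin k)), l.length ≤ N ∧ (∀ g ∈ l, IsOneTwoUnitary g) ∧
    ∀ ψ, Layer.run l ψ = M.mulVec ψ

theorem Synth.mono {N N' : ℕ} {M : QMat k} (h : Synth N M) (hN : N ≤ N') : Synth N' M := by
  obtain ⟨l, h1, h2, h3⟩ := h
  exact ⟨l, h1.trans hN, h2, h3⟩

theorem synth_one : Synth 0 (1 : QMat k) :=
  ⟨[], le_rfl, by simp, fun ψ => by rw [Matrix.one_mulVec]; rfl⟩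

theorem Synth.mul {N N' : ℕ} {M M' : QMat k} (h : Synth N M) (h' : Synth N' M') :
    Synth (N + N') (M * M') := by
  obtain ⟨l, h1, h2, h3⟩ := h
  obtain ⟨l', h1', h2', h3'⟩ := h'
  refine ⟨l' ++ l, ?_, fun g hg => ?_, fun ψ => ?_⟩
  · rw [List.length_append]; omega
  · rcases List.mem_append.1 hg with hg | hg
    · exact h2' g hg
    · exact h2 g hg
  · rw [Layer.run_append, h3, h3', Matrix.mulVec_mulVec]

theorem synth_opMat {g : Gate (Fin k)} (hg : IsOneTwoUnitary g) : Synth 1 g.opMat :=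
  ⟨[g], le_rfl, by simpa using hg, fun ψ => by rw [Gate.opMat_mulVec]; rfl⟩

/-- The adjoint gates in reverse order implement the adjoint operator, which is the inverse. -/
theorem exists_adjoint_list (l : List (Gate (Fin k))) (hl : ∀ g ∈ l, IsOneTwoUnitary g) :
    ∃ l' : List (Gate (Fin k)), l'.length = l.length ∧ (∀ g ∈ l', IsOneTwoUnitary g) ∧
      (∀ φ ψ : State (Fin k), ∑ z, star (Layer.run l φ z) * ψ z
        = ∑ z, star (φ z) * Layer.run l' ψ z) ∧
      ∀ ψ, Layer.run l' (Layer.run l ψ) = ψ := by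
  induction l with
  | nil => exact ⟨[], rfl, by simp, fun _ _ => rfl, fun _ => rfl⟩
  | cons g l ih =>
    obtain ⟨l', h1, h2, h3, h4⟩ := ih fun h hh => hl h (List.mem_cons_of_mem _ hh)
    have hg := hl g List.mem_cons_self
    refine ⟨l' ++ [onWires g.wires g.mat.conjTranspose], by simp [h1], fun h hh => ?_,
      fun φ ψ => ?_, fun ψ => ?_⟩
    · rcases List.mem_append.1 hh with hh | hh
      · exact h2 h hh
      · obtain rfl := List.mem_singleton.1 hh
        exact ⟨hg.1, Unitary.star_mem hg.2⟩
    · rw [Layer.run_cons, h3, Layer.run_append]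
      exact inner_onWires_apply g.wires g.mat φ _
    · rw [Layer.run_cons, Layer.run_append, h4]
      change (onWires g.wires g.mat.conjTranspose).apply ((onWires g.wires g.mat).apply ψ) = ψ
      rw [← onWires_mul_apply, ← Matrix.star_eq_conjTranspose, Matrix.mem_unitaryGroup_iff'.1 hg.2,
        onWires_one_apply]

theorem Synth.conjTranspose_and_mem {N : ℕ} {M : QMat k} (h : Synth N M) :
    Synth N M.conjTranspose ∧ M ∈ Matrix.unitaryGroup (Fin k → Bool) ℂ := by
  obtain ⟨l, h1, h2, h3⟩ := h
  obtain ⟨l', h1', h2', h3', h4'⟩ := exists_adjoint_list l h2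
  have hadj : ∀ ψ, Layer.run l' ψ = M.conjTranspose.mulVec ψ := by
    intro ψ
    funext x
    have := h3' (Pi.single x 1) ψ
    rw [h3] at this
    simpa [Pi.single_apply, Matrix.mulVec, dotProduct, apply_ite] using this.symm
  refine ⟨⟨l', h1'.trans_le h1, h2', hadj⟩, ?_⟩
  rw [Matrix.mem_unitaryGroup_iff', Matrix.star_eq_conjTranspose]
  refine Matrix.ext_of_mulVec_single fun x => ?_
  rw [← Matrix.mulVec_mulVec, ← h3, ← hadj, h4', Matrix.one_mulVec]

theorem Synth.conjTranspose {N : ℕ} {M : QMat k} (h : Synth N M) : Synth N M.conjTranspose :=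
  h.conjTranspose_and_mem.1

theorem Synth.mem_unitaryGroup {N : ℕ} {M : QMat k} (h : Synth N M) :
    M ∈ Matrix.unitaryGroup (Fin k → Bool) ℂ := h.conjTranspose_and_mem.2

theorem eq_zero_of_star_dotProduct_eq_zero {α : Type} [Fintype α] {w : α → ℂ}
    (h : star w ⬝ᵥ w = 0) : w = 0 := by
  have h2 : star w ⬝ᵥ w = ((∑ x, ‖w x‖ ^ 2 : ℝ) : ℂ) := by
    push_cast
    exact Finset.sum_congr rfl fun x _ => Complex.conj_mul' _
  rw [h2, Complex.ofReal_eq_zero,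
    Finset.sum_eq_zero_iff_of_nonneg fun _ _ => sq_nonneg _] at h
  funext x
  simpa using h x (Finset.mem_univ x)

/-- The Walsh function `x ↦ (-1) ^ (∑_{j ∈ S} x_j)`. -/
def walsh (S : Finset (Fin k)) (x : Fin k → Bool) : ℝ := ∏ j ∈ S, if x j then -1 else 1

/-- The diagonal unitary with the phases `f`. -/
def phaseMat (f : (Fin k → Bool) → ℝ) : QMat k :=
  Matrix.diagonal fun x => Complex.exp ((f x : ℂ) * Complex.I)

theorem phaseMat_add (f g : (Fin k → Bool) → ℝ) :
    phaseMat (f + g) = phaseMat f * phaseMat g := by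
  rw [phaseMat, phaseMat, phaseMat, Matrix.diagonal_mul_diagonal]
  congr 1
  funext x
  rw [← Complex.exp_add, Pi.add_apply, Complex.ofReal_add, add_mul]

theorem phaseMat_mulVec (f : (Fin k → Bool) → ℝ) (ψ : State (Fin k)) (x : Fin k → Bool) :
    (phaseMat f).mulVec ψ x = Complex.exp ((f x : ℂ) * Complex.I) * ψ x :=
  Matrix.mulVec_diagonal _ _ _

theorem synth_phaseMat_one (j : Fin k) (f : Bool → ℝ) :
    Synth 1 (phaseMat fun x => f (x j)) := by
  have hV : (Matrix.diagonal fun b => Complex.exp ((f b : ℂ) * Complex.I))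
      ∈ Matrix.unitaryGroup Bool ℂ := by
    rw [Matrix.mem_unitaryGroup_iff, Matrix.star_eq_conjTranspose, Matrix.diagonal_conjTranspose,
      Matrix.diagonal_mul_diagonal, ← Matrix.diagonal_one]
    congr 1
    funext b
    rw [Pi.star_apply, RCLike.star_def, Complex.mul_conj, Complex.normSq_eq_norm_sq,
      Complex.norm_exp_ofReal_mul_I]
    norm_num
  refine ⟨[oneQubitGate j _], le_rfl, by simpa using isOneTwoUnitary_oneQubitGate j hV,
    fun ψ => ?_⟩
  funext x
  rw [Layer.run_cons, Layer.run_nil, oneQubitGate_apply, phaseMat_mulVec,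
    Finset.sum_eq_single (x j)]
  · rw [Matrix.diagonal_apply_eq, Function.update_eq_self]
  · intro b _ hb
    rw [Matrix.diagonal_apply_ne _ hb.symm, zero_mul]
  · simp

/-- Walsh phases: adding a bit to the parity is conjugation with a controlled NOT. -/
theorem exists_synth_walsh (hk : 1 ≤ k) (S : Finset (Fin k)) :
    ∃ N, ∀ t : ℝ, Synth N (phaseMat fun x => t * walsh S x) := by
  rcases S.eq_empty_or_nonempty with rfl | hS
  · exact ⟨1, fun t => by simpa [walsh] using synth_phaseMat_one ⟨0, hk⟩ fun _ => t⟩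
  · induction hS using Finset.Nonempty.cons_induction with
    | singleton j =>
      exact ⟨1, fun t => by
        simpa [walsh] using synth_phaseMat_one j fun b => t * if b then -1 else 1⟩
    | cons a S ha hS ih =>
      obtain ⟨N, hN⟩ := ih
      obtain ⟨j, hj⟩ := hS
      have haj : a ≠ j := fun h => ha (h ▸ hj)
      have hc := synth_opMat (isOneTwoUnitary_cnotGate a j haj)
      refine ⟨1 + N + 1, fun t => ?_⟩
      convert (hc.mul (hN t)).mul hc using 1
      refine Matrix.ext_of_mulVec_single fun y => ?_
      generalize (Pi.single y 1 : State (Fin k)) = ψ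
      funext x
      rw [← Matrix.mulVec_mulVec, ← Matrix.mulVec_mulVec, Gate.opMat_mulVec, Gate.opMat_mulVec,
        cnotGate_apply, phaseMat_mulVec, phaseMat_mulVec, cnotGate_apply]
      have hx : walsh (Finset.cons a S ha) x
          = walsh S (Function.update x j (xor (x j) (x a))) := by
        rw [walsh, walsh, Finset.prod_cons, ← Finset.mul_prod_erase S _ hj,
          ← Finset.mul_prod_erase S _ hj, ← mul_assoc]
        congr 1
        · rw [Function.update_self]
          cases x a <;> cases x j <;> simp
        · refine Finset.prod_congr rfl fun i hi => ?_
          rw [Function.update_of_ne (Finset.ne_of_mem_erase hi)]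
      rw [hx]
      simp [Function.update_of_ne haj]

theorem exists_synth_sum_walsh (hk : 1 ≤ k) (T : Finset (Finset (Fin k))) :
    ∃ N, ∀ c : Finset (Fin k) → ℝ,
      Synth N (phaseMat fun x => ∑ S ∈ T, c S * walsh S x) := by
  induction T using Finset.induction_on with
  | empty =>
    refine ⟨0, fun c => ?_⟩
    convert synth_one (k := k) using 1
    simp [phaseMat]
  | insert S T hS ih =>
    obtain ⟨N, hN⟩ := ih
    obtain ⟨N', hN'⟩ := exists_synth_walsh hk S
    refine ⟨N' + N, fun c => ?_⟩
    convert (hN' (c S)).mul (hN c) using 1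
    rw [← phaseMat_add]
    congr 1
    funext x
    rw [Finset.sum_insert hS, Pi.add_apply]

/-- Every real function of `k` bits is a combination of Walsh functions. -/
theorem exists_eq_sum_walsh (f : (Fin k → Bool) → ℝ) :
    ∃ c : Finset (Fin k) → ℝ, f = fun x => ∑ S, c S * walsh S x := by
  have hδ : ∀ x y : Fin k → Bool,
      ∑ S : Finset (Fin k), walsh S y * walsh S x = if y = x then 2 ^ k else 0 := by
    intro x y
    have h := Finset.prod_one_add (f := fun j : Fin k =>
      (if y j then (-1 : ℝ) else 1) * if x j then -1 else 1) (s := Finset.univ)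
    simp only [Finset.powerset_univ, Finset.prod_mul_distrib] at h
    simp only [walsh]
    rw [← h]
    split_ifs with hxy
    · subst hxy
      have : ∀ j, (1 + (if y j then (-1 : ℝ) else 1) * if y j then -1 else 1) = 2 := by
        intro j
        split_ifs <;> norm_num
      simp only [this, Finset.prod_const, Finset.card_univ, Fintype.card_fin]
    · obtain ⟨j, hj⟩ := Function.ne_iff.1 hxy
      refine Finset.prod_eq_zero (Finset.mem_univ j) ?_
      cases hx : x j <;> cases hy : y j <;> simp_all
  refine ⟨fun S => (∑ y, f y * walsh S y) / 2 ^ k, funext fun x => ?_⟩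
  have h1 : ∑ S : Finset (Fin k), (∑ y, f y * walsh S y) / 2 ^ k * walsh S x
      = ∑ y, f y / 2 ^ k * ∑ S : Finset (Fin k), walsh S y * walsh S x := by
    simp only [Finset.mul_sum, Finset.sum_mul, Finset.sum_div]
    rw [Finset.sum_comm]
    exact Finset.sum_congr rfl fun _ _ => Finset.sum_congr rfl fun _ _ => by ring
  rw [h1]
  simp [hδ]

theorem exists_synth_phaseMat (hk : 1 ≤ k) : ∃ N, ∀ f : (Fin k → Bool) → ℝ,
    Synth N (phaseMat f) := by
  obtain ⟨N, hN⟩ := exists_synth_sum_walsh hk Finset.univ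
  refine ⟨N, fun f => ?_⟩
  obtain ⟨c, rfl⟩ := exists_eq_sum_walsh f
  exact hN c


theorem hadamard_mulVec (j : Fin k) (ψ : State (Fin k)) (x : Fin k → Bool) :
    (oneQubitGate j hadamard).opMat.mulVec ψ x
      = 1 / (Real.sqrt 2 : ℂ) * (ψ (Function.update x j false)
        + (if x j then -1 else 1) * ψ (Function.update x j true)) := by
  rw [Gate.opMat_mulVec, oneQubitGate_apply, Fintype.sum_bool]
  cases hx : x j <;> simp [hadamard] <;> ring

/-- State reduction: a circuit of bounded length moves a given vector into the span of the basis
states vanishing on a given set `J` of bits. One bit `j` is cleared by the rotations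
`exp (i α X)` of the qubit `j`, where the angle `α` depends on the other bits;
they are conjugate under Hadamard gates to a diagonal unitary. -/
theorem exists_synth_clear (hk : 1 ≤ k) (J : Finset (Fin k)) :
    ∃ N, ∀ u : State (Fin k), ∃ W : QMat k, Synth N W ∧
      ∀ x, (∃ j ∈ J, x j = true) → W.mulVec u x = 0 := by
  induction J using Finset.induction_on with
  | empty => exact ⟨0, fun u => ⟨1, synth_one, by simp⟩⟩
  | insert j J hj ih =>
    obtain ⟨N, hN⟩ := ih
    obtain ⟨N', hN'⟩ := exists_synth_phaseMat (k := k) hk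
    have hH := synth_opMat (isOneTwoUnitary_oneQubitGate j hadamard_mem_unitaryGroup)
    refine ⟨1 + N' + 1 + N' + N, fun u => ?_⟩
    obtain ⟨W, hW, hW0⟩ := hN u
    set v := W.mulVec u with hv
    -- `f` turns the amplitudes for `x j = 0, 1` into `r₀` and `-i r₁` with `r₀, r₁ ≥ 0`; between
    -- two Hadamard gates `g` is the rotation of the qubit `j` by the argument `α` of `r₀ + i r₁`,
    -- which moves the whole weight to `x j = 0`.
    let α : (Fin k → Bool) → ℝ := fun x =>
      Complex.arg (‖v (Function.update x j false)‖ + ‖v (Function.update x j true)‖ * Complex.I)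
    let f : (Fin k → Bool) → ℝ := fun x => -Complex.arg (v x) - if x j then Real.pi / 2 else 0
    let g : (Fin k → Bool) → ℝ := fun x => (if x j then -1 else 1) * α x
    refine ⟨_, (((hH.mul (hN' g)).mul hH).mul (hN' f)).mul hW, fun x hx => ?_⟩
    simp only [← Matrix.mulVec_mulVec, hadamard_mulVec, phaseMat_mulVec, ← hv,
      Function.update_idem, Function.update_self]
    by_cases hJ : ∃ i ∈ J, x i = true
    · obtain ⟨i, hi, hxi⟩ := hJ
      have hij : i ≠ j := fun h => hj (h ▸ hi)
      have h0 : ∀ b, v (Function.update x j b) = 0 := fun b =>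
        hW0 _ ⟨i, hi, by rw [Function.update_of_ne hij, hxi]⟩
      simp [h0]
    · have hxj : x j = true := by
        obtain ⟨i, hi, hxi⟩ := hx
        rcases Finset.mem_insert.1 hi with rfl | hi
        · exact hxi
        · exact absurd ⟨i, hi, hxi⟩ hJ
      have hα : ∀ b, α (Function.update x j b) = α x := by
        intro b
        simp only [α, Function.update_idem]
      have hphase : ∀ w : ℂ, Complex.exp (((-Complex.arg w : ℝ) : ℂ) * Complex.I) * w = ‖w‖ := by
        intro w
        nth_rewrite 2 [← Complex.norm_mul_exp_arg_mul_I w]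
        rw [mul_left_comm, ← Complex.exp_add]
        simp
      have hf0 : Complex.exp ((f (Function.update x j false) : ℂ) * Complex.I)
          * v (Function.update x j false) = ‖v (Function.update x j false)‖ := by
        rw [← hphase]
        simp [f]
      have hf1 : Complex.exp ((f (Function.update x j true) : ℂ) * Complex.I)
          * v (Function.update x j true) = -Complex.I * ‖v (Function.update x j true)‖ := by
        rw [← hphase, ← mul_assoc]
        congr 1
        have hI : -Complex.I = Complex.exp (((-(Real.pi / 2) : ℝ) : ℂ) * Complex.I) := by
          rw [Complex.exp_mul_I, ← Complex.ofReal_cos, ← Complex.ofReal_sin, Real.cos_neg,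
            Real.sin_neg, Real.cos_pi_div_two, Real.sin_pi_div_two]
          simp
        rw [hI, ← Complex.exp_add]
        congr 1
        simp [f]
        ring
      have hg0 : g (Function.update x j false) = α x := by simp [g, hα]
      have hg1 : g (Function.update x j true) = -α x := by simp [g, hα]
      rw [hf0, hf1, hg0, hg1, hxj]
      set r0 := ‖v (Function.update x j false)‖
      set r1 := ‖v (Function.update x j true)‖
      set ζ : ℂ := r0 + r1 * Complex.I with hζ
      have hre : r0 = ‖ζ‖ * Real.cos (α x) := by
        rw [Complex.norm_mul_cos_arg]; simp [hζ]
      have him : r1 = ‖ζ‖ * Real.sin (α x) := by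
        rw [Complex.norm_mul_sin_arg]; simp [hζ]
      rw [hre, him, Complex.ofReal_neg, Complex.exp_mul_I, Complex.exp_mul_I, Complex.cos_neg,
        Complex.sin_neg]
      push_cast
      simp
      ring_nf

/-- A unitary of the form `1 + c w wᴴ` has a circuit whose length depends on `k` alone: moving `w`
to a basis state makes it diagonal. -/
theorem exists_synth_rank_one (hk : 1 ≤ k) : ∃ N, ∀ (c : ℂ) (w : State (Fin k)),
    1 + c • Matrix.vecMulVec w (star w) ∈ Matrix.unitaryGroup (Fin k → Bool) ℂ →
      Synth N (1 + c • Matrix.vecMulVec w (star w)) := by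
  obtain ⟨N, hN⟩ := exists_synth_clear hk (Finset.univ)
  obtain ⟨N', hN'⟩ := exists_synth_phaseMat (k := k) hk
  refine ⟨N + N' + N, fun c w hR => ?_⟩
  set R : QMat k := 1 + c • Matrix.vecMulVec w (star w) with hRdef
  obtain ⟨W, hW, hW0⟩ := hN w
  have hWu := hW.mem_unitaryGroup
  have hWW : W.conjTranspose * W = 1 := Matrix.mem_unitaryGroup_iff'.1 hWu
  have hWW' : W * W.conjTranspose = 1 := Matrix.mem_unitaryGroup_iff.1 hWu
  set w' := W.mulVec w with hw'
  have hconj : W * R * W.conjTranspose = 1 + c • Matrix.vecMulVec w' (star w') := by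
    rw [hRdef, mul_add, add_mul, mul_one, hWW', Matrix.mul_smul, Matrix.smul_mul,
      Matrix.mul_vecMulVec, Matrix.vecMulVec_mul, ← Matrix.star_mulVec]
  have hdiag : 1 + c • Matrix.vecMulVec w' (star w')
      = Matrix.diagonal fun x => 1 + c * (w' x * star (w' x)) := by
    ext x y
    rcases eq_or_ne x y with rfl | hxy
    · simp [Matrix.vecMulVec_apply]
    · have h0 : w' x * star (w' y) = 0 := by
        by_cases hx : ∃ j ∈ (Finset.univ : Finset (Fin k)), x j = true
        · rw [hW0 x hx, zero_mul]
        · by_cases hy : ∃ j ∈ (Finset.univ : Finset (Fin k)), y j = true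
          · rw [hW0 y hy, star_zero, mul_zero]
          · refine absurd (funext fun j => ?_) hxy
            simp only [Finset.mem_univ, true_and, not_exists, Bool.not_eq_true] at hx hy
            rw [hx, hy]
      simpa [Matrix.vecMulVec_apply, hxy] using Or.inr h0
  have hDu : (Matrix.diagonal fun x => 1 + c * (w' x * star (w' x)))
      ∈ Matrix.unitaryGroup (Fin k → Bool) ℂ := by
    rw [← hdiag, ← hconj]
    exact mul_mem (mul_mem hWu hR) (Unitary.star_mem hWu)
  have hD : (Matrix.diagonal fun x => 1 + c * (w' x * star (w' x)))
      = phaseMat fun x => Complex.arg (1 + c * (w' x * star (w' x))) := by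
    rw [phaseMat]
    congr 1
    funext x
    rw [Matrix.mem_unitaryGroup_iff, Matrix.star_eq_conjTranspose, Matrix.diagonal_conjTranspose,
      Matrix.diagonal_mul_diagonal] at hDu
    have hx := congrFun (congrFun hDu x) x
    rw [Matrix.diagonal_apply_eq, Matrix.one_apply_eq, Pi.star_apply, RCLike.star_def,
      Complex.mul_conj, Complex.normSq_eq_norm_sq, Complex.ofReal_eq_one,
      pow_eq_one_iff_of_nonneg (norm_nonneg _) two_ne_zero] at hx
    conv_lhs => rw [← Complex.norm_mul_exp_arg_mul_I (1 + c * (w' x * star (w' x)))]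
    rw [RCLike.star_def, hx, Complex.ofReal_one, one_mul]
  have hfin : R = W.conjTranspose * (phaseMat fun x => Complex.arg (1 + c * (w' x * star (w' x))))
      * W := by
    rw [← hD, ← hdiag, ← hconj]
    calc R = (W.conjTranspose * W) * R * (W.conjTranspose * W) := by rw [hWW, one_mul, mul_one]
      _ = _ := by simp only [mul_assoc]
  rw [hfin]
  exact (hW.conjTranspose.mul (hN' _)).mul hW

/-- Householder elimination: a unitary fixing all basis states outside `T` is made to fix one more
of them by a reflection `1 + c w wᴴ` which does not disturb the others. -/
theorem exists_synth_of_fixes (hk : 1 ≤ k) (T : Finset (Fin k → Bool)) :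
    ∃ N, ∀ U ∈ Matrix.unitaryGroup (Fin k → Bool) ℂ,
      (∀ x ∉ T, U.mulVec (Pi.single x 1) = Pi.single x 1) → Synth N U := by
  obtain ⟨N', hN'⟩ := exists_synth_rank_one hk
  induction T using Finset.induction_on with
  | empty =>
    refine ⟨0, fun U _ hU => ?_⟩
    convert synth_one (k := k) using 1
    refine Matrix.ext_of_mulVec_single fun x => ?_
    rw [hU x (Finset.notMem_empty x), Matrix.one_mulVec]
  | insert a T ha ih =>
    obtain ⟨N, hN⟩ := ih
    refine ⟨N' + N, fun U hU hfix => ?_⟩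
    set v := U.mulVec (Pi.single a 1) with hv
    by_cases hva : v = Pi.single a 1
    · refine (hN U hU fun x hx => ?_).mono (Nat.le_add_left _ _)
      by_cases hxa : x = a
      · rw [hxa, ← hv, hva]
      · exact hfix x (by simp [hxa, hx])
    set w : State (Fin k) := v - Pi.single a 1 with hw
    -- `U` preserves the inner products of basis states
    have hinner : ∀ x y, star (U.mulVec (Pi.single x 1)) ⬝ᵥ U.mulVec (Pi.single y 1)
        = if x = y then 1 else 0 := by
      intro x y
      rw [Matrix.star_mulVec, Matrix.dotProduct_mulVec, Matrix.vecMul_vecMul,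
        ← Matrix.star_eq_conjTranspose, Matrix.mem_unitaryGroup_iff'.1 hU, Matrix.vecMul_one]
      simp [Pi.single_apply, eq_comm]
    have hvv : star v ⬝ᵥ v = 1 := by rw [hv, hinner, if_pos rfl]
    have hva' : star v ⬝ᵥ Pi.single a 1 = star (v a) := by simp
    have hav : star (Pi.single a 1 : State (Fin k)) ⬝ᵥ v = v a := by
      simp [dotProduct, Pi.single_apply, apply_ite]
    have haa : star (Pi.single a 1 : State (Fin k)) ⬝ᵥ Pi.single a 1 = 1 := by simp
    have hwv : star w ⬝ᵥ v = 1 - v a := by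
      rw [hw, star_sub, sub_dotProduct, hvv, hav]
    have hww : star w ⬝ᵥ w = (1 - v a) + (1 - star (v a)) := by
      rw [hw, star_sub, dotProduct_sub, sub_dotProduct, sub_dotProduct, hvv, hav, haa, hva']
      ring
    have h1 : 1 - v a ≠ 0 := by
      intro h0
      have h0' : v a = 1 := (sub_eq_zero.1 h0).symm
      rw [h0'] at hww
      simp only [star_one, sub_self, add_zero] at hww
      exact hva (sub_eq_zero.1 (eq_zero_of_star_dotProduct_eq_zero hww))
    have h1' : 1 - star (v a) ≠ 0 := by
      intro h0
      apply h1
      have := congrArg star h0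
      simpa using this
    -- With this factor the reflection maps `v` to the basis state `a`.
    set c : ℂ := -(1 - v a)⁻¹ with hc
    set R : QMat k := 1 + c • Matrix.vecMulVec w (star w) with hR
    have hRstar : star R = 1 + star c • Matrix.vecMulVec w (star w) := by
      rw [hR, star_add, star_one, star_smul, Matrix.star_eq_conjTranspose,
        Matrix.conjTranspose_vecMulVec, star_star]
    have hcc : c + star c + c * star c * (star w ⬝ᵥ w) = 0 := by
      rw [hww, hc]
      simp only [star_neg, star_inv₀, star_sub, star_one]
      field_simp
      ring
    have hRu : R ∈ Matrix.unitaryGroup (Fin k → Bool) ℂ := by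
      rw [Matrix.mem_unitaryGroup_iff, hRstar, hR]
      have hPP : Matrix.vecMulVec w (star w) * Matrix.vecMulVec w (star w)
          = (star w ⬝ᵥ w) • Matrix.vecMulVec w (star w) := by
        rw [Matrix.vecMulVec_mul_vecMulVec]
        simp [Matrix.vecMulVec_smul]
      have : (1 + c • Matrix.vecMulVec w (star w)) * (1 + star c • Matrix.vecMulVec w (star w))
          = 1 + (c + star c + c * star c * (star w ⬝ᵥ w)) • Matrix.vecMulVec w (star w) := by
        rw [mul_add, add_mul, add_mul, one_mul, one_mul, mul_one, Matrix.smul_mul, Matrix.mul_smul,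
          hPP]
        module
      rw [this, hcc, zero_smul, add_zero]
    have hRvec : ∀ u, R.mulVec u = u + (c * (star w ⬝ᵥ u)) • w := by
      intro u
      rw [hR, Matrix.add_mulVec, Matrix.one_mulVec, Matrix.smul_mulVec, Matrix.vecMulVec_mulVec,
        mul_smul]
      simp
    have hRU : Synth N (R * U) := by
      refine hN _ (mul_mem hRu hU) fun x hx => ?_
      rw [← Matrix.mulVec_mulVec]
      by_cases hxa : x = a
      · rw [hxa, ← hv, hRvec, hwv, hc, neg_mul, inv_mul_cancel₀ h1, neg_one_smul, hw]
        abel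
      · have hxf := hfix x (by simp [hxa, hx])
        have hwx : star w ⬝ᵥ Pi.single x 1 = 0 := by
          rw [hw, star_sub, sub_dotProduct, hv]
          nth_rewrite 1 [← hxf]
          rw [hinner, if_neg (Ne.symm hxa)]
          simp [hxa]
        rw [hxf, hRvec, hwx, mul_zero, zero_smul, add_zero]
    have hUeq : U = R.conjTranspose * (R * U) := by
      rw [← mul_assoc, ← Matrix.star_eq_conjTranspose, Matrix.mem_unitaryGroup_iff'.1 hRu, one_mul]
    rw [hUeq]
    exact (hN' c w hRu).conjTranspose.mul hRU

/-- Exact universality: every unitary on `k ≥ 1` qubits is a circuit of one- and two-qubit gates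
whose depth depends on `k` alone. -/
theorem exists_circuit_of_unitary (k : ℕ) (hk : 1 ≤ k) :
    ∃ N₀, ∀ N, N₀ ≤ N → ∀ U ∈ Matrix.unitaryGroup (Fin k → Bool) ℂ,
      ∃ C : Circuit (Fin k), C.IsOver IsOneTwoUnitary ∧ C.length = N ∧
        ∀ φ, C.run φ = U.mulVec φ := by
  obtain ⟨N₀, h⟩ := exists_synth_of_fixes hk Finset.univ
  refine ⟨N₀, fun N hN U hU => ?_⟩
  obtain ⟨l, h1, h2, h3⟩ := h U hU (by simp)
  -- one gate per layer, padded with empty layers to the length `N`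
  refine ⟨l.map (fun g => [g]) ++ List.replicate (N - l.length) [], ?_, ?_, fun φ => ?_⟩
  · intro L hL
    rcases List.mem_append.1 hL with hL | hL
    · obtain ⟨g, hg, rfl⟩ := List.mem_map.1 hL
      simpa using h2 g hg
    · obtain rfl := List.eq_of_mem_replicate hL
      simp
  · simp
    omega
  · rw [← h3, Circuit.run_append]
    have hrep : ∀ (m : ℕ) (ψ : State (Fin k)), Circuit.run (List.replicate m []) ψ = ψ := by
      intro m ψ
      induction m with
      | zero => rfl
      | succ m ih => exact ih
    rw [hrep, Circuit.run, Layer.run, List.foldl_map]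
    rfl

end Universality

/-! ### The gates `A` and their orthonormalisations `U` -/

section GramSchmidt

variable {k : ℕ}

theorem sum_prod_apply {ι R : Type*} [Fintype ι] [DecidableEq ι] [CommSemiring R]
    (f : ι → Bool → R) : ∑ y : ι → Bool, ∏ j, f j (y j) = ∏ j, ∑ b, f j b := by
  rw [Finset.prod_univ_sum, Fintype.piFinset_univ]

theorem rotX_inner (α β : ℝ) (a b : Bool) :
    ∑ c, star (rotX α c a) * rotX β c b = rotX (β - α) a b := by
  have hI : Complex.I ^ 2 = -1 := Complex.I_sq
  cases a <;> cases b <;>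
    simp only [Fintype.sum_bool, rotX, Matrix.of_apply, if_true, reduceCtorEq, if_false,
      RCLike.star_def, map_mul, Complex.conj_I, Complex.conj_ofReal, Real.cos_sub, Real.sin_sub] <;>
    push_cast
  · linear_combination (-Complex.sin α * Complex.sin β) * hI
  · ring
  · ring
  · linear_combination (-Complex.sin α * Complex.sin β) * hI

theorem rotX_zero (a b : Bool) : rotX 0 a b = if a = b then 1 else 0 := by
  simp [rotX]

theorem norm_rotX_le_one (φ : ℝ) (a b : Bool) : ‖rotX φ a b‖ ≤ 1 := by
  rw [rotX, Matrix.of_apply]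
  split_ifs
  · rw [Complex.norm_real]; exact Real.abs_cos_le_one φ
  · rw [norm_mul, Complex.norm_I, one_mul, Complex.norm_real]; exact Real.abs_sin_le_one φ

theorem norm_aMat_le_one (θ : ℝ) (y x : Fin k → Bool) : ‖aMat k θ y x‖ ≤ 1 := by
  rw [aMat, Matrix.of_apply, norm_prod]
  exact Finset.prod_le_one (fun _ _ => norm_nonneg _) fun _ _ => norm_rotX_le_one _ _ _

theorem flipAll_flipAll {α : Type} (x : α → Bool) : flipAll (flipAll x) = x := by
  funext j
  simp [flipAll]

theorem flipAll_injective {α : Type} : Function.Injective (flipAll (α := α)) :=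
  Function.Involutive.injective flipAll_flipAll

theorem flipAll_ne {x : Fin k → Bool} (hk : 1 ≤ k) : flipAll x ≠ x := by
  intro h
  have := congrFun h ⟨0, hk⟩
  simp [flipAll] at this

theorem neg_one_pow_weight {α R : Type} [Fintype α] [CommRing R] (x : α → Bool) :
    (-1 : R) ^ weight x = ∏ j, if x j then -1 else 1 := by
  rw [Finset.prod_ite, Finset.prod_const_one, mul_one, Finset.prod_const, weight]

theorem weight_comp_equiv {α : Type} [Fintype α] (x : α → Bool) (σ : Equiv.Perm α) :
    weight (x ∘ σ) = weight x := by
  rw [weight, weight]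
  exact Finset.card_equiv σ (by simp)

theorem weight_add_weight_flipAll {α : Type} [Fintype α] (x : α → Bool) :
    weight x + weight (flipAll x) = Fintype.card α := by
  have h := Finset.card_filter_add_card_filter_not (s := (Finset.univ : Finset α))
    (fun j => x j = true)
  simpa [weight, flipAll] using h

/-- A property of cyclically ordered positions which passes to the successor holds everywhere
as soon as it holds somewhere. -/
theorem forall_of_finRotate {P : Fin k → Prop} (h : ∀ j, P ((finRotate k).symm j) → P j)
    {i : Fin k} (hi : P i) (j : Fin k) : P j := by
  obtain _ | n := k
  · exact i.elim0
  · have hstep : ∀ m : ℕ, P (i + Fin.ofNat (n + 1) m) := by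
      intro m
      induction m with
      | zero => simpa using hi
      | succ m ih =>
        apply h
        have hm : i + Fin.ofNat (n + 1) (m + 1)
            = finRotate (n + 1) (i + Fin.ofNat (n + 1) m) := by
          rw [finRotate_apply, add_assoc]
          congr 1
          exact Fin.ext (by simp [Fin.val_add])
        rw [hm, Equiv.symm_apply_apply]
        exact ih
    have := hstep (j - i).val
    rwa [Fin.ofNat_val_eq_self, add_sub_cancel] at this

/-- The inner product `⟨A x, A x̄⟩` of the images of complementary basis states. -/
def gramPhase (k : ℕ) (θ : ℝ) (x : Fin k → Bool) : ℂ :=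
  (Complex.I * (Real.sin θ : ℂ)) ^ k * (-1) ^ weight x

/-- The Gram matrix of the columns of `A`: they are unit vectors, and two of them are orthogonal
unless they belong to complementary bit strings. Indeed the `j`-th factor of the inner product
vanishes where `x` and `x'` agree at the predecessor of `j` but not at `j`. -/
theorem aMat_gram (θ : ℝ) (x x' : Fin k → Bool) :
    ∑ y, star (aMat k θ y x) * aMat k θ y x'
      = if x' = x then 1 else if x' = flipAll x then gramPhase k θ x else 0 := by
  have h1 : ∑ y, star (aMat k θ y x) * aMat k θ y x'
      = ∏ j, rotX ((if x' ((finRotate k).symm j) then θ else 0)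
          - (if x ((finRotate k).symm j) then θ else 0)) (x j) (x' j) := by
    simp only [aMat, Matrix.of_apply, star_prod, ← Finset.prod_mul_distrib]
    rw [sum_prod_apply fun j b => star (rotX (if x ((finRotate k).symm j) then θ else 0) b (x j))
      * rotX (if x' ((finRotate k).symm j) then θ else 0) b (x' j)]
    exact Finset.prod_congr rfl fun j _ => rotX_inner _ _ _ _
  rw [h1]
  split_ifs with hx hx'
  · subst hx
    exact Finset.prod_eq_one fun j _ => by rw [sub_self, rotX_zero, if_pos rfl]
  · subst hx'
    rw [gramPhase, ← weight_comp_equiv x (finRotate k).symm, neg_one_pow_weight]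
    have h2 : (Complex.I * (Real.sin θ : ℂ)) ^ k = ∏ _j : Fin k, Complex.I * (Real.sin θ : ℂ) := by
      simp
    rw [h2, ← Finset.prod_mul_distrib]
    refine Finset.prod_congr rfl fun j _ => ?_
    have hj : (x j = flipAll x j) = False := by simp [flipAll]
    simp only [rotX, Matrix.of_apply, hj, if_false, Function.comp_apply]
    rcases Bool.eq_false_or_eq_true (x ((finRotate k).symm j)) with hp | hp
    · have hq : flipAll x ((finRotate k).symm j) = false := by rw [flipAll, hp]; rfl
      simp only [hq, hp, if_true, reduceCtorEq, if_false, zero_sub, Real.sin_neg]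
      push_cast
      ring
    · have hq : flipAll x ((finRotate k).symm j) = true := by rw [flipAll, hp]; rfl
      simp only [hq, hp, if_true, reduceCtorEq, if_false, sub_zero, mul_one]
  · obtain ⟨i, hi⟩ : ∃ i, x' i = x i := by
      by_contra hcon
      push Not at hcon
      refine hx' (funext fun j => ?_)
      have := hcon j
      rw [flipAll]
      cases h : x j <;> cases h' : x' j <;> simp_all
    have : ¬ ∀ j, x' ((finRotate k).symm j) = x ((finRotate k).symm j) → x' j = x j := by
      intro hall
      exact hx (funext fun j => forall_of_finRotate (P := fun j => x' j = x j) hall hi j)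
    push Not at this
    obtain ⟨j, hj, hj'⟩ := this
    refine Finset.prod_eq_zero (Finset.mem_univ j) ?_
    rw [hj, sub_self, rotX_zero, if_neg (Ne.symm hj')]

theorem star_gramPhase (θ : ℝ) (x : Fin k → Bool) :
    star (gramPhase k θ x) = gramPhase k θ (flipAll x) := by
  have hw := weight_add_weight_flipAll x
  rw [Fintype.card_fin] at hw
  have h1 : ((-1 : ℂ)) ^ k * (-1) ^ weight x = (-1) ^ weight (flipAll x) := by
    have hk : (-1 : ℂ) ^ k = (-1) ^ (weight x + weight (flipAll x)) := by rw [hw]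
    rw [hk, pow_add]
    have : ((-1 : ℂ)) ^ weight x * (-1) ^ weight x = 1 := by rw [← mul_pow]; simp
    linear_combination ((-1 : ℂ)) ^ weight (flipAll x) * this
  rw [gramPhase, gramPhase, ← h1]
  simp only [star_mul', star_pow, star_neg, star_one, RCLike.star_def, Complex.conj_I,
    Complex.conj_ofReal]
  rw [neg_mul, neg_pow]
  ring

theorem star_gramPhase_mul_self (θ : ℝ) (x : Fin k → Bool) :
    star (gramPhase k θ x) * gramPhase k θ x = (Real.sin θ : ℂ) ^ (2 * k) := by
  have h1 : ((-1 : ℂ)) ^ weight x * (-1) ^ weight x = 1 := by rw [← mul_pow]; simp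
  rw [gramPhase]
  simp only [star_mul', star_pow, star_neg, star_one, RCLike.star_def, Complex.conj_I,
    Complex.conj_ofReal]
  calc _ = (-Complex.I * Real.sin θ * (Complex.I * Real.sin θ)) ^ k
        * ((-1 : ℂ) ^ weight x * (-1) ^ weight x) := by rw [mul_pow]; ring
    _ = _ := by
        rw [h1, mul_one, pow_mul]
        congr 1
        linear_combination (-(Real.sin θ : ℂ) ^ 2) * Complex.I_sq

theorem uMat_coeff_eq (θ : ℝ) (x : Fin k → Bool) :
    (-1) ^ (k + 1) * Complex.I ^ (k + 2 * weight x) * (Real.sin θ : ℂ) ^ k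
      = -gramPhase k θ (flipAll x) := by
  rw [← star_gramPhase, gramPhase]
  simp only [star_mul', star_pow, star_neg, star_one, RCLike.star_def, Complex.conj_I,
    Complex.conj_ofReal]
  rw [pow_add Complex.I, pow_mul Complex.I, Complex.I_sq, pow_succ, neg_mul Complex.I,
    neg_pow (Complex.I * _), mul_pow]
  ring

theorem uMat_apply (θ : ℝ) (B : Finset (Fin k → Bool)) (y x : Fin k → Bool) :
    uMat k θ B y x = if x ∈ B then aMat k θ y x
      else (aMat k θ y x - gramPhase k θ (flipAll x) * aMat k θ y (flipAll x))
        / (Real.sqrt (1 - Real.sin θ ^ (2 * k)) : ℂ) := by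
  rw [uMat, Matrix.of_apply]
  split_ifs
  · rfl
  · rw [uMat_coeff_eq]
    ring

theorem uMat_mem_unitaryGroup (hk : 1 ≤ k) {θ : ℝ} (hθ : Real.sin θ ^ (2 * k) < 1)
    {B : Finset (Fin k → Bool)} (hB : IsHalf B) :
    uMat k θ B ∈ Matrix.unitaryGroup (Fin k → Bool) ℂ := by
  set r : ℂ := (Real.sqrt (1 - Real.sin θ ^ (2 * k)) : ℂ) with hr
  have hr2 : r * r = 1 - (Real.sin θ : ℂ) ^ (2 * k) := by
    rw [hr, ← Complex.ofReal_mul, Real.mul_self_sqrt (by linarith)]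
    push_cast
    rfl
  have hr0 : r ≠ 0 := by
    rw [hr]
    exact Complex.ofReal_ne_zero.2 (Real.sqrt_pos.2 (by linarith)).ne'
  have hrs : star r = r := Complex.conj_ofReal _
  let G : (Fin k → Bool) → (Fin k → Bool) → ℂ := fun x x' =>
    ∑ y, star (aMat k θ y x) * aMat k θ y x'
  have hG : ∀ x x', G x x' = if x' = x then 1 else if x' = flipAll x then gramPhase k θ x else 0 :=
    aMat_gram θ
  have hGs : ∀ x, G x x = 1 := fun x => by rw [hG, if_pos rfl]
  have hGf : ∀ x, G x (flipAll x) = gramPhase k θ x := fun x => by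
    rw [hG, if_neg (flipAll_ne hk), if_pos rfl]
  have hGf' : ∀ x, G (flipAll x) x = gramPhase k θ (flipAll x) := fun x => by
    rw [← hGf, flipAll_flipAll]
  have hGn : ∀ x x', x' ≠ x → x' ≠ flipAll x → G x x' = 0 := fun x x' h h' => by
    rw [hG, if_neg h, if_neg h']
  rw [Matrix.mem_unitaryGroup_iff']
  ext x x'
  rw [Matrix.mul_apply]
  simp only [Matrix.star_apply, uMat_apply, ← hr, Matrix.one_apply]
  by_cases hx : x ∈ B <;> by_cases hx' : x' ∈ B <;> simp only [hx, hx', if_true, if_false]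
  · change G x x' = _
    have h2 : x' ≠ flipAll x := fun h => (hB x).1 hx (h ▸ hx')
    by_cases h : x = x'
    · rw [← h, hGs, if_pos rfl]
    · rw [hGn x x' (Ne.symm h) h2, if_neg h]
  · have h : x ≠ x' := fun h => hx' (h ▸ hx)
    have e : ∑ y, star (aMat k θ y x) * ((aMat k θ y x'
        - gramPhase k θ (flipAll x') * aMat k θ y (flipAll x')) / r)
        = (G x x' - gramPhase k θ (flipAll x') * G x (flipAll x')) / r := by
      simp only [G, Finset.mul_sum, ← Finset.sum_sub_distrib, Finset.sum_div]
      exact Finset.sum_congr rfl fun y _ => by ring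
    rw [e, if_neg h]
    by_cases h2 : x' = flipAll x
    · subst h2
      rw [flipAll_flipAll, hGf, hGs]
      simp
    · rw [hGn x x' (Ne.symm h) h2, hGn x (flipAll x')]
      · simp
      · rintro rfl
        exact h2 (flipAll_flipAll x').symm
      · exact fun h3 => h (flipAll_injective h3).symm
  · have h : x ≠ x' := fun h => hx (h ▸ hx')
    have e : ∑ y, star ((aMat k θ y x
        - gramPhase k θ (flipAll x) * aMat k θ y (flipAll x)) / r) * aMat k θ y x'
        = (G x x' - gramPhase k θ x * G (flipAll x) x') / r := by
      simp only [G, Finset.mul_sum, ← Finset.sum_sub_distrib, Finset.sum_div]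
      refine Finset.sum_congr rfl fun y _ => ?_
      rw [star_div₀, hrs, star_sub, star_mul', star_gramPhase, flipAll_flipAll]
      ring
    rw [e, if_neg h]
    by_cases h2 : x' = flipAll x
    · subst h2
      rw [hGf, hGs]
      simp
    · rw [hGn x x' (Ne.symm h) h2, hGn (flipAll x) x' h2]
      · simp
      · rw [flipAll_flipAll]; exact Ne.symm h
  · have e : ∑ y, star ((aMat k θ y x
        - gramPhase k θ (flipAll x) * aMat k θ y (flipAll x)) / r) * ((aMat k θ y x'
        - gramPhase k θ (flipAll x') * aMat k θ y (flipAll x')) / r)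
        = (G x x' - gramPhase k θ x * G (flipAll x) x'
            - gramPhase k θ (flipAll x') * G x (flipAll x')
            + gramPhase k θ x * gramPhase k θ (flipAll x') * G (flipAll x) (flipAll x'))
          / (r * r) := by
      simp only [G, Finset.mul_sum, ← Finset.sum_sub_distrib, ← Finset.sum_add_distrib,
        Finset.sum_div]
      refine Finset.sum_congr rfl fun y _ => ?_
      rw [star_div₀, hrs, star_sub, star_mul', star_gramPhase, flipAll_flipAll]
      field_simp
      ring
    rw [e]
    by_cases h : x = x'
    · subst h
      have hn := star_gramPhase_mul_self θ x
      rw [star_gramPhase] at hn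
      rw [hGs, hGs, hGf, hGf', hr2, if_pos rfl]
      have hne : (1 : ℂ) - (Real.sin θ : ℂ) ^ (2 * k) ≠ 0 := hr2 ▸ mul_ne_zero hr0 hr0
      rw [div_eq_one_iff_eq hne]
      linear_combination -hn
    · have hfx : flipAll x ∈ B := by
        by_contra hcon
        exact hx ((hB x).2 hcon)
      have h2 : x' ≠ flipAll x := fun h2 => hx' (h2 ▸ hfx)
      have h3 : flipAll x' ≠ x := fun h3 => h2 (by rw [← h3, flipAll_flipAll])
      rw [hGn x x' (Ne.symm h) h2, hGn (flipAll x) x' h2 (by rw [flipAll_flipAll]; exact Ne.symm h),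
        hGn x (flipAll x') h3 fun h4 => h (flipAll_injective h4).symm,
        hGn (flipAll x) (flipAll x') (fun h4 => h (flipAll_injective h4).symm)
          (by rw [flipAll_flipAll]; exact h3), if_neg h]
      simp

theorem norm_gramPhase (θ : ℝ) (x : Fin k → Bool) : ‖gramPhase k θ x‖ = |Real.sin θ| ^ k := by
  rw [gramPhase, norm_mul, norm_pow, norm_pow, norm_mul, Complex.norm_I, Complex.norm_real,
    norm_neg, norm_one, one_pow, one_mul, mul_one, Real.norm_eq_abs]

/-- For small angles `U` is close to `A`: the correction is of the order `|sin θ| ^ k` of the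
inner products of the columns of `A`. -/
theorem norm_uMat_sub_aMat_le (hk : 1 ≤ k) {θ : ℝ} (hθ : |Real.sin θ| ≤ 1 / 2)
    (B : Finset (Fin k → Bool)) (y x : Fin k → Bool) :
    ‖uMat k θ B y x - aMat k θ y x‖ ≤ 4 * |Real.sin θ| ^ k := by
  have hε0 : 0 ≤ |Real.sin θ| ^ k := by positivity
  rw [uMat_apply]
  split_ifs
  · rw [sub_self, norm_zero]
    positivity
  · set ε : ℝ := |Real.sin θ| ^ k with hε
    have hε1 : ε ≤ 1 / 2 :=
      (pow_le_of_le_one (abs_nonneg _) (by linarith) (by omega)).trans hθ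
    have hs : Real.sin θ ^ (2 * k) = ε ^ 2 := by
      rw [hε, ← pow_mul, mul_comm k 2, pow_mul, pow_mul, sq_abs]
    rw [hs]
    set r := Real.sqrt (1 - ε ^ 2) with hr
    have hpos : 0 ≤ 1 - ε ^ 2 := by nlinarith
    have hr2 : r ^ 2 = 1 - ε ^ 2 := Real.sq_sqrt hpos
    have hr0 : 0 ≤ r := Real.sqrt_nonneg _
    have hrhalf : 1 / 2 ≤ r := Real.le_sqrt_of_sq_le (by nlinarith)
    have hr1 : r ≤ 1 := by nlinarith
    have hrlow : 1 - ε ^ 2 ≤ r := by nlinarith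
    have hrC : (r : ℂ) ≠ 0 := Complex.ofReal_ne_zero.2 (by linarith)
    have e : (aMat k θ y x - gramPhase k θ (flipAll x) * aMat k θ y (flipAll x)) / (r : ℂ)
        - aMat k θ y x
        = (((1 - r : ℝ) : ℂ) * aMat k θ y x
          - gramPhase k θ (flipAll x) * aMat k θ y (flipAll x)) / (r : ℂ) := by
      field_simp
      push_cast
      ring
    rw [e, norm_div, Complex.norm_real, Real.norm_of_nonneg hr0, div_le_iff₀ (by linarith)]
    have h1 : ‖((1 - r : ℝ) : ℂ) * aMat k θ y x‖ ≤ (1 - r) * 1 := by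
      rw [norm_mul, Complex.norm_real, Real.norm_of_nonneg (by linarith)]
      exact mul_le_mul_of_nonneg_left (norm_aMat_le_one _ _ _) (by linarith)
    have h2 : ‖gramPhase k θ (flipAll x) * aMat k θ y (flipAll x)‖ ≤ ε * 1 := by
      rw [norm_mul, norm_gramPhase]
      exact mul_le_mul_of_nonneg_left (norm_aMat_le_one _ _ _) hε0
    refine (norm_sub_le _ _).trans ?_
    nlinarith

end GramSchmidt

/-! ### Path parities in the balanced binary tree -/

section Tree

variable {n : ℕ}

/-- The parent of the vertex `i + 1` among the non-root vertices and the root. -/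
def parentV (i : Fin (n - 1)) : Fin (n - 1) ⊕ Unit :=
  if h : (i : ℕ) / 2 = 0 then Sum.inr () else Sum.inl ⟨(i : ℕ) / 2 - 1, by omega⟩

theorem le_of_mem_rootPath {v u : ℕ} (h : u ∈ rootPath v) : u ≤ v := by
  induction v using Nat.strong_induction_on with
  | _ v ih =>
    rw [rootPath] at h
    split_ifs at h with hv
    · simp at h
    · rcases List.mem_cons.1 h with rfl | h
      · exact le_rfl
      · exact (ih _ (by omega) h).trans (by omega)

theorem mem_rootPath_succ (i u : ℕ) :
    u ∈ rootPath (i + 1) ↔ u = i + 1 ∨ u ∈ rootPath (i / 2) := by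
  rw [rootPath, if_neg (Nat.succ_ne_zero i), List.mem_cons, Nat.add_sub_cancel]

/-- The parity at a vertex is that of its parent, changed by the connecting edge. -/
theorem pathSum_eq_xor (d : Fin (n - 1) → Bool) (i : Fin (n - 1)) :
    pathSum d i = xor (d i) (Sum.elim (pathSum d) (fun _ => false) (parentV i)) := by
  set T := Finset.univ.filter fun j : Fin (n - 1) =>
    (j : ℕ) + 1 ∈ rootPath ((i : ℕ) / 2) ∧ d j = true with hT
  have hiT : i ∉ T := by
    intro h
    have := le_of_mem_rootPath (Finset.mem_filter.1 h).2.1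
    omega
  have hpar : Sum.elim (pathSum d) (fun _ => false) (parentV i) = decide (Odd T.card) := by
    rw [parentV]
    split_ifs with h
    · have : T = ∅ := by
        rw [hT, h]
        simp [rootPath]
      simp [this]
    · have h1 : (i : ℕ) / 2 - 1 + 1 = (i : ℕ) / 2 := by omega
      simp only [Sum.elim_inl, pathSum, h1, hT]
  have hset : (Finset.univ.filter fun j : Fin (n - 1) =>
      (j : ℕ) + 1 ∈ rootPath ((i : ℕ) + 1) ∧ d j = true) = if d i then insert i T else T := by
    ext j
    have hji : ((j : ℕ) + 1 = i + 1) ↔ j = i := by rw [Fin.ext_iff]; omega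
    split_ifs with hd
    · simp only [hT, Finset.mem_filter, Finset.mem_univ, true_and, mem_rootPath_succ, hji,
        Finset.mem_insert, or_and_right]
      constructor
      · rintro (h | h)
        · exact Or.inl h.1
        · exact Or.inr h
      · rintro (h | h)
        · exact Or.inl ⟨h, h ▸ hd⟩
        · exact Or.inr h
    · simp only [hT, Finset.mem_filter, Finset.mem_univ, true_and, mem_rootPath_succ, hji,
        or_and_right]
      constructor
      · rintro (h | h)
        · exact absurd (h.1 ▸ h.2) hd
        · exact h
      · exact Or.inr
  rw [hpar, pathSum, hset]
  cases hd : d i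
  · simp
  · simp only [if_true, Finset.card_insert_of_notMem hiT, Nat.odd_add_one, decide_not, Bool.true_xor]

/-- Given the edge bits and the bit of the root, the bits of the other vertices are determined by
the condition that every edge bit is the sum of the bits of its end points. -/
theorem forall_edge_iff (d x : Fin (n - 1) → Bool) (w : Bool) :
    (∀ i, xor (d i) (xor (x i) (Sum.elim x (fun _ => w) (parentV i))) = false)
      ↔ x = fun i => xor (pathSum d i) w := by
  constructor
  · intro h
    have key : ∀ m : ℕ, ∀ i : Fin (n - 1), (i : ℕ) = m → x i = xor (pathSum d i) w := by
      intro m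
      induction m using Nat.strong_induction_on with
      | _ m ih =>
        intro i hi
        have h1 := h i
        rw [pathSum_eq_xor]
        rcases hp : parentV i with j | u
        · rw [hp] at h1
          have hj : (j : ℕ) < m := by
            rw [parentV] at hp
            split_ifs at hp with h0
            obtain rfl := Sum.inl.inj hp
            change (i : ℕ) / 2 - 1 < m
            omega
          have h2 := ih j hj j rfl
          rw [Sum.elim_inl] at h1 ⊢
          rw [h2] at h1
          revert h1
          cases x i <;> cases d i <;> cases pathSum d j <;> cases w <;> simp
        · rw [hp] at h1
          rw [Sum.elim_inr] at h1 ⊢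
          revert h1
          cases x i <;> cases d i <;> cases w <;> simp
    exact funext fun i => key i i rfl
  · rintro rfl i
    simp only
    rw [pathSum_eq_xor d i]
    rcases parentV i with j | u
    · simp only [Sum.elim_inl]
      cases d i <;> cases pathSum d j <;> cases w <;> rfl
    · simp only [Sum.elim_inr]
      cases d i <;> cases w <;> rfl

theorem pathSum_injective : Function.Injective (pathSum (n := n)) := by
  intro d d' h
  funext i
  have h1 := pathSum_eq_xor d i
  have h2 := pathSum_eq_xor d' i
  rw [h] at h1
  rw [h1] at h2
  revert h2
  generalize Sum.elim (pathSum d') (fun _ => false) (parentV i) = b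
  cases b <;> cases d i <;> cases d' i <;> simp

theorem pathSum_bijective : Function.Bijective (pathSum (n := n)) :=
  Finite.injective_iff_bijective.1 pathSum_injective

end Tree

/-! ### Hadamard gates and the preparation of the poor man's GHZ state -/

section Preparation

variable {n : ℕ}

/-- The vertex qubits, indexed by the non-root vertices and the root. -/
abbrev vq : Fin (n - 1) ⊕ Unit → Qubit n := Sum.elim vertexQ fun _ => lastQ n

theorem vq_injective : Function.Injective (vq (n := n)) := by
  rintro (i | i) (j | j) h <;> simp_all [vq, vertexQ, lastQ]

theorem edgeQ_ne_vq (i : Fin (n - 1)) (q : Fin (n - 1) ⊕ Unit) : edgeQ i ≠ vq q := by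
  rcases q with j | j <;> simp [vq, edgeQ, vertexQ, lastQ]

theorem edgeBits_update_vq (z : Qubit n → Bool) (q : Fin (n - 1) ⊕ Unit) (b : Bool) :
    edgeBits (Function.update z (vq q) b) = edgeBits z := by
  funext i
  exact Function.update_of_ne (edgeQ_ne_vq i q) _ _

/-- For every value of the edge bits, a product state of the vertex qubits. -/
def prodState (c : (Fin (n - 1) → Bool) → ℂ)
    (f : (Fin (n - 1) → Bool) → Fin (n - 1) ⊕ Unit → Bool → ℂ) : State (Qubit n) :=
  fun z => c (edgeBits z) * ∏ q, f (edgeBits z) q (z (vq q))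

theorem oneQubitGate_apply_prodState (c : (Fin (n - 1) → Bool) → ℂ)
    (f : (Fin (n - 1) → Bool) → Fin (n - 1) ⊕ Unit → Bool → ℂ) (q : Fin (n - 1) ⊕ Unit)
    (V : Matrix Bool Bool ℂ) :
    (oneQubitGate (vq q) V).apply (prodState c f)
      = prodState c fun d => Function.update (f d) q (V.mulVec (f d q)) := by
  funext z
  simp only [oneQubitGate_apply, prodState, edgeBits_update_vq]
  rw [← Finset.mul_prod_erase Finset.univ _ (Finset.mem_univ q), Function.update_self]
  have h1 : ∀ b, ∏ q', f (edgeBits z) q' (Function.update z (vq q) b (vq q'))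
      = f (edgeBits z) q b * ∏ q' ∈ Finset.univ.erase q, f (edgeBits z) q' (z (vq q')) := by
    intro b
    rw [← Finset.mul_prod_erase Finset.univ _ (Finset.mem_univ q), Function.update_self]
    congr 1
    refine Finset.prod_congr rfl fun q' hq' => ?_
    rw [Function.update_of_ne (vq_injective.ne (Finset.ne_of_mem_erase hq'))]
  have h2 : ∏ q' ∈ Finset.univ.erase q,
        Function.update (f (edgeBits z)) q (V.mulVec (f (edgeBits z) q)) q' (z (vq q'))
      = ∏ q' ∈ Finset.univ.erase q, f (edgeBits z) q' (z (vq q')) :=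
    Finset.prod_congr rfl fun q' hq' => by rw [Function.update_of_ne (Finset.ne_of_mem_erase hq')]
  simp only [h1, h2, Matrix.mulVec, dotProduct, Finset.sum_mul, Finset.mul_sum]
  exact Finset.sum_congr rfl fun b _ => by ring

open Classical in
theorem run_oneQubit_prodState (V : Matrix Bool Bool ℂ) (c : (Fin (n - 1) → Bool) → ℂ)
    (l : List (Fin (n - 1) ⊕ Unit)) (hl : l.Nodup)
    (f : (Fin (n - 1) → Bool) → Fin (n - 1) ⊕ Unit → Bool → ℂ) :
    Layer.run (l.map fun q => oneQubitGate (vq q) V) (prodState c f)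
      = prodState c fun d (q : Fin (n - 1) ⊕ Unit) =>
        if q ∈ l then V.mulVec (f d q) else f d q := by
  induction l generalizing f with
  | nil => simp [Layer.run_nil]
  | cons q l ih =>
    rw [List.map_cons, Layer.run_cons, oneQubitGate_apply_prodState, ih (List.nodup_cons.1 hl).2]
    congr 1
    funext d q'
    by_cases hq : q' = q
    · subst hq
      rw [if_neg (List.nodup_cons.1 hl).1, Function.update_self, if_pos List.mem_cons_self]
    · simp [hq]

theorem hadamardLayer_eq (n : ℕ) : hadamardLayer n
    = ((List.finRange (n - 1)).map Sum.inl ++ [Sum.inr ()]).map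
        fun q => oneQubitGate (vq q) hadamard := by
  simp [hadamardLayer, List.ofFn_eq_map, Function.comp_def]

theorem nodup_vertices (n : ℕ) :
    ((List.finRange (n - 1)).map Sum.inl ++ [Sum.inr ()] : List (Fin (n - 1) ⊕ Unit)).Nodup := by
  rw [List.nodup_append]
  refine ⟨(List.nodup_finRange _).map Sum.inl_injective, List.nodup_singleton _, ?_⟩
  simp

theorem mem_vertices (q : Fin (n - 1) ⊕ Unit) :
    q ∈ ((List.finRange (n - 1)).map Sum.inl ++ [Sum.inr ()] : List (Fin (n - 1) ⊕ Unit)) := by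
  rcases q with i | i <;> simp

/-- The sign `(-1) ^ (a b)`. -/
def bsign (a b : Bool) : ℂ := if a && b then -1 else 1


/-- The characters of the vertex bits given by `t d`. -/
def charState (c : (Fin (n - 1) → Bool) → ℂ)
    (t : (Fin (n - 1) → Bool) → Fin (n - 1) ⊕ Unit → Bool) : State (Qubit n) :=
  fun z => c (edgeBits z) * (1 / (Real.sqrt 2 : ℂ)) ^ (n - 1 + 1)
    * ∏ q, bsign (z (vq q)) (t (edgeBits z) q)

theorem hadamardLayer_run_prodState (c : (Fin (n - 1) → Bool) → ℂ)
    (t : (Fin (n - 1) → Bool) → Fin (n - 1) ⊕ Unit → Bool) :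
    Layer.run (hadamardLayer n) (prodState c fun d q b => if b = t d q then 1 else 0)
      = charState c t := by
  rw [hadamardLayer_eq, run_oneQubit_prodState _ _ _ (nodup_vertices n)]
  funext z
  simp only [mem_vertices, if_true, prodState, charState]
  have hcard : (1 / (Real.sqrt 2 : ℂ)) ^ (n - 1 + 1)
      = ∏ _q : Fin (n - 1) ⊕ Unit, 1 / (Real.sqrt 2 : ℂ) := by simp
  rw [hcard, mul_assoc, ← Finset.prod_mul_distrib]
  congr 1
  refine Finset.prod_congr rfl fun q _ => ?_
  simp only [Matrix.mulVec, dotProduct, hadamard, Matrix.of_apply, bsign]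
  cases z (vq q) <;> cases t (edgeBits z) q <;> simp

theorem prod_ite_eq_ite {α : Type} [Fintype α] (x y : α → Bool) :
    ∏ q, (if x q = y q then (1 : ℂ) else 0) = if x = y then 1 else 0 := by
  split_ifs with h
  · subst h
    simp
  · obtain ⟨q, hq⟩ := Function.ne_iff.1 h
    exact Finset.prod_eq_zero (Finset.mem_univ q) (if_neg hq)

theorem zeroState_eq : zeroState (Qubit n)
    = prodState (fun d => if d = fun _ => false then 1 else 0)
        fun _ _ b => if b = false then 1 else 0 := by
  funext z
  rw [zeroState, prodState, prod_ite_eq_ite (fun q => z (vq q)) fun _ => false]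
  by_cases h : z = fun _ => false
  · have h1 : edgeBits z = fun _ => false := by rw [h]; rfl
    have h2 : (fun q => z (vq q)) = fun _ => false := by rw [h]
    rw [if_pos h, if_pos h1, if_pos h2, mul_one]
  · rw [if_neg h]
    by_cases h1 : edgeBits z = fun _ => false
    · rw [if_neg (c := (fun q => z (vq q)) = fun _ => false), mul_zero]
      intro h2
      refine h (funext fun q => ?_)
      rcases q with (i | i) | i
      · exact congrFun h1 i
      · exact congrFun h2 (Sum.inl i)
      · exact congrFun h2 (Sum.inr ())
    · rw [if_neg h1, zero_mul]

/-- The function `pathSum`, extended to the root by the parity of the empty path. -/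
def pathSum' (d : Fin (n - 1) → Bool) : Fin (n - 1) ⊕ Unit → Bool :=
  Sum.elim (pathSum d) fun _ => false

/-- The normalisation of the poor man's GHZ state. -/
def bpmCoeff (n : ℕ) : ℂ := (1 / (Real.sqrt 2 : ℂ)) ^ (n - 1) * (1 / (Real.sqrt 2 : ℂ))

theorem bpmState_eq_ite (z : Qubit n → Bool) : bpmState n z
    = bpmCoeff n *
      if vertexBits z = (fun i => xor (pathSum (edgeBits z) i) (lastBit z)) then 1 else 0 := by
  rw [bpmState, bpmCoeff]
  congr 1
  have h1 : (fun i => xor (pathSum (edgeBits z) i) true) = flipAll (pathSum (edgeBits z)) := by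
    funext i
    simp [flipAll]
  cases lastBit z
  · simp
  · rw [h1]
    simp

/-- The state is the sum of two branches, which differ by the complementation of all vertex bits;
in each of them the edge bits determine the vertex bits. -/
theorem bpmState_eq_add (n : ℕ) : bpmState n
    = (prodState (fun _ => bpmCoeff n) fun d q b =>
        if b = xor (pathSum' d q) false then 1 else 0)
      + prodState (fun _ => bpmCoeff n) fun d q b =>
        if b = xor (pathSum' d q) true then 1 else 0 := by
  have key : ∀ (z : Qubit n → Bool) (w : Bool),
      ((fun q => z (vq q)) = fun q => xor (pathSum' (edgeBits z) q) w)
        ↔ vertexBits z = (fun i => xor (pathSum (edgeBits z) i) w) ∧ lastBit z = w := by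
    intro z w
    constructor
    · intro h
      refine ⟨funext fun i => congrFun h (Sum.inl i), ?_⟩
      have := congrFun h (Sum.inr ())
      simpa [pathSum', lastBit] using this
    · rintro ⟨h1, h2⟩
      funext q
      rcases q with i | i
      · exact congrFun h1 i
      · simpa [pathSum', lastBit] using h2
  funext z
  rw [Pi.add_apply, prodState, prodState,
    prod_ite_eq_ite (fun q => z (vq q)) fun q => xor (pathSum' (edgeBits z) q) false,
    prod_ite_eq_ite (fun q => z (vq q)) fun q => xor (pathSum' (edgeBits z) q) true,
    bpmState_eq_ite, ← mul_add]
  congr 1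
  simp only [key]
  cases lastBit z <;> simp

/-- Controlled NOT gates onto the edge qubits `i ∈ l`, with the controls `vq (c i)`. -/
def edgeCnots (c : Fin (n - 1) → Fin (n - 1) ⊕ Unit) (l : List (Fin (n - 1))) :
    Layer (Qubit n) :=
  l.map fun i => cnotGate (vq (c i)) (edgeQ i) (edgeQ_ne_vq i (c i)).symm

/-- The bit string with `z_{c i}` added to the bit of the edge `i` for all `i ∈ l`. -/
def addEdges (c : Fin (n - 1) → Fin (n - 1) ⊕ Unit) (l : List (Fin (n - 1)))
    (z : Qubit n → Bool) : Qubit n → Bool :=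
  Sum.elim (Sum.elim (fun i => xor (z (edgeQ i)) (decide (i ∈ l) && z (vq (c i))))
    fun i => z (vertexQ i)) fun _ => z (lastQ n)

theorem addEdges_vq (c : Fin (n - 1) → Fin (n - 1) ⊕ Unit) (l : List (Fin (n - 1)))
    (z : Qubit n → Bool) (q : Fin (n - 1) ⊕ Unit) : addEdges c l z (vq q) = z (vq q) := by
  rcases q with i | i <;> rfl

theorem run_edgeCnots (c : Fin (n - 1) → Fin (n - 1) ⊕ Unit) (l : List (Fin (n - 1)))
    (hl : l.Nodup) (ψ : State (Qubit n)) (z : Qubit n → Bool) :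
    Layer.run (edgeCnots c l) ψ z = ψ (addEdges c l z) := by
  induction l generalizing ψ with
  | nil =>
    rw [edgeCnots, List.map_nil, Layer.run_nil]
    congr 1
    funext q
    rcases q with (i | i) | i <;> simp [addEdges]
  | cons i l ih =>
    rw [edgeCnots, List.map_cons, Layer.run_cons, ← edgeCnots, ih (List.nodup_cons.1 hl).2,
      cnotGate_apply, addEdges_vq]
    congr 1
    funext q
    by_cases hq : q = edgeQ i
    · subst hq
      rw [Function.update_self]
      simp [addEdges, (List.nodup_cons.1 hl).1]
    · rw [Function.update_of_ne hq]
      rcases q with (j | j) | j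
      · have hj : j ≠ i := fun h => hq (by rw [h])
        simp [addEdges, hj]
      · rfl
      · rfl

theorem edgeCnots_pairwise (c : Fin (n - 1) → Fin (n - 1) ⊕ Unit) (l : List (Fin (n - 1)))
    (hl : l.Nodup) (hc : ∀ i ∈ l, ∀ j ∈ l, i ≠ j → c i ≠ c j) :
    (edgeCnots c l).Pairwise fun g h => Disjoint (Set.range g.wires) (Set.range h.wires) := by
  rw [edgeCnots, List.pairwise_map]
  refine List.Pairwise.imp_of_mem ?_ hl
  intro i j hi hj hij
  rw [range_cnotGate_wires, range_cnotGate_wires, Set.disjoint_left]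
  have h1 : vq (c i) ≠ vq (c j) := vq_injective.ne (hc i hi j hj hij)
  have h2 : (edgeQ i : Qubit n) ≠ edgeQ j := fun h => hij (by simpa [edgeQ] using h)
  intro q hq hq'
  rcases hq with rfl | rfl <;> rcases hq' with hq' | hq'
  · exact h1 hq'
  · exact edgeQ_ne_vq _ _ hq'.symm
  · exact edgeQ_ne_vq _ _ hq'
  · exact h2 hq'

theorem pairwise_oneQubit_vq (V : Matrix Bool Bool ℂ) (l : List (Fin (n - 1) ⊕ Unit))
    (hl : l.Nodup) : (l.map fun q => oneQubitGate (vq q) V).Pairwise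
      fun g h => Disjoint (Set.range g.wires) (Set.range h.wires) := by
  rw [List.pairwise_map]
  refine hl.imp fun {q q'} hq => ?_
  rw [range_oneQubitGate_wires, range_oneQubitGate_wires, Set.disjoint_singleton]
  exact vq_injective.ne hq

theorem isOver_hadamardLayer (n : ℕ) : Circuit.IsOver IsOneTwoUnitary [hadamardLayer n] := by
  intro L hL
  obtain rfl := List.mem_singleton.1 hL
  rw [hadamardLayer_eq]
  refine ⟨fun g hg => ?_, pairwise_oneQubit_vq _ _ (nodup_vertices n)⟩
  obtain ⟨q, _, rfl⟩ := List.mem_map.1 hg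
  exact isOneTwoUnitary_oneQubitGate _ hadamard_mem_unitaryGroup

/-- The preparation circuit: all vertex qubits are put into the state `|+⟩`, and the sums of the
bits at the two ends of every edge are written into the edge qubits. The edges to left and to right
children form two layers, so that no parent is used twice in a layer. -/
def prepCircuit (n : ℕ) : Circuit (Qubit n) :=
  [hadamardLayer n, edgeCnots Sum.inl (List.finRange (n - 1)),
    edgeCnots parentV ((List.finRange (n - 1)).filter fun i => (i : ℕ) % 2 = 0),
    edgeCnots parentV ((List.finRange (n - 1)).filter fun i => (i : ℕ) % 2 = 1)]

theorem parentV_ne {i j : Fin (n - 1)} (hij : i ≠ j) (h2 : (i : ℕ) % 2 = (j : ℕ) % 2) :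
    parentV i ≠ parentV j := by
  have hne : (i : ℕ) ≠ j := fun h => hij (Fin.ext h)
  rw [parentV, parentV]
  split_ifs with h h' h'
  · omega
  · simp
  · simp
  · simp only [ne_eq, Sum.inl.injEq, Fin.mk.injEq]
    omega

theorem isOver_prepCircuit (n : ℕ) : (prepCircuit n).IsOver IsOneTwoUnitary := by
  have hgate : ∀ (c : Fin (n - 1) → Fin (n - 1) ⊕ Unit) (l : List (Fin (n - 1))),
      ∀ g ∈ edgeCnots c l, IsOneTwoUnitary g := by
    intro c l g hg
    obtain ⟨i, _, rfl⟩ := List.mem_map.1 hg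
    exact isOneTwoUnitary_cnotGate _ _ _
  intro L hL
  simp only [prepCircuit, List.mem_cons, List.not_mem_nil, or_false] at hL
  rcases hL with rfl | rfl | rfl | rfl
  · exact isOver_hadamardLayer n _ (List.mem_singleton_self _)
  · exact ⟨hgate _ _, edgeCnots_pairwise _ _ (List.nodup_finRange _) fun i _ j _ hij =>
      Sum.inl_injective.ne hij⟩
  · refine ⟨hgate _ _, edgeCnots_pairwise _ _ ((List.nodup_finRange _).filter _)
      fun i hi j hj hij => parentV_ne hij ?_⟩
    simp at hi hj
    omega
  · refine ⟨hgate _ _, edgeCnots_pairwise _ _ ((List.nodup_finRange _).filter _)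
      fun i hi j hj hij => parentV_ne hij ?_⟩
    simp at hi hj
    omega

/-- The sums of neighbouring bits, written into the edge qubits, determine the vertex bits up to a
complementation: these are the path parities of the sums. -/
theorem run_prepCircuit (n : ℕ) :
    Circuit.run (prepCircuit n) (zeroState (Qubit n)) = bpmState n := by
  funext z
  simp only [prepCircuit, Circuit.run_cons, Circuit.run_nil]
  rw [run_edgeCnots _ _ ((List.nodup_finRange _).filter _),
    run_edgeCnots _ _ ((List.nodup_finRange _).filter _),
    run_edgeCnots _ _ (List.nodup_finRange _), zeroState_eq,
    hadamardLayer_run_prodState _ fun _ _ => false, bpmState_eq_ite, charState]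
  have hd : edgeBits (addEdges Sum.inl (List.finRange (n - 1)) (addEdges parentV
        ((List.finRange (n - 1)).filter fun i => (i : ℕ) % 2 = 0) (addEdges parentV
        ((List.finRange (n - 1)).filter fun i => (i : ℕ) % 2 = 1) z)))
      = fun i => xor (edgeBits z i) (xor (vertexBits z i)
          (Sum.elim (vertexBits z) (fun _ => lastBit z) (parentV i))) := by
    funext i
    have hp : z (vq (parentV i))
        = Sum.elim (vertexBits z) (fun _ => lastBit z) (parentV i) := by
      rcases parentV i with j | j <;> rfl
    have hi : (i : ℕ) % 2 = 0 ∨ (i : ℕ) % 2 = 1 := by omega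
    rw [← hp]
    change xor (xor (xor (z (edgeQ i)) _) _) _ = xor (z (edgeQ i)) (xor (z (vertexQ i)) _)
    rw [addEdges_vq, addEdges_vq, addEdges_vq]
    rcases hi with hi | hi <;> simp [hi, vq] <;>
      cases z (edgeQ i) <;> cases z (vertexQ i) <;>
      cases z (Sum.elim vertexQ (fun _ => lastQ n) (parentV i)) <;> rfl
  have hiff := funext_iff.trans (forall_edge_iff (edgeBits z) (vertexBits z) (lastBit z))
  rw [hd]
  simp only [bsign, Bool.and_false, Bool.false_eq_true, if_false, Finset.prod_const_one, mul_one,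
    hiff, bpmCoeff, pow_succ]
  ring

end Preparation

/-! ### The output amplitudes of the circuit with the operations `A†` -/

section Characters

variable {ι : Type}

theorem sum_star_rotX_mul_bsign (α : ℝ) (a t : Bool) :
    ∑ b, star (rotX α b a) * bsign b t
      = Complex.exp (((if t then α else -α : ℝ) : ℂ) * Complex.I) * bsign a t := by
  rw [Complex.exp_mul_I]
  cases a <;> cases t <;>
    simp [rotX, bsign, ← Complex.cos_conj, ← Complex.sin_conj] <;> ring

theorem sum_rotX_mul_bsign (α : ℝ) (a t : Bool) :
    ∑ b, rotX α a b * bsign b t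
      = Complex.exp (((if t then -α else α : ℝ) : ℂ) * Complex.I) * bsign a t := by
  rw [Complex.exp_mul_I]
  cases a <;> cases t <;> simp [rotX, bsign] <;> ring

theorem bsign_mul_self (a t : Bool) : bsign a t * bsign a t = 1 := by
  cases a <;> cases t <;> simp [bsign]

theorem norm_bsign (a t : Bool) : ‖bsign a t‖ = 1 := by
  cases a <;> cases t <;> simp [bsign]

/-- The phase which `A†` gives to the amplitude of `x` in the character `t`. -/
def blockPhase {k : ℕ} (θ : ℝ) (x t : Fin k → Bool) : ℂ :=
  ∏ j, Complex.exp (((if x ((finRotate k).symm j) then (if t j then θ else -θ) else 0 : ℝ) : ℂ)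
    * Complex.I)

/-- Characters, that is product states of eigenvectors `|±⟩` of `X`, are mapped by `A†` to
themselves up to a phase for every basis state. -/
theorem aMat_conjTranspose_character {k : ℕ} (θ : ℝ) (x t : Fin k → Bool) :
    ∑ y : Fin k → Bool, (aMat k θ).conjTranspose x y * ∏ j, bsign (y j) (t j)
      = blockPhase θ x t * ∏ j, bsign (x j) (t j) := by
  have h : ∀ y : Fin k → Bool, (aMat k θ).conjTranspose x y * ∏ j, bsign (y j) (t j)
      = ∏ j, star (rotX (if x ((finRotate k).symm j) then θ else 0) (y j) (x j))
          * bsign (y j) (t j) := by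
    intro y
    rw [Matrix.conjTranspose_apply, aMat, Matrix.of_apply, star_prod, Finset.prod_mul_distrib]
  simp only [h]
  rw [sum_prod_apply fun j b => star (rotX (if x ((finRotate k).symm j) then θ else 0) b (x j))
      * bsign b (t j), blockPhase, ← Finset.prod_mul_distrib]
  refine Finset.prod_congr rfl fun j _ => ?_
  rw [sum_star_rotX_mul_bsign]
  rcases Bool.eq_false_or_eq_true (x ((finRotate k).symm j)) with hx | hx <;> simp only [hx] <;>
    simp

/-- On the wires `e`, the state `ψ` is the character with the signs `τ z (e j)`. -/
def IsCharacterOn {k : ℕ} (e : Fin k ↪ ι) (τ : (ι → Bool) → ι → Bool) (ψ : State ι) : Prop :=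
  ∀ z y, ψ (Function.extend e y z)
    = (∏ j, bsign (y j) (τ z (e j))) * (∏ j, bsign (z (e j)) (τ z (e j))) * ψ z

theorem onWires_aMat_character {k : ℕ} (e : Fin k ↪ ι) (τ : (ι → Bool) → ι → Bool) (ψ : State ι)
    (hψ : IsCharacterOn e τ ψ) (θ : ℝ) (z : ι → Bool) :
    (onWires e (aMat k θ).conjTranspose).apply ψ z
      = blockPhase θ (fun j => z (e j)) (fun j => τ z (e j)) * ψ z := by
  have h := aMat_conjTranspose_character θ (fun j => z (e j)) fun j => τ z (e j)
  have hs : (∏ j, bsign (z (e j)) (τ z (e j))) * ∏ j, bsign (z (e j)) (τ z (e j)) = 1 := by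
    rw [← Finset.prod_mul_distrib]
    exact Finset.prod_eq_one fun j _ => bsign_mul_self _ _
  rw [onWires_apply]
  calc _ = ∑ y : Fin k → Bool, ((aMat k θ).conjTranspose (fun j => z (e j)) y
        * ∏ j, bsign (y j) (τ z (e j))) * ((∏ j, bsign (z (e j)) (τ z (e j))) * ψ z) :=
        Finset.sum_congr rfl fun y _ => by rw [hψ z y]; ring
    _ = _ := by
        rw [← Finset.sum_mul, h]
        linear_combination (blockPhase θ (fun j => z (e j)) fun j => τ z (e j)) * ψ z * hs

theorem run_blocks_character {β : Type} (l : List β) (κ : β → ℕ) (e : ∀ b, Fin (κ b) ↪ ι) (θ : ℝ)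
    (τ : (ι → Bool) → ι → Bool) (ψ : State ι)
    (hdisj : l.Pairwise fun b b' => Disjoint (Set.range (e b)) (Set.range (e b')))
    (hτ : ∀ b ∈ l, ∀ y z, τ (Function.extend (e b) y z) = τ z)
    (hψ : ∀ b ∈ l, IsCharacterOn (e b) τ ψ) (z : ι → Bool) :
    Layer.run (l.map fun b => onWires (e b) (aMat (κ b) θ).conjTranspose) ψ z
      = (l.map fun b => blockPhase θ (fun j => z (e b j)) fun j => τ z (e b j)).prod * ψ z := by
  induction l generalizing ψ with
  | nil => simp [Layer.run_nil]
  | cons b l ih =>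
    rw [List.pairwise_cons] at hdisj
    rw [List.map_cons, Layer.run_cons,
      ih _ hdisj.2 fun b' hb' => hτ b' (List.mem_cons_of_mem _ hb'),
      onWires_aMat_character (e b) τ ψ (hψ b List.mem_cons_self), List.map_cons, List.prod_cons]
    · ring
    · intro b' hb' z y
      have h1 : ∀ j, Function.extend (e b') y z (e b j) = z (e b j) := fun j =>
        extend_wires_of_notMem _ _ _ fun hq => Set.disjoint_left.1 (hdisj.1 b' hb') ⟨j, rfl⟩ hq
      rw [onWires_aMat_character (e b) τ ψ (hψ b List.mem_cons_self),
        onWires_aMat_character (e b) τ ψ (hψ b List.mem_cons_self),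
        hψ b' (List.mem_cons_of_mem _ hb'), hτ b' (List.mem_cons_of_mem _ hb')]
      simp only [h1]
      ring

end Characters

section Shift

variable {ι : Type} [DecidableEq ι]

theorem onWires_shiftMat_apply {k : ℕ} (e : Fin k ↪ ι) (ψ : State ι) (z : ι → Bool) :
    (onWires e (shiftMat k)).apply ψ z
      = ψ (z ∘ (finRotate k).viaFintypeEmbedding e) := by
  rw [onWires_apply, Finset.sum_eq_single fun j => z (e (finRotate k j))]
  · rw [shiftMat, Matrix.of_apply, if_pos (by simp only [Equiv.apply_symm_apply]), one_mul]
    congr 1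
    funext q
    by_cases hq : q ∈ Set.range e
    · obtain ⟨j, rfl⟩ := hq
      rw [extend_wires_apply, Function.comp_apply, Equiv.Perm.viaFintypeEmbedding_apply_image]
    · rw [extend_wires_of_notMem _ _ _ hq, Function.comp_apply,
        Equiv.Perm.viaFintypeEmbedding_apply_notMem_range _ _ hq]
  · intro y _ hy
    rw [shiftMat, Matrix.of_apply, if_neg, zero_mul]
    intro h
    refine hy (funext fun j => ?_)
    have := congrFun h (finRotate k j)
    simp only [Equiv.symm_apply_apply] at this
    exact this.symm
  · simp

/-- Cyclic shifts of disjoint blocks permute the wires. -/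
theorem exists_perm_run_shift {β : Type} (l : List β) (κ : β → ℕ) (e : ∀ b, Fin (κ b) ↪ ι)
    (hdisj : l.Pairwise fun b b' => Disjoint (Set.range (e b)) (Set.range (e b'))) :
    ∃ π : Equiv.Perm ι, (∀ ψ z, Layer.run (l.map fun b => onWires (e b) (shiftMat (κ b))) ψ z
        = ψ (z ∘ π)) ∧
      (∀ b ∈ l, ∀ j, π (e b j) = e b (finRotate (κ b) j)) ∧
      ∀ q, (∀ b ∈ l, q ∉ Set.range (e b)) → π q = q := by
  induction l with
  | nil => exact ⟨1, fun _ _ => rfl, by simp, fun _ _ => rfl⟩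
  | cons b l ih =>
    rw [List.pairwise_cons] at hdisj
    obtain ⟨π, h1, h2, h3⟩ := ih hdisj.2
    have hfix : ∀ j, π (e b j) = e b j := fun j =>
      h3 _ fun b' hb' hq => Set.disjoint_left.1 (hdisj.1 b' hb') ⟨j, rfl⟩ hq
    refine ⟨π * (finRotate (κ b)).viaFintypeEmbedding (e b), fun ψ z => ?_, fun b' hb' j => ?_,
      fun q hq => ?_⟩
    · rw [List.map_cons, Layer.run_cons, h1, onWires_shiftMat_apply]
      rfl
    · rw [Equiv.Perm.mul_apply]
      rcases List.mem_cons.1 hb' with rfl | hb'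
      · rw [Equiv.Perm.viaFintypeEmbedding_apply_image, hfix]
      · rw [Equiv.Perm.viaFintypeEmbedding_apply_notMem_range, h2 b' hb']
        exact fun hq => Set.disjoint_left.1 (hdisj.1 b' hb') hq ⟨j, rfl⟩
    · rw [Equiv.Perm.mul_apply, Equiv.Perm.viaFintypeEmbedding_apply_notMem_range _ _
        (hq b List.mem_cons_self), h3 q fun b' hb' => hq b' (List.mem_cons_of_mem _ hb')]

end Shift

section Amplitudes

variable {n m : ℕ}

theorem blockLayer_eq (n m : ℕ) (M : ∀ k : ℕ, QMat k) : blockLayer n m M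
    = (List.range (numBlocks n m)).map
        fun b => onWires (blockWires n m b) (M (blockSize n m b)) := rfl

theorem blockWires_disjoint {b b' : ℕ} (h : b ≠ b') :
    Disjoint (Set.range (blockWires n m b)) (Set.range (blockWires n m b')) := by
  rw [Set.disjoint_left]
  rintro q ⟨j, rfl⟩ ⟨j', hj'⟩
  have hj := j.isLt
  have hjj := j'.isLt
  have h1 : b' * m + (j' : ℕ) = b * m + j := by
    have : vertexQ _ = vertexQ _ := hj'
    simpa [vertexQ] using this
  have hb : blockSize n m b ≤ m := min_le_left _ _
  have hb' : blockSize n m b' ≤ m := min_le_left _ _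
  rcases Nat.lt_or_gt_of_ne h with hlt | hlt
  · have := Nat.mul_le_mul_right m (Nat.succ_le_of_lt hlt)
    rw [Nat.succ_mul] at this
    omega
  · have := Nat.mul_le_mul_right m (Nat.succ_le_of_lt hlt)
    rw [Nat.succ_mul] at this
    omega

theorem blockWires_pairwise (n m : ℕ) : (List.range (numBlocks n m)).Pairwise
    fun b b' => Disjoint (Set.range (blockWires n m b)) (Set.range (blockWires n m b')) :=
  List.nodup_range.imp fun h => blockWires_disjoint h

theorem blockSize_pos (hm : 1 ≤ m) {b : ℕ} (hb : b < numBlocks n m) : 1 ≤ blockSize n m b := by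
  rw [numBlocks, Nat.lt_div_iff_mul_lt (by omega)] at hb
  have : m * b = b * m := mul_comm _ _
  rw [blockSize, Nat.le_min]
  omega

/-- The blocks exhaust the non-root vertices. -/
theorem prod_blocks (hm : 1 ≤ m) (F : Fin (n - 1) → ℂ) :
    ((List.range (numBlocks n m)).map fun b => ∏ j : Fin (blockSize n m b),
      F ⟨b * m + j, by have h := j.isLt; unfold blockSize at h; omega⟩).prod = ∏ i, F i := by
  set G : ℕ → ℂ := fun i => if h : i < n - 1 then F ⟨i, h⟩ else 1 with hG
  have h1 : ∀ b, (∏ j : Fin (blockSize n m b),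
      F ⟨b * m + j, by have h := j.isLt; unfold blockSize at h; omega⟩)
      = ∏ j ∈ Finset.range (blockSize n m b), G (b * m + j) := by
    intro b
    rw [Finset.prod_range]
    refine Finset.prod_congr rfl fun j _ => ?_
    have h := j.isLt
    unfold blockSize at h
    rw [hG]
    simp only
    rw [dif_pos (by omega)]
  have h2 : ∀ B : ℕ, ((List.range B).map fun b =>
      ∏ j ∈ Finset.range (blockSize n m b), G (b * m + j)).prod
      = ∏ i ∈ Finset.range (min (B * m) (n - 1)), G i := by
    intro B
    induction B with
    | zero => simp
    | succ B ih =>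
      rw [List.range_succ, List.map_append, List.prod_append, ih, List.map_singleton,
        List.prod_singleton]
      by_cases hB : B * m ≤ n - 1
      · have e : min ((B + 1) * m) (n - 1) = B * m + blockSize n m B := by
          rw [Nat.succ_mul, blockSize]
          omega
        rw [e, Finset.prod_range_add, min_eq_left hB]
      · have e : blockSize n m B = 0 := by
          rw [blockSize]
          omega
        have e2 : min ((B + 1) * m) (n - 1) = min (B * m) (n - 1) := by
          rw [Nat.succ_mul]
          omega
        rw [e, e2, Finset.range_zero, Finset.prod_empty, mul_one]
  have h3 : n - 1 ≤ numBlocks n m * m := by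
    have := Nat.div_add_mod ((n - 1) + (m - 1)) m
    have h4 := Nat.mod_lt ((n - 1) + (m - 1)) (by omega : 0 < m)
    have h5 : m * numBlocks n m = numBlocks n m * m := mul_comm _ _
    rw [numBlocks] at h5 ⊢
    omega
  simp only [h1]
  rw [h2, min_eq_right h3, Finset.prod_range]
  refine Finset.prod_congr rfl fun i _ => ?_
  simp [hG]

/-- The signs of the vertex qubits in the branch `w` of the poor man's GHZ state. -/
def branchSign (w : Bool) (z : Qubit n → Bool) : Qubit n → Bool :=
  Sum.elim (Sum.elim (fun _ => false) fun i => xor (pathSum (edgeBits z) i) w) fun _ => w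

/-- The branch `w` of the poor man's GHZ state after the Hadamard gates. -/
def branchState (n : ℕ) (w : Bool) : State (Qubit n) :=
  charState (fun _ => bpmCoeff n) fun d q => xor (pathSum' d q) w

theorem hadamardLayer_run_bpmState (n : ℕ) :
    Layer.run (hadamardLayer n) (bpmState n) = branchState n false + branchState n true := by
  rw [bpmState_eq_add, Layer.run_add,
    hadamardLayer_run_prodState _ fun d q => xor (pathSum' d q) false,
    hadamardLayer_run_prodState _ fun d q => xor (pathSum' d q) true]
  rfl

theorem branchState_apply (w : Bool) (z : Qubit n → Bool) : branchState n w z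
    = bpmCoeff n * (1 / (Real.sqrt 2 : ℂ)) ^ (n - 1 + 1)
      * ∏ q, bsign (z (vq q)) (branchSign w z (vq q)) := by
  rw [branchState, charState]
  congr 1
  refine Finset.prod_congr rfl fun q _ => ?_
  rcases q with i | i
  · rfl
  · simp [pathSum', branchSign]

theorem edgeBits_extend_blockWires (b : ℕ) (y : Fin (blockSize n m b) → Bool)
    (z : Qubit n → Bool) : edgeBits (Function.extend (blockWires n m b) y z) = edgeBits z := by
  funext i
  refine extend_wires_of_notMem _ _ _ ?_
  rintro ⟨j, hj⟩
  have : (vertexQ _ : Qubit n) = edgeQ i := hj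
  simp [vertexQ, edgeQ] at this

theorem branchSign_congr (w : Bool) {z z' : Qubit n → Bool} (h : edgeBits z = edgeBits z') :
    branchSign w z = branchSign w z' := by
  rw [branchSign, branchSign, h]

theorem branchState_isCharacterOn (w : Bool) (b : ℕ) :
    IsCharacterOn (blockWires n m b) (branchSign w) (branchState n w) := by
  intro z y
  rw [branchState_apply, branchState_apply,
    branchSign_congr w (edgeBits_extend_blockWires b y z)]
  set τ := branchSign w z
  set e := blockWires n m b
  let v : Fin (blockSize n m b) → Fin (n - 1) ⊕ Unit := fun j =>
    Sum.inl ⟨b * m + j, by have h := j.isLt; unfold blockSize at h; omega⟩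
  have hv : ∀ j, vq (v j) = e j := fun j => rfl
  have hvinj : Function.Injective v := fun i j h => e.injective (by rw [← hv, ← hv, h])
  have hprod : ∏ j, (bsign (y j) (τ (e j)) * bsign (z (e j)) (τ (e j)))
      = ∏ q, (bsign (Function.extend e y z (vq q)) (τ (vq q)) * bsign (z (vq q)) (τ (vq q))) := by
    refine Fintype.prod_of_injective v hvinj _ _ (fun q hq => ?_) fun j => ?_
    · rw [extend_wires_of_notMem, bsign_mul_self]
      rintro ⟨j, hj⟩
      exact hq ⟨j, vq_injective (by rw [hv, hj])⟩
    · rw [hv, extend_wires_apply]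
  have hs : (∏ q, bsign (z (vq q)) (τ (vq q))) * ∏ q, bsign (z (vq q)) (τ (vq q)) = 1 := by
    rw [← Finset.prod_mul_distrib]
    exact Finset.prod_eq_one fun q _ => bsign_mul_self _ _
  rw [Finset.prod_mul_distrib, Finset.prod_mul_distrib] at hprod
  rw [hprod]
  linear_combination (-(bpmCoeff n * (1 / (Real.sqrt 2 : ℂ)) ^ (n - 1 + 1)
    * ∏ q, bsign (Function.extend e y z (vq q)) (τ (vq q)))) * hs

theorem branchState_update_last (w : Bool) (z : Qubit n → Bool) (b : Bool) :
    branchState n w (Function.update z (lastQ n) b)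
      = bsign b w * bsign (z (lastQ n)) w * branchState n w z := by
  have hE : edgeBits (Function.update z (lastQ n) b) = edgeBits z :=
    edgeBits_update_vq z (Sum.inr ()) b
  rw [branchState_apply, branchState_apply, branchSign_congr w hE, Fintype.prod_sum_type,
    Fintype.prod_sum_type]
  simp only [Fintype.prod_unique, vq, Sum.elim_inl, Sum.elim_inr]
  have h1 : ∀ i : Fin (n - 1), Function.update z (lastQ n) b (vertexQ i) = z (vertexQ i) :=
    fun i => Function.update_of_ne (by simp [vertexQ, lastQ]) _ _
  have h2 : branchSign w z (lastQ n) = w := rfl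
  simp only [h1, Function.update_self, h2]
  have hs := bsign_mul_self (z (lastQ n)) w
  linear_combination (-(bpmCoeff n * (1 / (Real.sqrt 2 : ℂ)) ^ (n - 1 + 1)
    * (∏ i : Fin (n - 1), bsign (z (vertexQ i)) (branchSign w z (vertexQ i))) * bsign b w)) * hs

/-- The signed count `∑ᵢ xᵢ (-1) ^ h(d)ᵢ` of the vertex bits. -/
def signedCount (d x : Fin (n - 1) → Bool) : ℤ :=
  ∑ i, if x i then (if pathSum d i then -1 else 1) else 0

/-- In the branch `w`, the phases of all blocks multiply to `exp (∓ i θ ∑ᵢ xᵢ (-1) ^ h(d)ᵢ)`. -/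
theorem prod_blockPhase (hm : 1 ≤ m) (θ : ℝ) (w : Bool) (z z' : Qubit n → Bool)
    (hE : edgeBits z' = edgeBits z)
    (hz : ∀ b ∈ List.range (numBlocks n m), ∀ j,
      z' (blockWires n m b ((finRotate _).symm j)) = z (blockWires n m b j)) :
    ((List.range (numBlocks n m)).map fun b => blockPhase θ
        (fun j => z' (blockWires n m b j)) fun j => branchSign w z' (blockWires n m b j)).prod
      = Complex.exp ((((if w then 1 else -1) * (θ * signedCount (edgeBits z) (vertexBits z)) : ℝ)
          : ℂ) * Complex.I) := by
  have h1 := prod_blocks hm fun i => Complex.exp (((if vertexBits z i then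
    (if xor (pathSum (edgeBits z) i) w then θ else -θ) else 0 : ℝ) : ℂ) * Complex.I)
  rw [← Complex.exp_sum, ← Finset.sum_mul] at h1
  refine Eq.trans (Eq.trans (congrArg List.prod (List.map_congr_left fun b hb => ?_)) h1) ?_
  · rw [blockPhase]
    refine Finset.prod_congr rfl fun j _ => ?_
    rw [hz b hb, branchSign_congr w hE]
    rfl
  rw [signedCount, ← Complex.ofReal_sum]
  congr 3
  push_cast
  rw [Finset.mul_sum, Finset.mul_sum]
  refine Finset.sum_congr rfl fun i _ => ?_
  cases vertexBits z i <;> cases pathSum (edgeBits z) i <;> cases w <;> simp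

/-- The sign with which the two branches interfere at the outcome `z`. -/
def interferenceSign (z : Qubit n → Bool) : ℝ :=
  if xor (parity (vertexBits z)) (lastBit z) then -1 else 1

theorem prod_bsign_true (z : Qubit n → Bool) :
    ∏ q, bsign (z (vq q)) true = (interferenceSign z : ℂ) := by
  have h1 : ∏ i : Fin (n - 1), bsign (z (vertexQ i)) true
      = if parity (vertexBits z) then -1 else 1 := by
    have h2 : ∏ i : Fin (n - 1), bsign (z (vertexQ i)) true = (-1) ^ weight (vertexBits z) := by
      rw [neg_one_pow_weight]
      refine Finset.prod_congr rfl fun i _ => ?_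
      rw [bsign, Bool.and_true]
      rfl
    rw [h2, parity, neg_one_pow_eq_ite]
    by_cases h : Odd (weight (vertexBits z))
    · simp [h, Nat.not_even_iff_odd.2 h]
    · simp [h, Nat.not_odd_iff_even.1 h]
  rw [Fintype.prod_sum_type]
  simp only [Fintype.prod_unique, vq, Sum.elim_inl, Sum.elim_inr, h1, interferenceSign]
  change _ * bsign (lastBit z) true = _
  cases parity (vertexBits z) <;> cases lastBit z <;> simp [bsign]

theorem branchState_true (z : Qubit n → Bool) :
    branchState n true z = interferenceSign z * branchState n false z := by
  rw [branchState_apply, branchState_apply, ← prod_bsign_true, mul_left_comm,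
    ← Finset.prod_mul_distrib]
  congr 1
  refine Finset.prod_congr rfl fun q _ => ?_
  rcases q with i | i
  · simp only [branchSign, vq, Sum.elim_inl, Sum.elim_inr]
    cases z (vertexQ i) <;> cases pathSum (edgeBits z) i <;> simp [bsign]
  · simp only [branchSign, vq, Sum.elim_inr]
    cases z (lastQ n) <;> simp [bsign]

theorem interferenceSign_comp (π : Equiv.Perm (Qubit n)) (hπ : ∀ i, π (edgeQ i) = edgeQ i)
    (z : Qubit n → Bool) : interferenceSign (z ∘ π) = interferenceSign z := by
  have key : ∀ z : Qubit n → Bool, ∏ q : Qubit n, bsign (z q) true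
      = (∏ i : Fin (n - 1), bsign (z (edgeQ i)) true) * ∏ q, bsign (z (vq q)) true := by
    intro z
    simp only [Fintype.prod_sum_type, vq, Sum.elim_inl, Sum.elim_inr, mul_assoc]
  have h1 := key (z ∘ π)
  have h2 : ∏ q : Qubit n, bsign ((z ∘ π) q) true = ∏ q : Qubit n, bsign (z q) true :=
    Equiv.prod_comp π fun q => bsign (z q) true
  have hE : ∏ i : Fin (n - 1), bsign ((z ∘ π) (edgeQ i)) true
      = ∏ i : Fin (n - 1), bsign (z (edgeQ i)) true :=
    Finset.prod_congr rfl fun i _ => by rw [Function.comp_apply, hπ]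
  rw [h2, key z, prod_bsign_true, hE, prod_bsign_true] at h1
  have hne : ∏ i : Fin (n - 1), bsign (z (edgeQ i)) true ≠ 0 :=
    Finset.prod_ne_zero_iff.2 fun i _ h0 => by
      have := norm_bsign (z (edgeQ i)) true
      rw [h0, norm_zero] at this
      exact zero_ne_one this
  exact (Complex.ofReal_injective (mul_left_cancel₀ hne h1)).symm

theorem norm_branchState_sq (w : Bool) (z : Qubit n → Bool) :
    ‖branchState n w z‖ ^ 2 = 1 / 2 ^ (2 * (n - 1)) / 4 := by
  have hs : ‖(1 / (Real.sqrt 2 : ℂ))‖ ^ 2 = 1 / 2 := by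
    rw [norm_div, norm_one, Complex.norm_real, Real.norm_of_nonneg (Real.sqrt_nonneg 2), div_pow,
      one_pow, Real.sq_sqrt (by norm_num)]
  rw [branchState_apply, norm_mul, norm_prod, Finset.prod_eq_one fun q _ => norm_bsign _ _, mul_one,
    bpmCoeff, ← pow_succ, ← pow_add, norm_pow, ← pow_mul, mul_comm, pow_mul, hs]
  have e : n - 1 + 1 + (n - 1 + 1) = 2 * (n - 1) + 2 := by ring
  rw [e, pow_add, div_pow, one_pow]
  norm_num
  ring

theorem norm_exp_add_sq (ε β : ℝ) (hε : ε = 1 ∨ ε = -1) :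
    ‖Complex.exp ((β : ℂ) * Complex.I) + ε * Complex.exp (((-β : ℝ) : ℂ) * Complex.I)‖ ^ 2
      = 2 * (1 + ε * Real.cos (2 * β)) := by
  have e : Complex.exp ((β : ℂ) * Complex.I) + ε * Complex.exp (((-β : ℝ) : ℂ) * Complex.I)
      = (((1 + ε) * Real.cos β : ℝ) : ℂ) + (((1 - ε) * Real.sin β : ℝ) : ℂ) * Complex.I := by
    rw [Complex.exp_mul_I, Complex.exp_mul_I, ← Complex.ofReal_cos, ← Complex.ofReal_sin,
      ← Complex.ofReal_cos, ← Complex.ofReal_sin, Real.cos_neg, Real.sin_neg]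
    push_cast
    ring
  rw [e, ← Complex.normSq_eq_norm_sq, Complex.normSq_add_mul_I, Real.cos_two_mul]
  have h := Real.sin_sq_add_cos_sq β
  rcases hε with rfl | rfl <;> nlinarith

/-- The output distribution of the circuit with the operations `A†`: given the other bits, the last
bit equals the parity of the vertex bits with probability `(1 + sin (2π (S + s) / p)) / 2`, where
`S` is the signed count. -/
theorem born_run_nonunitaryCircuit (hm : 1 ≤ m) {p : ℕ} (hp : 1 ≤ p) (s : ZMod p)
    (z : Qubit n → Bool) :
    born (Circuit.run (nonunitaryCircuit n m p s) (bpmState n)) z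
      = 1 / 2 ^ (2 * (n - 1)) * ((1 + interferenceSign z * Real.sin (2 * Real.pi
          * ((signedCount (edgeBits z) (vertexBits z) : ℝ) + s.val) / p)) / 2) := by
  set θ : ℝ := Real.pi / p with hθ
  set φ : ℝ := Real.pi / 4 - Real.pi * (s.val : ℝ) / p with hφ
  obtain ⟨π, hπ1, hπ2, hπ3⟩ := exists_perm_run_shift (List.range (numBlocks n m)) (blockSize n m)
    (blockWires n m) (blockWires_pairwise n m)
  have hπE : ∀ i, π (edgeQ i) = edgeQ i := fun i => hπ3 _ fun b _ ⟨j, hj⟩ => by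
    have : (vertexQ _ : Qubit n) = edgeQ i := hj
    simp [vertexQ, edgeQ] at this
  have hE : edgeBits (z ∘ π) = edgeBits z := funext fun i => congrArg z (hπE i)
  have hbranch : ∀ w, Circuit.run [blockLayer n m (fun k => (aMat k θ).conjTranspose)
        ++ [oneQubitGate (lastQ n) (rotX φ)], blockLayer n m shiftMat] (branchState n w) z
      = Complex.exp ((((if w then 1 else -1)
          * (θ * signedCount (edgeBits z) (vertexBits z) - φ) : ℝ) : ℂ) * Complex.I)
        * branchState n w (z ∘ π) := by
    intro w
    have hA := run_blocks_character (List.range (numBlocks n m)) (blockSize n m)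
      (blockWires n m) θ (branchSign w) (branchState n w) (blockWires_pairwise n m)
      (fun b _ y z => branchSign_congr w (edgeBits_extend_blockWires b y z))
      fun b _ => branchState_isCharacterOn w b
    rw [Circuit.run_cons, Circuit.run_cons, Circuit.run_nil, blockLayer_eq n m shiftMat, hπ1,
      Layer.run_append, Layer.run_cons, Layer.run_nil, oneQubitGate_apply,
      blockLayer_eq]
    have hup : ∀ b q, Function.update (z ∘ π) (lastQ n) b (vertexQ q) = (z ∘ π) (vertexQ q) :=
      fun b q => Function.update_of_ne (by simp [vertexQ, lastQ]) _ _
    have hphase : ∀ b, ((List.range (numBlocks n m)).map fun b' => blockPhase θ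
          (fun j => Function.update (z ∘ π) (lastQ n) b (blockWires n m b' j)) fun j =>
            branchSign w (Function.update (z ∘ π) (lastQ n) b) (blockWires n m b' j)).prod
        = Complex.exp ((((if w then 1 else -1)
          * (θ * signedCount (edgeBits z) (vertexBits z)) : ℝ) : ℂ) * Complex.I) := by
      intro b
      refine prod_blockPhase hm θ w z _ ?_ fun b' hb' j => ?_
      · rw [← hE]
        exact edgeBits_update_vq (z ∘ π) (Sum.inr ()) b
      · refine (hup b _).trans ?_
        change z (π (blockWires n m b' ((finRotate _).symm j))) = _
        rw [hπ2 b' hb', Equiv.apply_symm_apply]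
    simp only [hA, hphase, branchState_update_last]
    have hlast := sum_rotX_mul_bsign φ ((z ∘ π) (lastQ n)) w
    have hs := bsign_mul_self ((z ∘ π) (lastQ n)) w
    set Φ := Complex.exp ((((if w then 1 else -1)
      * (θ * signedCount (edgeBits z) (vertexBits z)) : ℝ) : ℂ) * Complex.I) with hΦ
    calc _ = (∑ b, rotX φ ((z ∘ π) (lastQ n)) b * bsign b w)
          * (Φ * bsign ((z ∘ π) (lastQ n)) w * branchState n w (z ∘ π)) := by
          rw [Finset.sum_mul]
          exact Finset.sum_congr rfl fun b _ => by ring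
      _ = (Complex.exp (((if w then -φ else φ : ℝ) : ℂ) * Complex.I) * Φ)
          * branchState n w (z ∘ π) := by
          rw [hlast]
          linear_combination (Complex.exp (((if w then -φ else φ : ℝ) : ℂ) * Complex.I) * Φ
            * branchState n w (z ∘ π)) * hs
      _ = _ := by
          rw [hΦ, ← Complex.exp_add]
          congr 2
          rw [← add_mul, ← Complex.ofReal_add]
          congr 2
          cases w <;> simp <;> ring
  have hε : interferenceSign z = 1 ∨ interferenceSign z = -1 := by
    rw [interferenceSign]
    split_ifs <;> simp
  have hp0 : (p : ℝ) ≠ 0 := by positivity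
  rw [born, nonunitaryCircuit, mainCircuit, Circuit.run_cons, hadamardLayer_run_bpmState,
    Circuit.run_add, Pi.add_apply, hbranch, hbranch, branchState_true,
    interferenceSign_comp π hπE]
  set β : ℝ := φ - θ * signedCount (edgeBits z) (vertexBits z) with hβ
  have e : ∀ u : ℂ, Complex.exp ((((if false then 1 else -1)
        * (θ * signedCount (edgeBits z) (vertexBits z) - φ) : ℝ) : ℂ) * Complex.I) * u
      + Complex.exp ((((if true then 1 else -1)
        * (θ * signedCount (edgeBits z) (vertexBits z) - φ) : ℝ) : ℂ) * Complex.I)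
        * (interferenceSign z * u)
      = (Complex.exp ((β : ℂ) * Complex.I)
        + interferenceSign z * Complex.exp (((-β : ℝ) : ℂ) * Complex.I)) * u := by
    intro u
    have h1 : ((if false then 1 else -1)
        * (θ * signedCount (edgeBits z) (vertexBits z) - φ) : ℝ) = β := by
      rw [hβ]; simp
    have h2 : ((if true then 1 else -1)
        * (θ * signedCount (edgeBits z) (vertexBits z) - φ) : ℝ) = -β := by
      rw [hβ]; simp
    rw [h1, h2]
    ring
  rw [e, norm_mul, mul_pow, norm_exp_add_sq _ _ hε, norm_branchState_sq]
  have hcos : Real.cos (2 * β) = Real.sin (2 * Real.pi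
      * ((signedCount (edgeBits z) (vertexBits z) : ℝ) + s.val) / p) := by
    rw [← Real.cos_pi_div_two_sub]
    congr 1
    rw [hβ, hφ, hθ]
    field_simp
    ring
  rw [hcos]
  ring

end Amplitudes

/-! ### The mean of `|sin|` over the residues -/

section SineSums

theorem sin_mul_sum_sin (N : ℕ) (hN : 1 ≤ N) :
    Real.sin (Real.pi / (2 * N)) * ∑ v ∈ Finset.range N, Real.sin (Real.pi * v / N)
      = Real.cos (Real.pi / (2 * N)) := by
  have hN0 : (N : ℝ) ≠ 0 := by positivity
  set u := Real.pi / (2 * N) with hu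
  have h1 : ∀ v : ℕ, 2 * (Real.sin u * Real.sin (Real.pi * v / N))
      = Real.cos ((2 * (v : ℝ) - 1) * u) - Real.cos ((2 * ((v + 1 : ℕ) : ℝ) - 1) * u) := by
    intro v
    have e1 : (2 * (v : ℝ) - 1) * u = Real.pi * v / N - u := by rw [hu]; field_simp
    have e2 : (2 * ((v + 1 : ℕ) : ℝ) - 1) * u = Real.pi * v / N + u := by
      rw [hu]; push_cast; field_simp; ring
    rw [e1, e2, Real.cos_sub, Real.cos_add]
    ring
  have h2 := Finset.sum_range_sub' (fun v : ℕ => Real.cos ((2 * (v : ℝ) - 1) * u)) N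
  have e3 : (2 * (N : ℝ) - 1) * u = Real.pi - u := by rw [hu]; field_simp
  have e4 : (2 * ((0 : ℕ) : ℝ) - 1) * u = -u := by push_cast; ring
  simp only [← h1, e3, e4, Real.cos_neg, Real.cos_pi_sub] at h2
  rw [← Finset.mul_sum, ← Finset.mul_sum] at h2
  linarith

/-- The sum is `cot (π / 2N)`, and `u cot u ≥ 1 - u² / 2`. -/
theorem le_sum_sin (N : ℕ) (hN : 1 ≤ N) :
    2 * N / Real.pi - Real.pi / (4 * N) ≤ ∑ v ∈ Finset.range N, Real.sin (Real.pi * v / N) := by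
  have hN0 : (0 : ℝ) < N := by positivity
  have hN1 : (1 : ℝ) ≤ N := by exact_mod_cast hN
  have hpi := Real.pi_pos
  have h := sin_mul_sum_sin N hN
  set u := Real.pi / (2 * N) with hu
  set T := ∑ v ∈ Finset.range N, Real.sin (Real.pi * v / N)
  have hu0 : 0 < u := by positivity
  have hu1 : u ≤ Real.pi / 2 := by
    rw [hu]
    exact div_le_div_of_nonneg_left hpi.le (by norm_num) (by linarith)
  have hsin : 0 < Real.sin u := Real.sin_pos_of_pos_of_lt_pi hu0 (by linarith)
  have hcos : 0 ≤ Real.cos u := Real.cos_nonneg_of_neg_pi_div_two_le_of_le (by linarith) hu1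
  have hT : 0 ≤ T := by
    by_contra hneg
    push Not at hneg
    nlinarith
  have h1 : 1 - u ^ 2 / 2 ≤ u * T := by
    have := Real.one_sub_sq_div_two_le_cos (x := u)
    have h2 := Real.sin_le hu0.le
    nlinarith
  have h3 : 2 * N / Real.pi - Real.pi / (4 * N) = (1 - u ^ 2 / 2) / u := by
    rw [hu]
    field_simp
    ring
  rw [h3, div_le_iff₀ hu0]
  linarith

theorem sin_nonneg_of_lt {v N : ℕ} (hv : v < N) : 0 ≤ Real.sin (Real.pi * v / N) := by
  have hN : (0 : ℝ) < N := by exact_mod_cast (Nat.zero_le v).trans_lt hv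
  have hvN : (v : ℝ) ≤ N := by exact_mod_cast hv.le
  refine Real.sin_nonneg_of_nonneg_of_le_pi (by positivity) ?_
  rw [div_le_iff₀ hN]
  exact mul_le_mul_of_nonneg_left hvN Real.pi_pos.le

/-- The bias `|sin (2π r / p)|` of the output bit at the residue `r`. -/
def bias (p : ℕ) (r : ZMod p) : ℝ := |Real.sin (2 * Real.pi * (r.val : ℝ) / p)|

theorem sum_zmod_val {p : ℕ} [NeZero p] (f : ℕ → ℝ) :
    ∑ r : ZMod p, f r.val = ∑ v ∈ Finset.range p, f v := by
  obtain ⟨q, rfl⟩ := Nat.exists_eq_succ_of_ne_zero (NeZero.ne p)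
  exact (Finset.sum_range (n := q + 1) f).symm

theorem sum_bias_even {q : ℕ} (hq : 1 ≤ q) [NeZero (2 * q)] :
    ∑ r : ZMod (2 * q), bias (2 * q) r
      = 2 * ∑ v ∈ Finset.range q, Real.sin (Real.pi * v / q) := by
  have hq0 : (q : ℝ) ≠ 0 := by positivity
  simp only [bias]
  rw [sum_zmod_val fun v => |Real.sin (2 * Real.pi * (v : ℝ) / (2 * q : ℕ))|, two_mul q,
    Finset.sum_range_add, two_mul (Finset.sum _ _)]
  refine congrArg₂ (· + ·) ?_ ?_
  · refine Finset.sum_congr rfl fun v hv => ?_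
    have e : 2 * Real.pi * (v : ℝ) / ((q + q : ℕ) : ℝ) = Real.pi * v / q := by
      push_cast; field_simp; ring
    rw [e, abs_of_nonneg (sin_nonneg_of_lt (Finset.mem_range.1 hv))]
  · refine Finset.sum_congr rfl fun v hv => ?_
    have e : 2 * Real.pi * ((q + v : ℕ) : ℝ) / ((q + q : ℕ) : ℝ) = Real.pi * v / q + Real.pi := by
      push_cast; field_simp; ring
    rw [e, Real.sin_add_pi, abs_neg, abs_of_nonneg (sin_nonneg_of_lt (Finset.mem_range.1 hv))]

theorem abs_sin_add_nat_mul_pi (x : ℝ) (k : ℕ) : |Real.sin (x + k * Real.pi)| = |Real.sin x| := by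
  rw [Real.sin_add_nat_mul_pi, abs_mul, abs_pow, abs_neg, abs_one, one_pow, one_mul]

/-- For odd `p` the doubling map permutes the residues. -/
theorem sum_bias_odd {p : ℕ} (hp : Odd p) [NeZero p] :
    ∑ r : ZMod p, bias p r = ∑ v ∈ Finset.range p, Real.sin (Real.pi * v / p) := by
  have hp0 : (p : ℝ) ≠ 0 := by exact_mod_cast NeZero.ne p
  have hu : IsUnit (2 : ZMod p) := by
    have : IsUnit ((2 : ℕ) : ZMod p) := (ZMod.isUnit_iff_coprime 2 p).2 hp.coprime_two_left
    exact_mod_cast this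
  have hbij : Function.Bijective fun r : ZMod p => 2 * r := IsUnit.isUnit_iff_mulLeft_bijective.1 hu
  have hpt : ∀ r : ZMod p, bias p r = |Real.sin (Real.pi * ((2 * r).val : ℝ) / p)| := by
    intro r
    have hval : (2 * r).val = 2 * r.val % p := by
      have e : (2 * r : ZMod p) = ((2 * r.val : ℕ) : ZMod p) := by
        push_cast
        rw [ZMod.natCast_zmod_val]
      rw [e, ZMod.val_natCast]
    have hdiv := Nat.mod_add_div (2 * r.val) p
    have hR : ((2 * r.val % p : ℕ) : ℝ) + p * ((2 * r.val / p : ℕ) : ℝ) = 2 * r.val := by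
      exact_mod_cast hdiv
    have e : 2 * Real.pi * (r.val : ℝ) / p
        = Real.pi * ((2 * r.val % p : ℕ) : ℝ) / p + ((2 * r.val / p : ℕ) : ℝ) * Real.pi := by
      field_simp
      linarith
    rw [bias, e, abs_sin_add_nat_mul_pi, hval]
  simp only [hpt]
  rw [hbij.sum_comp fun r : ZMod p => |Real.sin (Real.pi * (r.val : ℝ) / p)|,
    sum_zmod_val fun v => |Real.sin (Real.pi * (v : ℝ) / p)|]
  exact Finset.sum_congr rfl fun v hv => abs_of_nonneg (sin_nonneg_of_lt (Finset.mem_range.1 hv))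

/-- The mean bias is at least `2/π - 1/p`. -/
theorem le_mean_bias {p : ℕ} (hp : 1 ≤ p) (hp2 : p ≠ 2) [NeZero p] :
    2 / Real.pi - 1 / p ≤ (∑ r : ZMod p, bias p r) / p := by
  have hpi := Real.pi_pos
  have hpi4 := Real.pi_le_four
  have hp0 : (0 : ℝ) < p := by positivity
  rcases Nat.even_or_odd p with hev | hodd
  · obtain ⟨q, hq⟩ := even_iff_two_dvd.1 hev
    subst hq
    have hq2 : 2 ≤ q := by omega
    have hq2' : (2 : ℝ) ≤ q := by exact_mod_cast hq2
    rw [sum_bias_even (by omega)]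
    have h := le_sum_sin q (by omega)
    have e : 2 * (2 * q / Real.pi - Real.pi / (4 * q)) / ((2 * q : ℕ) : ℝ)
        = 2 / Real.pi - Real.pi / (4 * q ^ 2) := by
      push_cast; field_simp
    have h1 : Real.pi / (4 * (q : ℝ) ^ 2) ≤ 1 / ((2 * q : ℕ) : ℝ) := by
      push_cast
      rw [div_le_div_iff₀ (by positivity) (by positivity)]
      nlinarith
    calc 2 / Real.pi - 1 / ((2 * q : ℕ) : ℝ) ≤ 2 / Real.pi - Real.pi / (4 * q ^ 2) := by linarith
      _ = _ := e.symm
      _ ≤ _ := by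
        refine div_le_div_of_nonneg_right ?_ hp0.le
        linarith
  · rw [sum_bias_odd hodd]
    have h := le_sum_sin p hp
    have hp1 : (1 : ℝ) ≤ p := by exact_mod_cast hp
    have e : (2 * p / Real.pi - Real.pi / (4 * p)) / (p : ℝ)
        = 2 / Real.pi - Real.pi / (4 * p ^ 2) := by field_simp
    have h1 : Real.pi / (4 * (p : ℝ) ^ 2) ≤ 1 / p := by
      rw [div_le_div_iff₀ (by positivity) (by positivity)]
      nlinarith
    calc 2 / Real.pi - 1 / (p : ℝ) ≤ 2 / Real.pi - Real.pi / (4 * p ^ 2) := by linarith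
      _ = _ := e.symm
      _ ≤ _ := div_le_div_of_nonneg_right h hp0.le

end SineSums

/-! ### Equidistribution of the signed count -/

section Equidistribution

variable {n : ℕ}

/-- The characteristic function of the signed count of independent uniform bits. -/
theorem sum_addChar_signedCount {p : ℕ} (χ : AddChar (ZMod p) ℂ) :
    ∑ d : Fin (n - 1) → Bool, ∑ x : Fin (n - 1) → Bool, χ (signedCount d x : ℤ)
      = (2 + χ 1 + χ (-1)) ^ (n - 1) := by
  have h1 : ∀ d x : Fin (n - 1) → Bool, χ ((signedCount d x : ℤ) : ZMod p)
      = ∏ i, χ (((if x i then (if pathSum d i then -1 else 1) else 0 : ℤ)) : ZMod p) := by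
    intro d x
    rw [signedCount, Int.cast_sum]
    exact map_prod χ.toMonoidHom (fun i => Multiplicative.ofAdd (((if x i then
      (if pathSum d i then -1 else 1) else 0 : ℤ)) : ZMod p)) Finset.univ
  have h2 : ∀ d : Fin (n - 1) → Bool, ∑ x : Fin (n - 1) → Bool, χ ((signedCount d x : ℤ) : ZMod p)
      = ∏ i, (1 + χ (((if pathSum d i then -1 else 1 : ℤ)) : ZMod p)) := by
    intro d
    simp only [h1]
    rw [sum_prod_apply fun i b =>
      χ (((if b then (if pathSum d i then -1 else 1) else 0 : ℤ)) : ZMod p)]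
    refine Finset.prod_congr rfl fun i _ => ?_
    rw [Fintype.sum_bool, add_comm]
    simp
  simp only [h2]
  rw [pathSum_bijective.sum_comp fun h : Fin (n - 1) → Bool =>
      ∏ i, (1 + χ (((if h i then -1 else 1 : ℤ)) : ZMod p)),
    sum_prod_apply fun _ b => 1 + χ (((if b then -1 else 1 : ℤ)) : ZMod p),
    Finset.prod_const, Finset.card_univ, Fintype.card_fin]
  congr 1
  rw [Fintype.sum_bool]
  push_cast
  simp
  ring

theorem norm_stdAddChar {p : ℕ} [NeZero p] (a : ZMod p) : ‖ZMod.stdAddChar a‖ = 1 := by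
  rw [ZMod.stdAddChar_apply, Circle.norm_coe]

/-- The characteristic function at a non-trivial character is `cos² (π j / p) ≤ exp (-4 / p²)`. -/
theorem norm_two_add_stdAddChar_le {p : ℕ} [NeZero p] {j : ZMod p} (hj : j ≠ 0) :
    ‖2 + ZMod.stdAddChar j + ZMod.stdAddChar (-j)‖ ≤ 4 * Real.exp (-4 / (p : ℝ) ^ 2) := by
  have hp0 : (0 : ℝ) < p := by exact_mod_cast Nat.pos_of_ne_zero (NeZero.ne p)
  have hpi := Real.pi_pos
  set x : ℝ := Real.pi * (j.val : ℝ) / p with hx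
  have h1 : ZMod.stdAddChar j = Complex.exp (((2 * x : ℝ) : ℂ) * Complex.I) := by
    conv_lhs => rw [← ZMod.natCast_zmod_val j, ← Int.cast_natCast]
    rw [ZMod.stdAddChar_coe, hx]
    congr 1
    push_cast
    ring
  have h2 : ZMod.stdAddChar (-j) = Complex.exp (((-(2 * x) : ℝ) : ℂ) * Complex.I) := by
    rw [AddChar.map_neg_eq_inv, h1, ← Complex.exp_neg]
    congr 1
    push_cast
    ring
  have h3 : 2 + ZMod.stdAddChar j + ZMod.stdAddChar (-j) = ((4 * Real.cos x ^ 2 : ℝ) : ℂ) := by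
    rw [h1, h2, Complex.exp_mul_I, Complex.exp_mul_I, ← Complex.ofReal_cos, ← Complex.ofReal_cos,
      ← Complex.ofReal_sin, ← Complex.ofReal_sin, Real.cos_neg, Real.sin_neg, Real.cos_two_mul]
    push_cast
    ring
  rw [h3, Complex.norm_real, Real.norm_of_nonneg (by positivity)]
  have hjv : 1 ≤ j.val := Nat.one_le_iff_ne_zero.2 fun h => hj ((ZMod.val_eq_zero j).1 h)
  have hjp : j.val + 1 ≤ p := ZMod.val_lt j
  have hjv' : (1 : ℝ) ≤ j.val := by exact_mod_cast hjv
  have hjp' : (j.val : ℝ) + 1 ≤ p := by exact_mod_cast hjp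
  have hlow : ∀ y : ℝ, Real.pi / p ≤ y → y ≤ Real.pi / 2 → 2 / p ≤ Real.sin y := by
    intro y hy hy'
    refine le_trans ?_ (Real.mul_le_sin ((by positivity : (0 : ℝ) ≤ Real.pi / p).trans hy) hy')
    calc (2 : ℝ) / p = 2 / Real.pi * (Real.pi / p) := by field_simp
      _ ≤ _ := mul_le_mul_of_nonneg_left hy (by positivity)
  have hsin : 2 / p ≤ Real.sin x := by
    rcases le_total x (Real.pi / 2) with h | h
    · refine hlow x ?_ h
      rw [hx]
      refine div_le_div_of_nonneg_right ?_ hp0.le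
      nlinarith
    · rw [← Real.sin_pi_sub]
      refine hlow _ ?_ (by linarith)
      have e : Real.pi - x = Real.pi * (p - j.val) / p := by rw [hx]; field_simp
      rw [e]
      refine div_le_div_of_nonneg_right ?_ hp0.le
      nlinarith
  have hsq : 4 / (p : ℝ) ^ 2 ≤ Real.sin x ^ 2 := by
    calc 4 / (p : ℝ) ^ 2 = (2 / p) ^ 2 := by rw [div_pow]; norm_num
      _ ≤ _ := pow_le_pow_left₀ (by positivity) hsin 2
  have hexp := Real.add_one_le_exp (-4 / (p : ℝ) ^ 2)
  have hcs := Real.sin_sq_add_cos_sq x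
  have hneg : -4 / (p : ℝ) ^ 2 = -(4 / (p : ℝ) ^ 2) := by ring
  rw [hneg] at hexp ⊢
  linarith

/-- Fourier inversion on `ℤ/p`: the mean of a function `0 ≤ f ≤ 1` of the shifted signed count
modulo `p` differs from its mean over all residues by the contribution of the non-trivial
characters. -/
theorem abs_mean_sub_le {p : ℕ} [NeZero p] (f : ZMod p → ℝ) (hf0 : ∀ r, 0 ≤ f r)
    (hf1 : ∀ r, f r ≤ 1) (s : ZMod p) :
    |1 / 2 ^ (2 * (n - 1)) * (∑ d : Fin (n - 1) → Bool, ∑ x : Fin (n - 1) → Bool,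
        f ((signedCount d x : ℤ) + s)) - (∑ r, f r) / p|
      ≤ p * Real.exp (-4 / (p : ℝ) ^ 2) ^ (n - 1) := by
  have hp0 : (0 : ℝ) < p := by exact_mod_cast Nat.pos_of_ne_zero (NeZero.ne p)
  have hpC : (p : ℂ) ≠ 0 := by exact_mod_cast NeZero.ne p
  set g : ZMod p → ℂ := fun r => (f r : ℂ) with hg
  have hinv : ∀ r, g r = (p : ℂ)⁻¹ * ∑ j, ZMod.stdAddChar (j * r) * ZMod.dft g j := by
    intro r
    have := ZMod.invDFT_apply (ZMod.dft g) r
    rw [LinearEquiv.symm_apply_apply] at this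
    simpa using this
  have hnorm : ∀ j, ‖ZMod.dft g j‖ ≤ p := by
    intro j
    rw [ZMod.dft_apply]
    calc _ ≤ ∑ r : ZMod p, ‖ZMod.stdAddChar (-(r * j)) • g r‖ := norm_sum_le _ _
      _ ≤ ∑ r : ZMod p, (1 : ℝ) := by
          refine Finset.sum_le_sum fun r _ => ?_
          rw [smul_eq_mul, norm_mul, norm_stdAddChar, one_mul, Complex.norm_real,
            Real.norm_of_nonneg (hf0 r)]
          exact hf1 r
      _ = p := by simp [ZMod.card]
  have hzero : ZMod.dft g 0 = ∑ r, g r := by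
    rw [ZMod.dft_apply]
    simp
  have hchar : ∀ j : ZMod p, ∑ d : Fin (n - 1) → Bool, ∑ x : Fin (n - 1) → Bool,
      ZMod.stdAddChar (j * ((signedCount d x : ℤ) : ZMod p))
      = (2 + ZMod.stdAddChar j + ZMod.stdAddChar (-j)) ^ (n - 1) := by
    intro j
    have := sum_addChar_signedCount (n := n) (ZMod.stdAddChar.mulShift j)
    simpa [AddChar.mulShift_apply] using this
  have hpow4 : (2 : ℂ) ^ (2 * (n - 1)) = 4 ^ (n - 1) := by rw [pow_mul]; norm_num
  have hsum : (1 / 2 ^ (2 * (n - 1)) : ℂ) * (∑ d : Fin (n - 1) → Bool, ∑ x : Fin (n - 1) → Bool,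
        g ((signedCount d x : ℤ) + s)) - (∑ r, g r) / p
      = (p : ℂ)⁻¹ * ∑ j ∈ Finset.univ.erase (0 : ZMod p), ZMod.dft g j * ZMod.stdAddChar (j * s)
        * ((2 + ZMod.stdAddChar j + ZMod.stdAddChar (-j)) / 4) ^ (n - 1) := by
    have e1 : ∑ d : Fin (n - 1) → Bool, ∑ x : Fin (n - 1) → Bool, g ((signedCount d x : ℤ) + s)
        = (p : ℂ)⁻¹ * ∑ j, ZMod.dft g j * ZMod.stdAddChar (j * s)
          * (2 + ZMod.stdAddChar j + ZMod.stdAddChar (-j)) ^ (n - 1) := by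
      rw [Finset.mul_sum]
      simp only [hinv, ← hchar, Finset.mul_sum]
      rw [Finset.sum_comm (s := (Finset.univ : Finset (ZMod p)))]
      refine Finset.sum_congr rfl fun d _ => ?_
      rw [Finset.sum_comm]
      refine Finset.sum_congr rfl fun x _ => Finset.sum_congr rfl fun j _ => ?_
      rw [mul_add, AddChar.map_add_eq_mul]
      ring
    rw [e1, ← Finset.add_sum_erase _ _ (Finset.mem_univ (0 : ZMod p)), hzero, hpow4, mul_add,
      mul_add]
    have e2 : (1 : ℂ) / 4 ^ (n - 1) * ((p : ℂ)⁻¹ * ((∑ r, g r) * ZMod.stdAddChar (0 * s)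
        * (2 + ZMod.stdAddChar (0 : ZMod p) + ZMod.stdAddChar (-0 : ZMod p)) ^ (n - 1)))
        = (∑ r, g r) / p := by
      rw [zero_mul, neg_zero, AddChar.map_zero_eq_one]
      norm_num
      field_simp
    rw [e2, add_sub_cancel_left, mul_left_comm, Finset.mul_sum]
    congr 1
    refine Finset.sum_congr rfl fun j _ => ?_
    rw [div_pow]
    ring
  have hreal : ((1 / 2 ^ (2 * (n - 1)) * (∑ d : Fin (n - 1) → Bool, ∑ x : Fin (n - 1) → Bool,
        f ((signedCount d x : ℤ) + s)) - (∑ r, f r) / p : ℝ) : ℂ)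
      = (1 / 2 ^ (2 * (n - 1)) : ℂ) * (∑ d : Fin (n - 1) → Bool, ∑ x : Fin (n - 1) → Bool,
        g ((signedCount d x : ℤ) + s)) - (∑ r, g r) / p := by
    rw [hg]
    push_cast
    rfl
  rw [← Real.norm_eq_abs, ← Complex.norm_real, hreal, hsum, norm_mul, norm_inv,
    Complex.norm_natCast]
  have hterm : ∀ j ∈ Finset.univ.erase (0 : ZMod p),
      ‖ZMod.dft g j * ZMod.stdAddChar (j * s)
        * ((2 + ZMod.stdAddChar j + ZMod.stdAddChar (-j)) / 4) ^ (n - 1)‖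
      ≤ p * Real.exp (-4 / (p : ℝ) ^ 2) ^ (n - 1) := by
    intro j hj
    rw [norm_mul, norm_mul, norm_stdAddChar, mul_one, norm_pow, norm_div]
    refine mul_le_mul (hnorm j) (pow_le_pow_left₀ (by positivity) ?_ _) (by positivity) hp0.le
    have := norm_two_add_stdAddChar_le (Finset.ne_of_mem_erase hj)
    rw [div_le_iff₀ (by norm_num)]
    norm_num
    linarith
  have hcard : ((Finset.univ.erase (0 : ZMod p)).card : ℝ) ≤ p := by
    have h1 := Finset.card_erase_le (s := (Finset.univ : Finset (ZMod p))) (a := 0)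
    rw [Finset.card_univ, ZMod.card] at h1
    exact_mod_cast h1
  calc (p : ℝ)⁻¹ * _ ≤ (p : ℝ)⁻¹ * ((Finset.univ.erase (0 : ZMod p)).card
        • (p * Real.exp (-4 / (p : ℝ) ^ 2) ^ (n - 1))) :=
        mul_le_mul_of_nonneg_left
          ((norm_sum_le _ _).trans (Finset.sum_le_card_nsmul _ _ _ hterm)) (by positivity)
    _ ≤ (p : ℝ)⁻¹ * (p * (p * Real.exp (-4 / (p : ℝ) ^ 2) ^ (n - 1))) := by
        rw [nsmul_eq_mul]
        exact mul_le_mul_of_nonneg_left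
          (mul_le_mul_of_nonneg_right hcard (by positivity)) (by positivity)
    _ = _ := by rw [inv_mul_cancel_left₀ hp0.ne']

end Equidistribution

/-! ### Total variation distance to the target distribution -/

section Distance

variable {n m : ℕ}

theorem sum_qubit (H : (Fin (n - 1) → Bool) → (Fin (n - 1) → Bool) → Bool → ℝ) :
    ∑ z : Qubit n → Bool, H (edgeBits z) (vertexBits z) (lastBit z) = ∑ d, ∑ x, ∑ b, H d x b := by
  let E : (Qubit n → Bool) ≃ (Fin (n - 1) → Bool) × (Fin (n - 1) → Bool) × Bool :=
    { toFun := fun z => (edgeBits z, vertexBits z, lastBit z)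
      invFun := fun t => Sum.elim (Sum.elim t.1 t.2.1) fun _ => t.2.2
      left_inv := fun z => by
        funext q
        rcases q with (i | i) | i <;> rfl
      right_inv := fun _ => rfl }
  refine (Fintype.sum_equiv E _ (fun t => H t.1 t.2.1 t.2.2) fun z => rfl).trans ?_
  rw [Fintype.sum_prod_type]
  exact Finset.sum_congr rfl fun d _ => Fintype.sum_prod_type _

theorem sin_eq_sin_val {p : ℕ} [NeZero p] (s : ZMod p) (S : ℤ) :
    Real.sin (2 * Real.pi * ((S : ℝ) + s.val) / p)
      = Real.sin (2 * Real.pi * (((S : ZMod p) + s).val : ℝ) / p) := by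
  have hp0 : (p : ℝ) ≠ 0 := by exact_mod_cast NeZero.ne p
  have hval : ((((S : ZMod p) + s).val : ℕ) : ℤ) = (S + s.val) % p := by
    have e : (S : ZMod p) + s = ((S + s.val : ℤ) : ZMod p) := by
      push_cast
      rw [ZMod.natCast_zmod_val]
    rw [e, ZMod.val_intCast]
  have hdiv := Int.emod_add_mul_ediv (S + s.val) p
  rw [← hval] at hdiv
  have hR : ((((S : ZMod p) + s).val : ℕ) : ℝ) + p * (((S + s.val) / (p : ℤ) : ℤ) : ℝ)
      = S + s.val := by exact_mod_cast hdiv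
  rw [← hR, ← Real.sin_add_int_mul_two_pi (2 * Real.pi * (((S : ZMod p) + s).val : ℝ) / p)
    ((S + s.val) / (p : ℤ))]
  congr 1
  field_simp

/-- The bit `majmod` records the sign of the sine. -/
theorem majmod_mul_sin {p : ℕ} [NeZero p] (s : ZMod p) (S : ℤ) :
    (if majmod p s S then -1 else 1) * Real.sin (2 * Real.pi * ((S : ℝ) + s.val) / p)
      = bias p ((S : ZMod p) + s) := by
  have hp0 : (0 : ℝ) < p := by exact_mod_cast Nat.pos_of_ne_zero (NeZero.ne p)
  have hpi := Real.pi_pos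
  rw [sin_eq_sin_val, bias, majmod]
  set v := ((S : ZMod p) + s).val with hv
  have hvp : (v : ℝ) ≤ p := by exact_mod_cast (ZMod.val_lt ((S : ZMod p) + s)).le
  by_cases h : 2 * v < p
  · have h' : (2 : ℝ) * v ≤ p := by exact_mod_cast h.le
    have hs : 0 ≤ Real.sin (2 * Real.pi * (v : ℝ) / p) := by
      refine Real.sin_nonneg_of_nonneg_of_le_pi (by positivity) ?_
      rw [div_le_iff₀ hp0]
      nlinarith
    rw [abs_of_nonneg hs]
    simp [h]
  · have h' : (p : ℝ) ≤ 2 * v := by exact_mod_cast not_lt.1 h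
    have hs : Real.sin (2 * Real.pi * (v : ℝ) / p) ≤ 0 := by
      have e : 2 * Real.pi * (v : ℝ) / p = (2 * Real.pi * (v : ℝ) / p - Real.pi) + Real.pi := by
        ring
      rw [e, Real.sin_add_pi, neg_nonpos]
      refine Real.sin_nonneg_of_nonneg_of_le_pi ?_ ?_
      · rw [sub_nonneg, le_div_iff₀ hp0]
        nlinarith
      · rw [sub_le_iff_le_add, div_le_iff₀ hp0]
        nlinarith
    rw [abs_of_nonpos hs]
    simp [h]

theorem bias_le_one (p : ℕ) (r : ZMod p) : bias p r ≤ 1 := Real.abs_sin_le_one _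

theorem pmmajmod_eq (p : ℕ) (s : ZMod p) (d x : Fin (n - 1) → Bool) :
    pmmajmod p s d x = xor (majmod p s (signedCount d x)) (parity x) := rfl

/-- At every outcome the output probability misses the target by the same factor
`(1 - bias) / 2`. -/
theorem abs_born_sub_target (hm : 1 ≤ m) {p : ℕ} [NeZero p] (s : ZMod p) (z : Qubit n → Bool) :
    |born (Circuit.run (nonunitaryCircuit n m p s) (bpmState n)) z - targetDist n p s z|
      = 1 / 2 ^ (2 * (n - 1)) * ((1 - bias p
        (((signedCount (edgeBits z) (vertexBits z) : ℤ) : ZMod p) + s)) / 2) := by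
  have hmaj := majmod_mul_sin s (signedCount (edgeBits z) (vertexBits z))
  rw [born_run_nonunitaryCircuit hm (Nat.one_le_iff_ne_zero.2 (NeZero.ne p)), targetDist,
    pmmajmod_eq, interferenceSign]
  set σ := Real.sin (2 * Real.pi
    * ((signedCount (edgeBits z) (vertexBits z) : ℝ) + s.val) / p)
  have hb1 := bias_le_one p (((signedCount (edgeBits z) (vertexBits z) : ℤ) : ZMod p) + s)
  set β := bias p (((signedCount (edgeBits z) (vertexBits z) : ℤ) : ZMod p) + s)
  have hC : (0 : ℝ) < 1 / 2 ^ (2 * (n - 1)) := by positivity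
  set C : ℝ := 1 / 2 ^ (2 * (n - 1))
  have h0 : 0 ≤ C * ((1 - β) / 2) := by
    have : 0 ≤ 1 - β := by linarith
    positivity
  generalize majmod p s (signedCount (edgeBits z) (vertexBits z)) = μ at hmaj ⊢
  generalize parity (vertexBits z) = π
  generalize lastBit z = l
  -- The weight of the correct answer is too small, that of the wrong answer too large.
  rw [← abs_of_nonneg h0]
  cases μ <;> cases π <;> cases l <;>
    simp only [Bool.xor_false, Bool.xor_true, Bool.not_true, Bool.not_false, Bool.false_eq_true,
      Bool.true_eq_false, if_true, if_false, one_mul] at hmaj ⊢ <;>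
    rw [← hmaj] <;>
    first
    | (congr 1; ring1)
    | (rw [abs_sub_comm]; congr 1; ring1)

theorem isProbDist_nonunitary (hm : 1 ≤ m) {p : ℕ} (hp : 1 ≤ p) (s : ZMod p) :
    IsProbDist (born (Circuit.run (nonunitaryCircuit n m p s) (bpmState n))) := by
  refine ⟨fun _ => sq_nonneg _, ?_⟩
  simp only [born_run_nonunitaryCircuit hm hp, interferenceSign]
  rw [sum_qubit fun d x b => 1 / 2 ^ (2 * (n - 1)) * ((1 + (if xor (parity x) b then -1 else 1)
    * Real.sin (2 * Real.pi * ((signedCount d x : ℝ) + s.val) / p)) / 2)]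
  have h : ∀ d x : Fin (n - 1) → Bool, ∑ b, (1 : ℝ) / 2 ^ (2 * (n - 1))
      * ((1 + (if xor (parity x) b then -1 else 1)
        * Real.sin (2 * Real.pi * ((signedCount d x : ℝ) + s.val) / p)) / 2)
      = 1 / 2 ^ (2 * (n - 1)) := by
    intro d x
    rw [Fintype.sum_bool]
    cases parity x <;> simp <;> ring
  simp only [h, Finset.sum_const, Finset.card_univ, Fintype.card_fun, Fintype.card_bool,
    Fintype.card_fin, nsmul_eq_mul]
  push_cast
  rw [two_mul, pow_add]
  field_simp

/-- The output of the circuit with the operations `A†` compared with the target distribution. -/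
theorem tvDist_nonunitary_le (hn : 1 ≤ n) (hm : 1 ≤ m) {p : ℕ} (hp : 1 ≤ p) (hp2 : p ≠ 2)
    (s : ZMod p) :
    tvDist (born (Circuit.run (nonunitaryCircuit n m p s) (bpmState n))) (targetDist n p s)
      ≤ 1 / 2 - 1 / Real.pi + 1 / (2 * (p : ℝ))
        + Real.exp 4 * (p : ℝ) ^ (3 / 2 : ℝ) * Real.exp (-(n : ℝ) / (4 * (p : ℝ) ^ 2)) := by
  have : NeZero p := ⟨by omega⟩
  have hp1 : (1 : ℝ) ≤ p := by exact_mod_cast hp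
  have hp0 : (0 : ℝ) < p := by linarith
  have hC : (1 : ℝ) / 2 ^ (2 * (n - 1)) * (2 ^ (n - 1) * 2 ^ (n - 1)) = 1 := by
    rw [two_mul, pow_add]
    field_simp
  have htv : tvDist (born (Circuit.run (nonunitaryCircuit n m p s) (bpmState n)))
        (targetDist n p s)
      = 1 / 2 - 1 / 2 * (1 / 2 ^ (2 * (n - 1)) * ∑ d : Fin (n - 1) → Bool,
          ∑ x : Fin (n - 1) → Bool, bias p (((signedCount d x : ℤ) : ZMod p) + s)) := by
    rw [tvDist]
    simp only [abs_born_sub_target hm]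
    rw [sum_qubit fun d x _ => 1 / 2 ^ (2 * (n - 1))
      * ((1 - bias p (((signedCount d x : ℤ) : ZMod p) + s)) / 2)]
    simp only [← Finset.mul_sum, ← Finset.sum_div,
      Finset.sum_sub_distrib, Finset.sum_const, Finset.card_univ, Fintype.card_fun,
      Fintype.card_bool, Fintype.card_fin, nsmul_eq_mul, mul_one]
    push_cast
    linear_combination (1 / 2 : ℝ) * hC
  have hmean := abs_mean_sub_le (n := n) (bias p) (fun _ => abs_nonneg _) (bias_le_one p) s
  have hlow := le_mean_bias hp hp2
  have herr : (p : ℝ) * Real.exp (-4 / (p : ℝ) ^ 2) ^ (n - 1)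
      ≤ (p : ℝ) ^ (3 / 2 : ℝ) * (Real.exp 4 * Real.exp (-(n : ℝ) / (4 * (p : ℝ) ^ 2))) := by
    have h1 : (p : ℝ) ≤ (p : ℝ) ^ (3 / 2 : ℝ) := by
      conv_lhs => rw [← Real.rpow_one (p : ℝ)]
      exact Real.rpow_le_rpow_of_exponent_le hp1 (by norm_num)
    refine mul_le_mul h1 ?_ (by positivity) (by positivity)
    rw [← Real.exp_nat_mul, ← Real.exp_add, Real.exp_le_exp, Nat.cast_sub hn]
    have hq : 1 / (p : ℝ) ^ 2 ≤ 1 := by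
      rw [div_le_one (by positivity)]
      exact one_le_pow₀ hp1
    have hn0 : (0 : ℝ) ≤ n * (1 / (p : ℝ) ^ 2) := by positivity
    have e1 : ((n : ℝ) - (1 : ℕ)) * (-4 / (p : ℝ) ^ 2)
        = 4 * (1 / (p : ℝ) ^ 2) - 4 * (n * (1 / (p : ℝ) ^ 2)) := by
      push_cast; ring
    have e2 : -(n : ℝ) / (4 * (p : ℝ) ^ 2) = -(1 / 4) * (n * (1 / (p : ℝ) ^ 2)) := by
      field_simp
    rw [e1, e2]
    linarith
  have h2p : 1 / (2 * (p : ℝ)) = 1 / 2 * (1 / p) := by field_simp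
  have h2pi : 1 / Real.pi = 1 / 2 * (2 / Real.pi) := by ring
  have habs := (abs_le.1 hmean).1
  rw [htv, h2p, h2pi]
  have hpos : 0 ≤ (p : ℝ) ^ (3 / 2 : ℝ)
      * (Real.exp 4 * Real.exp (-(n : ℝ) / (4 * (p : ℝ) ^ 2))) := by
    positivity
  nlinarith

end Distance

/-! ### Cyclic shifts in depth two -/

section Swaps

variable {k : ℕ}

/-- The swaps exchanging `i` and `σ i`, for an involution `σ`. -/
def swapLayer (σ : Fin k → Fin k) (l : List {i : Fin k // i < σ i}) : Layer (Fin k) :=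
  l.map fun i => swapGate i.1 (σ i.1) i.2.ne

theorem run_swapLayer {σ : Fin k → Fin k} (hσ : Function.Involutive σ)
    (l : List {i : Fin k // i < σ i}) (hl : l.Nodup) (ψ : State (Fin k)) (z : Fin k → Bool) :
    Layer.run (swapLayer σ l) ψ z
      = ψ fun q => z (if (∃ i ∈ l, i.1 = q ∨ σ i.1 = q) then σ q else q) := by
  induction l generalizing ψ with
  | nil => simp [swapLayer, Layer.run_nil]
  | cons i l ih =>
    rw [List.nodup_cons] at hl
    rw [swapLayer, List.map_cons, Layer.run_cons, ← swapLayer, ih hl.2, swapGate_apply]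
    congr 1
    funext q
    rw [Function.comp_apply]
    congr 1
    have hi : ∀ j ∈ l, j.1 ≠ i.1 := fun j hj h => hl.1 (Subtype.ext h ▸ hj)
    have hi' : ∀ j ∈ l, σ j.1 ≠ i.1 := by
      intro j _ h
      have h1 := j.2
      have h2 := i.2
      rw [← h, hσ] at h2
      exact lt_asymm h1 h2
    have hi'' : ∀ j ∈ l, j.1 ≠ σ i.1 := fun j hj h => hi' j hj (by rw [h, hσ])
    have hi3 : ∀ j ∈ l, σ j.1 ≠ σ i.1 := fun j hj h => hi j hj (hσ.injective h)
    by_cases hq1 : q = i.1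
    · subst hq1
      rw [Equiv.swap_apply_left, if_neg, if_pos ⟨i, List.mem_cons_self, Or.inl rfl⟩]
      rintro ⟨j, hj, h | h⟩
      · exact hi'' j hj h
      · exact hi3 j hj h
    · by_cases hq2 : q = σ i.1
      · subst hq2
        rw [Equiv.swap_apply_right, if_neg, if_pos ⟨i, List.mem_cons_self, Or.inr rfl⟩, hσ]
        rintro ⟨j, hj, h | h⟩
        · exact hi j hj h
        · exact hi' j hj h
      · rw [Equiv.swap_apply_of_ne_of_ne hq1 hq2]
        simp [Ne.symm hq1, Ne.symm hq2]

theorem isOver_swapLayer {σ : Fin k → Fin k} (hσ : Function.Involutive σ)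
    (l : List {i : Fin k // i < σ i}) (hl : l.Nodup) :
    Circuit.IsOver IsOneTwoUnitary [swapLayer σ l] := by
  intro L hL
  obtain rfl := List.mem_singleton.1 hL
  refine ⟨fun g hg => ?_, ?_⟩
  · obtain ⟨i, _, rfl⟩ := List.mem_map.1 hg
    exact isOneTwoUnitary_swapGate _ _ _
  · rw [swapLayer, List.pairwise_map]
    refine hl.imp fun {i j} hij => ?_
    have hne : i.1 ≠ j.1 := fun h => hij (Subtype.ext h)
    have hne2 : i.1 ≠ σ j.1 := by
      intro h
      have h1 := i.2
      have h2 := j.2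
      rw [h, hσ] at h1
      exact lt_asymm h1 h2
    rw [range_swapGate_wires, range_swapGate_wires, Set.disjoint_left]
    intro q hq hq'
    rcases hq with rfl | rfl <;> rcases hq' with hq' | hq'
    · exact hne hq'
    · exact hne2 hq'
    · exact hne2 (by rw [← hσ i.1, hq'])
    · exact hne (hσ.injective hq')

/-- An involution of the wires is performed by one layer of swaps. -/
theorem exists_swapLayer {σ : Fin k → Fin k} (hσ : Function.Involutive σ) :
    ∃ L : Layer (Fin k), Circuit.IsOver IsOneTwoUnitary [L] ∧
      ∀ ψ z, Layer.run L ψ z = ψ (z ∘ σ) := by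
  refine ⟨swapLayer σ Finset.univ.toList, isOver_swapLayer hσ _ (Finset.nodup_toList _),
    fun ψ z => ?_⟩
  rw [run_swapLayer hσ _ (Finset.nodup_toList _)]
  congr 1
  funext q
  rw [Function.comp_apply]
  congr 1
  split_ifs with h
  · rfl
  · by_contra hne
    rcases lt_or_gt_of_ne hne with hlt | hlt
    · exact h ⟨⟨q, hlt⟩, by simp, Or.inl rfl⟩
    · exact h ⟨⟨σ q, by rwa [hσ]⟩, by simp, Or.inr (hσ q)⟩

theorem shiftMat_mulVec (φ : State (Fin k)) (z : Fin k → Bool) :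
    (shiftMat k).mulVec φ z = φ (z ∘ finRotate k) := by
  rw [Matrix.mulVec, dotProduct, Finset.sum_eq_single (z ∘ finRotate k)]
  · rw [shiftMat, Matrix.of_apply, if_pos, one_mul]
    funext j
    simp only [Function.comp_apply, Equiv.apply_symm_apply]
  · intro y _ hy
    rw [shiftMat, Matrix.of_apply, if_neg, zero_mul]
    intro h
    refine hy (funext fun j => ?_)
    rw [h, Function.comp_apply]
    simp only [Equiv.symm_apply_apply]
  · simp

/-- The cyclic shift is a product of two reflections of the cyclic order. -/
theorem exists_shift_circuit (hk : 1 ≤ k) :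
    ∃ C : Circuit (Fin k), C.IsOver IsOneTwoUnitary ∧ C.length = 2 ∧
      ∀ φ, C.run φ = (shiftMat k).mulVec φ := by
  obtain ⟨k, rfl⟩ := Nat.exists_eq_succ_of_ne_zero (Nat.one_le_iff_ne_zero.1 hk)
  obtain ⟨L₁, h₁, hrun₁⟩ := exists_swapLayer (k := k + 1) Fin.rev_involutive
  obtain ⟨L₂, h₂, hrun₂⟩ := exists_swapLayer (k := k + 1) (σ := fun j => -j) neg_involutive
  refine ⟨[L₁] ++ [L₂], Circuit.isOver_append h₁ h₂, rfl, fun φ => ?_⟩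
  funext z
  rw [shiftMat_mulVec]
  change Layer.run L₂ (Layer.run L₁ φ) z = _
  rw [hrun₂, hrun₁]
  congr 1
  funext j
  simp only [Function.comp_apply, finRotate_apply]
  congr 1
  rw [neg_eq_iff_add_eq_zero]
  refine Fin.ext ?_
  have hj := j.isLt
  rw [Fin.val_add, Fin.val_add, Fin.val_rev]
  rw [Nat.add_mod_mod]
  simp only [Fin.val_one', Fin.val_zero]
  rw [← Nat.add_assoc, Nat.add_mod_mod]
  have : k + 1 - ((j : ℕ) + 1) + j + 1 = k + 1 := by omega
  rw [this, Nat.mod_self]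

theorem shiftMat_mem_unitaryGroup (k : ℕ) :
    shiftMat k ∈ Matrix.unitaryGroup (Fin k → Bool) ℂ := by
  rw [Matrix.mem_unitaryGroup_iff']
  ext x x'

  have h : ((fun j => x ((finRotate k).symm j)) = fun j => x' ((finRotate k).symm j)) ↔ x = x' :=
    (finRotate k).symm.surjective.injective_comp_right.eq_iff
  rw [Matrix.mul_apply, Finset.sum_eq_single fun j => x ((finRotate k).symm j)]
  · simp only [Matrix.star_apply, shiftMat, Matrix.of_apply, if_true, star_one, one_mul,
      Matrix.one_apply, h]
  · intro y _ hy
    rw [Matrix.star_apply, shiftMat, Matrix.of_apply, if_neg hy, star_zero, zero_mul]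
  · exact fun hx => absurd (Finset.mem_univ _) hx

end Swaps

/-! ### Shallow circuits for the sampling circuits -/

section Depth

variable {n m : ℕ}

theorem exists_common_length (m : ℕ) : ∃ N₀, ∀ N, N₀ ≤ N → ∀ k, 1 ≤ k → k ≤ m →
    ∀ U ∈ Matrix.unitaryGroup (Fin k → Bool) ℂ, ∃ C : Circuit (Fin k),
      C.IsOver IsOneTwoUnitary ∧ C.length = N ∧ ∀ φ, C.run φ = U.mulVec φ := by
  induction m with
  | zero => exact ⟨0, fun N _ k hk hk' => by omega⟩
  | succ m ih =>
    obtain ⟨N₁, h₁⟩ := ih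
    obtain ⟨N₂, h₂⟩ := exists_circuit_of_unitary (m + 1) (by omega)
    refine ⟨max N₁ N₂, fun N hN k hk hk' => ?_⟩
    rcases Nat.lt_or_ge m k with h | h
    · obtain rfl : k = m + 1 := by omega
      exact h₂ N (le_of_max_le_right hN)
    · exact h₁ N (le_of_max_le_left hN) k hk h

theorem exists_block_circuit (hm : 1 ≤ m) (N : ℕ) (M : ∀ k, QMat k)
    (hM : ∀ k, 1 ≤ k → k ≤ m → ∃ C : Circuit (Fin k),
      C.IsOver IsOneTwoUnitary ∧ C.length = N ∧ ∀ φ, C.run φ = (M k).mulVec φ) :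
    ∃ C : Circuit (Qubit n), C.IsOver IsOneTwoUnitary ∧ C.length = N ∧
      ∀ ψ, C.run ψ = Layer.run (blockLayer n m M) ψ := by
  obtain ⟨C, hC, hlen, _, hrun⟩ := exists_parallel_circuit (List.range (numBlocks n m))
    (fun b => blockSize n m b) (fun b => blockWires n m b) (fun b => M (blockSize n m b)) N
    (blockWires_pairwise n m) fun b hb =>
      hM _ (blockSize_pos hm (List.mem_range.1 hb)) (min_le_left _ _)
  exact ⟨C, hC, hlen, fun ψ => by rw [hrun, blockLayer_eq]⟩

/-- Once the block operators are available as a circuit of length `N`, the state preparation and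
the rest of the sampling circuit cost eight more layers. -/
theorem exists_main_circuit (hm : 1 ≤ m) (p : ℕ) (s : ZMod p) {N : ℕ} (M : ∀ k, QMat k)
    {S : Gate (Qubit n) → Prop} (hS : ∀ g, IsOneTwoUnitary g → S g)
    (hM : ∃ C : Circuit (Qubit n), C.IsOver S ∧ C.length = N ∧
      ∀ ψ, C.run ψ = Layer.run (blockLayer n m M) ψ) :
    ∃ main : Circuit (Qubit n), Circuit.IsOver S (prepCircuit n ++ main) ∧
      Circuit.depth (prepCircuit n ++ main) = N + 8 ∧
      ∀ ψ, main.run ψ = Circuit.run (mainCircuit n m p s M) ψ := by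
  obtain ⟨C, hC, hlen, hrun⟩ := hM
  obtain ⟨C', hC', hlen', hrun'⟩ := exists_block_circuit (n := n) hm 2 shiftMat
    fun k hk _ => exists_shift_circuit hk
  have hrot : Circuit.IsOver IsOneTwoUnitary
      [[oneQubitGate (lastQ n) (rotX (Real.pi / 4 - Real.pi * (s.val : ℝ) / (p : ℝ)))]] := by
    intro L hL
    obtain rfl := List.mem_singleton.1 hL
    refine ⟨fun g hg => ?_, List.pairwise_singleton _ _⟩
    obtain rfl := List.mem_singleton.1 hg
    exact isOneTwoUnitary_oneQubitGate _ (rotX_mem_unitaryGroup _)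
  refine ⟨[hadamardLayer n] ++ (C ++
    ([[oneQubitGate (lastQ n) (rotX (Real.pi / 4 - Real.pi * (s.val : ℝ) / (p : ℝ)))]] ++ C')),
    ?_, ?_, fun ψ => ?_⟩
  · exact Circuit.isOver_append ((isOver_prepCircuit n).mono hS)
      (Circuit.isOver_append ((isOver_hadamardLayer n).mono hS)
        (Circuit.isOver_append hC (Circuit.isOver_append (hrot.mono hS) (hC'.mono hS))))
  · simp only [Circuit.depth, List.length_append, hlen, hlen', prepCircuit,
      List.length_cons, List.length_nil]
    omega
  · simp only [mainCircuit, Circuit.run_append, Circuit.run_cons, Circuit.run_nil,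
      Layer.run_append, hrun, hrun']

end Depth

/-! ### Comparison of the circuits with `U†` and with `A†` -/

section Hybrid

variable {ι : Type} [Fintype ι] [DecidableEq ι]

/-- Replacing unitary operators `U b` one after the other by nearby operators `A b`, not
necessarily contractions. The added `1` accounts for the norm of the state on which the error
`A b - U b` acts: it is at most `1` plus the distance reached so far. -/
theorem l2norm_run_sub_run_le {β : Type} (l : List β) (κ : β → ℕ) (e : ∀ b, Fin (κ b) ↪ ι)
    (U A : ∀ b, QMat (κ b)) (ε : β → ℝ) (hε : ∀ b, 0 ≤ ε b)
    (hU : ∀ b ∈ l, U b ∈ Matrix.unitaryGroup (Fin (κ b) → Bool) ℂ)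
    (hA : ∀ b ∈ l, ∀ y x, ‖A b y x - U b y x‖ ≤ ε b) (φ ψ : State ι) (hψ : l2norm ψ ≤ 1) :
    l2norm (Layer.run (l.map fun b => onWires (e b) (A b)) φ
        - Layer.run (l.map fun b => onWires (e b) (U b)) ψ) + 1
      ≤ Real.exp (l.map fun b => 2 ^ κ b * ε b).sum * (l2norm (φ - ψ) + 1) := by
  induction l generalizing φ ψ with
  | nil => simp [Layer.run_nil]
  | cons b l ih =>
    have hUb := hU b List.mem_cons_self
    have hψ' : l2norm ((onWires (e b) (U b)).apply ψ) ≤ 1 := by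
      rwa [l2norm_gate_apply (onWires (e b) (U b)) hUb]
    simp only [List.map_cons, Layer.run_cons, List.sum_cons]
    refine (ih (fun b' hb' => hU b' (List.mem_cons_of_mem _ hb'))
      (fun b' hb' => hA b' (List.mem_cons_of_mem _ hb')) _ _ hψ').trans ?_
    rw [add_comm (2 ^ κ b * ε b), Real.exp_add, mul_assoc]
    refine mul_le_mul_of_nonneg_left ?_ (Real.exp_pos _).le
    have hsplit : (onWires (e b) (A b)).apply φ - (onWires (e b) (U b)).apply ψ
        = (onWires (e b) (U b)).apply (φ - ψ) + (onWires (e b) (A b - U b)).apply φ := by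
      rw [onWires_sub_apply, Gate.apply_sub]
      abel
    have h1 := l2norm_add_le ((onWires (e b) (U b)).apply (φ - ψ))
      ((onWires (e b) (A b - U b)).apply φ)
    have h2 := l2norm_onWires_apply_le (e b) (A b - U b) (hε b) (hA b List.mem_cons_self) φ
    rw [← hsplit, l2norm_gate_apply (onWires (e b) (U b)) hUb] at h1
    have h3 := l2norm_add_le (φ - ψ) ψ
    rw [sub_add_cancel] at h3
    have hδ : 0 ≤ 2 ^ κ b * ε b := mul_nonneg (by positivity) (hε b)
    have h4 : 2 ^ κ b * ε b * l2norm φ ≤ 2 ^ κ b * ε b * (l2norm (φ - ψ) + 1) :=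
      mul_le_mul_of_nonneg_left (by linarith) hδ
    have h5 : (2 ^ κ b * ε b + 1) * (l2norm (φ - ψ) + 1)
        ≤ Real.exp (2 ^ κ b * ε b) * (l2norm (φ - ψ) + 1) :=
      mul_le_mul_of_nonneg_right (Real.add_one_le_exp _)
        (add_nonneg (l2norm_nonneg _) zero_le_one)
    linarith

theorem l2norm_sub_comm {α : Type} [Fintype α] (ψ φ : α → ℂ) : l2norm (ψ - φ) = l2norm (φ - ψ) :=
  congrArg Real.sqrt (Finset.sum_congr rfl fun z _ => by
    rw [Pi.sub_apply, Pi.sub_apply, norm_sub_rev])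

theorem Layer.run_sub {ι : Type} (L : Layer ι) (ψ φ : State ι) :
    Layer.run L (ψ - φ) = Layer.run L ψ - Layer.run L φ := by
  rw [eq_sub_iff_add_eq, ← Layer.run_add, sub_add_cancel]

variable {n m : ℕ}

/-- Every block but the last has exactly `m` qubits. -/
theorem pow_blockSize_le {x : ℝ} (hx0 : 0 ≤ x) (hx1 : x ≤ 1) (hm : 1 ≤ m) {b : ℕ}
    (hb : b < numBlocks n m) :
    x ^ blockSize n m b ≤ x ^ m + if b + 1 = numBlocks n m then x else 0 := by
  split_ifs with h
  · have h1 : x ^ blockSize n m b ≤ x :=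
      pow_le_of_le_one hx0 hx1 (Nat.one_le_iff_ne_zero.1 (blockSize_pos hm hb))
    have h2 : 0 ≤ x ^ m := by positivity
    linarith
  · have hlt : b + 2 ≤ numBlocks n m := by omega
    rw [numBlocks, Nat.le_div_iff_mul_le (by omega)] at hlt
    have hs : (b + 2) * m = b * m + m + m := by ring
    rw [blockSize, min_eq_left (by omega), add_zero]

theorem numBlocks_le (hm : 1 ≤ m) : numBlocks n m ≤ n := by
  refine Nat.lt_succ_iff.1 ((Nat.div_lt_iff_lt_mul (by omega)).2 ?_)
  have : n ≤ n * m := Nat.le_mul_of_pos_right n (by omega)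
  rw [Nat.succ_mul]
  omega

theorem sum_block_errors_le {x : ℝ} (hx0 : 0 ≤ x) (hx1 : x ≤ 1) (hm : 1 ≤ m) :
    ((List.range (numBlocks n m)).map fun b =>
        (2 : ℝ) ^ blockSize n m b * (4 * x ^ blockSize n m b)).sum
      ≤ 2 ^ m * 4 * (n * x ^ m + x) := by
  have hsum : ((List.range (numBlocks n m)).map fun b =>
        (2 : ℝ) ^ blockSize n m b * (4 * x ^ blockSize n m b)).sum
      = ∑ b ∈ Finset.range (numBlocks n m),
        (2 : ℝ) ^ blockSize n m b * (4 * x ^ blockSize n m b) := rfl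
  have hterm : ∀ b ∈ Finset.range (numBlocks n m),
      (2 : ℝ) ^ blockSize n m b * (4 * x ^ blockSize n m b)
        ≤ 2 ^ m * 4 * (x ^ m + if b + 1 = numBlocks n m then x else 0) := by
    intro b hb
    have h1 := pow_blockSize_le hx0 hx1 hm (Finset.mem_range.1 hb)
    have h2 : (2 : ℝ) ^ blockSize n m b ≤ 2 ^ m :=
      pow_le_pow_right₀ (by norm_num) (min_le_left _ _)
    rw [← mul_assoc]
    exact mul_le_mul (by linarith) h1 (by positivity) (by positivity)
  have hlast : ∑ b ∈ Finset.range (numBlocks n m), (if b + 1 = numBlocks n m then x else 0)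
      ≤ x := by
    rcases Nat.eq_zero_or_pos (numBlocks n m) with h | h
    · rw [h]
      simpa using hx0
    · rw [Finset.sum_eq_single (numBlocks n m - 1)]
      · rw [if_pos (by omega)]
      · intro b _ hb
        exact if_neg (by omega)
      · intro hb
        exact absurd (Finset.mem_range.2 (by omega)) hb
  have hcard : (numBlocks n m : ℝ) * x ^ m ≤ n * x ^ m :=
    mul_le_mul_of_nonneg_right (by exact_mod_cast numBlocks_le hm) (by positivity)
  rw [hsum]
  refine (Finset.sum_le_sum hterm).trans ?_
  rw [← Finset.mul_sum, Finset.sum_add_distrib, Finset.sum_const, Finset.card_range, nsmul_eq_mul]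
  exact mul_le_mul_of_nonneg_left (add_le_add hcard hlast) (by positivity)

/-- The circuits with `U†` and with `A†`, run on the same normalised state, end in nearby states. -/
theorem l2norm_unitary_sub_nonunitary_le (hm : 1 ≤ m) {p : ℕ} (s : ZMod p)
    (hp : 7 ≤ p) {B : ∀ k : ℕ, Finset (Fin k → Bool)} (hB : ∀ k, 1 ≤ k → IsHalf (B k))
    {η : ℝ} (hη : 2 ^ m * 4 * (n * (Real.pi / p) ^ m + Real.pi / p) ≤ η) (hη1 : η ≤ 1)
    (ψ : State (Qubit n)) (hψ : l2norm ψ = 1) :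
    l2norm (Circuit.run (unitaryCircuit n m p s B) ψ - Circuit.run (nonunitaryCircuit n m p s) ψ)
      ≤ 2 * η := by
  have hp7 : (7 : ℝ) ≤ p := by exact_mod_cast hp
  have hpi := Real.pi_pos
  set x := Real.pi / (p : ℝ) with hx
  have hx0 : 0 ≤ x := by positivity
  have hx2 : x ≤ 1 / 2 := by
    rw [hx, div_le_iff₀ (by linarith)]
    linarith [Real.pi_lt_d2]
  have hsin : |Real.sin x| ≤ x := by
    have := Real.abs_sin_le_abs (x := x)
    rwa [abs_of_nonneg hx0] at this
  have hsin2 : |Real.sin x| ≤ 1 / 2 := hsin.trans hx2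
  set ψ₁ := Layer.run (hadamardLayer n) ψ with hψ₁
  have hnorm₁ : l2norm ψ₁ = 1 := by
    rw [hψ₁, ← hψ]
    exact l2norm_circuit_run [hadamardLayer n] (isOver_hadamardLayer n) ψ
  have hblocks := l2norm_run_sub_run_le (List.range (numBlocks n m)) (fun b => blockSize n m b)
    (fun b => blockWires n m b)
    (fun b => (uMat (blockSize n m b) x (B _)).conjTranspose)
    (fun b => (aMat (blockSize n m b) x).conjTranspose)
    (fun b => 4 * x ^ blockSize n m b) (fun b => by positivity)
    (fun b hb => by
      have hk := blockSize_pos hm (List.mem_range.1 hb)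
      refine Unitary.star_mem (uMat_mem_unitaryGroup hk ?_ (hB _ hk))
      rw [pow_mul, ← sq_abs]
      have h1 : |Real.sin x| ^ 2 ≤ 1 / 4 := by
        nlinarith [abs_nonneg (Real.sin x)]
      exact (pow_le_of_le_one (sq_nonneg _) (by linarith) (by omega)).trans_lt (by linarith))
    (fun b hb z y => by
      have hk := blockSize_pos hm (List.mem_range.1 hb)
      rw [Matrix.conjTranspose_apply, Matrix.conjTranspose_apply, ← star_sub, norm_star,
        norm_sub_rev]
      refine (norm_uMat_sub_aMat_le hk hsin2 _ _ _).trans ?_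
      gcongr)
    ψ₁ ψ₁ hnorm₁.le
  have hsum := (sum_block_errors_le (n := n) hx0 (by linarith) hm).trans hη
  rw [sub_self] at hblocks
  have hzero : l2norm (0 : State (Qubit n)) = 0 := by simp [l2norm]
  rw [hzero, zero_add, mul_one] at hblocks
  have hη0 : 0 ≤ η := le_trans (by positivity) hη
  have hexp : Real.exp η - 1 ≤ 2 * η := by
    have h := Real.abs_exp_sub_one_le (x := η) (by rwa [abs_of_nonneg hη0])
    rw [abs_of_nonneg hη0] at h
    exact (le_abs_self _).trans h
  have hmono := Real.exp_le_exp.2 hsum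
  simp only [unitaryCircuit, nonunitaryCircuit, mainCircuit, Circuit.run_cons, Circuit.run_nil,
    Layer.run_append]
  rw [← Layer.run_sub, ← Layer.run_sub, l2norm_layer_run, l2norm_layer_run, l2norm_sub_comm,
    blockLayer_eq, blockLayer_eq]
  · linarith
  · intro g hg
    obtain rfl := List.mem_singleton.1 hg
    exact (isOneTwoUnitary_oneQubitGate _ (rotX_mem_unitaryGroup _)).2
  · intro g hg
    obtain ⟨b, _, rfl⟩ := List.mem_map.1 hg
    exact shiftMat_mem_unitaryGroup _

end Hybrid

/-! ### Error estimates for `p = Θ(n ^ c)` -/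

section Asymptotics

open Filter

/-- The length `⌈2 / c + 1⌉` of the blocks makes up for their number, which may be of order `n`:
`n * (n ^ (-c)) ^ m` is at most `n ^ (-c)`. -/
theorem block_error_le {c a x : ℝ} (hc : 0 < c) (ha : 0 < a) {n m : ℕ} (hn : 1 ≤ n)
    (hm : 2 / c + 1 ≤ m) (hx0 : 0 ≤ x) (hx : x ≤ Real.pi / a * (n : ℝ) ^ (-c)) :
    2 ^ m * 4 * (n * x ^ m + x)
      ≤ 2 ^ m * 4 * ((Real.pi / a) ^ m + Real.pi / a) * (n : ℝ) ^ (-c) := by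
  have hn1 : (1 : ℝ) ≤ n := by exact_mod_cast hn
  have hn0 : (0 : ℝ) < n := by linarith
  have hpi := Real.pi_pos
  have hcm : 2 + c ≤ c * m := by
    have h := mul_le_mul_of_nonneg_left hm hc.le
    rwa [mul_add, mul_div_cancel₀ _ hc.ne', mul_one] at h
  have hpow : (n : ℝ) * ((n : ℝ) ^ (-c)) ^ m ≤ (n : ℝ) ^ (-c) := by
    rw [← Real.rpow_mul_natCast hn0.le]
    nth_rewrite 1 [← Real.rpow_one (n : ℝ)]
    rw [← Real.rpow_add hn0]
    exact Real.rpow_le_rpow_of_exponent_le hn1 (by linarith)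
  have h1 : (n : ℝ) * x ^ m ≤ (Real.pi / a) ^ m * (n : ℝ) ^ (-c) := by
    calc (n : ℝ) * x ^ m ≤ n * (Real.pi / a * (n : ℝ) ^ (-c)) ^ m :=
          mul_le_mul_of_nonneg_left (pow_le_pow_left₀ hx0 hx m) hn0.le
      _ = (Real.pi / a) ^ m * (n * ((n : ℝ) ^ (-c)) ^ m) := by rw [mul_pow]; ring
      _ ≤ _ := mul_le_mul_of_nonneg_left hpow (by positivity)
  rw [mul_assoc (2 ^ m * 4)]
  refine mul_le_mul_of_nonneg_left ?_ (by positivity)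
  rw [add_mul]
  exact add_le_add h1 hx

/-- For `c < 1 / 2` the exponential error is smaller than any negative power of `n`. -/
theorem exp_error_le {c b : ℝ} (hc : c < 1 / 2) (hb : 0 < b) :
    ∃ K : ℝ, ∀ n p : ℕ, 1 ≤ n → 1 ≤ p → (p : ℝ) ≤ b * (n : ℝ) ^ c →
      (p : ℝ) ^ (3 / 2 : ℝ) * Real.exp (-(n : ℝ) / (4 * (p : ℝ) ^ 2)) ≤ K * (n : ℝ) ^ (-c) := by
  -- `exp (-y) ≤ M! / y ^ M` for `y` of order `n ^ (1 - 2 c)`; this `M` outweighs the factor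
  -- `p ^ (3 / 2)`, of order `n ^ (3 c / 2)`, and leaves `n ^ (-c)`.
  obtain ⟨M, hM⟩ := exists_nat_ge (5 * c / 2 / (1 - 2 * c))
  have hc' : 0 < 1 - 2 * c := by linarith
  rw [div_le_iff₀ hc'] at hM
  refine ⟨b ^ (3 / 2 : ℝ) * (M.factorial * (4 * b ^ 2) ^ M), fun n p hn hp hpb => ?_⟩
  have hn1 : (1 : ℝ) ≤ n := by exact_mod_cast hn
  have hn0 : (0 : ℝ) < n := by linarith
  have hp0 : (0 : ℝ) < p := by exact_mod_cast hp
  set y : ℝ := (n : ℝ) ^ (1 - 2 * c) / (4 * b ^ 2) with hy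
  have hy0 : 0 < y := by positivity
  have hyn : y ≤ n / (4 * (p : ℝ) ^ 2) := by
    have h1 : (p : ℝ) ^ 2 ≤ b ^ 2 * (n : ℝ) ^ (2 * c) := by
      have h := pow_le_pow_left₀ hp0.le hpb 2
      rwa [mul_pow, ← Real.rpow_mul_natCast hn0.le, mul_comm c, Nat.cast_ofNat] at h
    have h2 : (n : ℝ) ^ (1 - 2 * c) * (n : ℝ) ^ (2 * c) = n := by
      rw [← Real.rpow_add hn0, sub_add_cancel, Real.rpow_one]
    rw [hy, div_le_div_iff₀ (by positivity) (by positivity)]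
    calc (n : ℝ) ^ (1 - 2 * c) * (4 * (p : ℝ) ^ 2)
        ≤ (n : ℝ) ^ (1 - 2 * c) * (4 * (b ^ 2 * (n : ℝ) ^ (2 * c))) := by gcongr
      _ = ((n : ℝ) ^ (1 - 2 * c) * (n : ℝ) ^ (2 * c)) * (4 * b ^ 2) := by ring
      _ = n * (4 * b ^ 2) := by rw [h2]
  have hexp : Real.exp (-(n : ℝ) / (4 * (p : ℝ) ^ 2))
      ≤ M.factorial * (4 * b ^ 2) ^ M * (n : ℝ) ^ (-(5 * c / 2)) := by
    have h1 : Real.exp (-(n : ℝ) / (4 * (p : ℝ) ^ 2)) ≤ (Real.exp y)⁻¹ := by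
      rw [← Real.exp_neg, Real.exp_le_exp, neg_div]
      exact neg_le_neg hyn
    have h2 : (Real.exp y)⁻¹ ≤ (y ^ M / M.factorial)⁻¹ :=
      inv_anti₀ (by positivity) (Real.pow_div_factorial_le_exp y hy0.le M)
    have h3 : (y ^ M / M.factorial)⁻¹
        = M.factorial * (4 * b ^ 2) ^ M * (n : ℝ) ^ (-((1 - 2 * c) * M)) := by
      rw [hy, div_pow, ← Real.rpow_mul_natCast hn0.le, Real.rpow_neg hn0.le]
      field_simp
    refine h1.trans (h2.trans ?_)
    rw [h3]
    refine mul_le_mul_of_nonneg_left ?_ (by positivity)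
    exact Real.rpow_le_rpow_of_exponent_le hn1 (by linarith)
  have hpp : (p : ℝ) ^ (3 / 2 : ℝ) ≤ b ^ (3 / 2 : ℝ) * (n : ℝ) ^ (3 * c / 2) := by
    refine (Real.rpow_le_rpow hp0.le hpb (by norm_num)).trans (le_of_eq ?_)
    rw [Real.mul_rpow hb.le (by positivity), ← Real.rpow_mul hn0.le]
    congr 2
    ring
  have hcc : (n : ℝ) ^ (3 * c / 2) * (n : ℝ) ^ (-(5 * c / 2)) = (n : ℝ) ^ (-c) := by
    rw [← Real.rpow_add hn0]
    congr 1
    ring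
  calc _ ≤ (b ^ (3 / 2 : ℝ) * (n : ℝ) ^ (3 * c / 2))
        * (M.factorial * (4 * b ^ 2) ^ M * (n : ℝ) ^ (-(5 * c / 2))) :=
        mul_le_mul hpp hexp (Real.exp_pos _).le (by positivity)
    _ = b ^ (3 / 2 : ℝ) * (M.factorial * (4 * b ^ 2) ^ M)
        * ((n : ℝ) ^ (3 * c / 2) * (n : ℝ) ^ (-(5 * c / 2))) := by ring
    _ = _ := by rw [hcc]

/-- Large `n`: the bound `7` makes the angle `π / p` at most `1 / 2` and excludes `p = 2`, and the
total error of the blocks is at most `1`. -/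
theorem exists_threshold {c a : ℝ} (hc : 0 < c) (ha : 0 < a) (K : ℝ) :
    ∃ n₀ : ℕ, ∀ n : ℕ, n₀ ≤ n → 1 ≤ n ∧ 7 ≤ a * (n : ℝ) ^ c ∧ K * (n : ℝ) ^ (-c) ≤ 1 := by
  have h1 : Tendsto (fun n : ℕ => a * (n : ℝ) ^ c) atTop atTop :=
    ((tendsto_rpow_atTop hc).comp tendsto_natCast_atTop_atTop).const_mul_atTop ha
  have h2 : Tendsto (fun n : ℕ => K * (n : ℝ) ^ (-c)) atTop (nhds (K * 0)) :=
    ((tendsto_rpow_neg_atTop hc).comp tendsto_natCast_atTop_atTop).const_mul K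
  rw [mul_zero] at h2
  exact eventually_atTop.1 ((eventually_ge_atTop 1).and
    ((h1.eventually_ge_atTop 7).and (h2.eventually_le_const one_pos)))

end Asymptotics

/-! ### The two families of circuits -/

section Families

/-- In the regime `p = Θ(n ^ c)` all errors beyond `1 / 2 - 1 / π` are `O(n ^ (-c))`. -/
theorem tvDist_unitary_le {c a b : ℝ} (hc : 0 < c) (hc2 : c < 1 / 2) (ha : 0 < a) (hb : 0 < b)
    {m : ℕ} (hm : 2 / c + 1 ≤ m) :
    ∃ (K : ℝ) (n₀ : ℕ), ∀ n p : ℕ, n₀ ≤ n → a * (n : ℝ) ^ c ≤ p → (p : ℝ) ≤ b * (n : ℝ) ^ c →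
      ∀ (s : ZMod p) (B : ∀ k : ℕ, Finset (Fin k → Bool)), (∀ k, 1 ≤ k → IsHalf (B k)) →
      7 ≤ p ∧ (l2norm (Circuit.run (unitaryCircuit n m p s B) (bpmState n)) = 1 →
        tvDist (born (Circuit.run (unitaryCircuit n m p s B) (bpmState n))) (targetDist n p s)
          ≤ 1 / 2 - 1 / Real.pi + K * (n : ℝ) ^ (-c)) := by
  have hm1 : 1 ≤ m := by
    have h : (1 : ℝ) ≤ m := le_trans (by linarith [div_pos two_pos hc]) hm
    exact_mod_cast h
  set K₁ : ℝ := 2 ^ m * 4 * ((Real.pi / a) ^ m + Real.pi / a) with hK₁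
  obtain ⟨K₂, hK₂⟩ := exp_error_le hc2 hb
  obtain ⟨n₀, hn₀⟩ := exists_threshold hc ha K₁
  refine ⟨2 * K₁ + 1 / (2 * a) + Real.exp 4 * K₂, n₀, fun n p hn hap hpb s B hB => ?_⟩
  obtain ⟨hn1, h7, hK1⟩ := hn₀ n hn
  have hp7 : 7 ≤ p := by
    have h : (7 : ℝ) ≤ p := h7.trans hap
    exact_mod_cast h
  refine ⟨hp7, fun hnorm => ?_⟩
  have hpi := Real.pi_pos
  have hn0 : (0 : ℝ) < n := by exact_mod_cast hn1
  have hp0 : (0 : ℝ) < p := by exact_mod_cast (by omega : 0 < p)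
  have hnc : 0 < (n : ℝ) ^ c := Real.rpow_pos_of_pos hn0 c
  have hinv : 1 / (p : ℝ) ≤ 1 / a * (n : ℝ) ^ (-c) := by
    rw [Real.rpow_neg hn0.le, ← one_div, one_div_mul_one_div]
    exact one_div_le_one_div_of_le (by positivity) hap
  have hx : Real.pi / p ≤ Real.pi / a * (n : ℝ) ^ (-c) := by
    have h := mul_le_mul_of_nonneg_left hinv hpi.le
    calc Real.pi / p = Real.pi * (1 / p) := by ring
      _ ≤ _ := h
      _ = _ := by ring
  have hη := block_error_le hc ha hn1 hm (by positivity) hx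
  have hbpm : l2norm (bpmState n) = 1 := by
    rw [← run_prepCircuit, l2norm_circuit_run _ (isOver_prepCircuit n), l2norm_zeroState]
  have hdiff := l2norm_unitary_sub_nonunitary_le hm1 s hp7 hB hη hK1 (bpmState n) hbpm
  have hnorm' : l2norm (Circuit.run (nonunitaryCircuit n m p s) (bpmState n)) = 1 :=
    Real.sqrt_eq_one.2 (isProbDist_nonunitary hm1 (by omega) s).2
  have h1 := tvDist_born_le hnorm hnorm'
  have h2 := tvDist_nonunitary_le hn1 hm1 (by omega : 1 ≤ p) (by omega) s
  have h3 := mul_le_mul_of_nonneg_left (hK₂ n p hn1 (by omega) hpb) (Real.exp_pos 4).le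
  have h4 : 1 / (2 * (p : ℝ)) ≤ 1 / (2 * a) * (n : ℝ) ^ (-c) := by
    calc 1 / (2 * (p : ℝ)) = 1 / 2 * (1 / p) := by field_simp
      _ ≤ 1 / 2 * (1 / a * (n : ℝ) ^ (-c)) := mul_le_mul_of_nonneg_left hinv (by norm_num)
      _ = _ := by field_simp
  refine (tvDist_triangle _ (born (Circuit.run (nonunitaryCircuit n m p s) (bpmState n)))
    _).trans ?_
  linarith

theorem exists_unitary_block_circuit {m : ℕ} (hm : 1 ≤ m) : ∃ N : ℕ, ∀ n p : ℕ, 7 ≤ p →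
    ∀ B : ∀ k : ℕ, Finset (Fin k → Bool), (∀ k, 1 ≤ k → IsHalf (B k)) →
      ∃ C : Circuit (Qubit n), C.IsOver IsOneTwoUnitary ∧ C.length = N ∧ ∀ ψ, C.run ψ
        = Layer.run (blockLayer n m fun k => (uMat k (Real.pi / p) (B k)).conjTranspose) ψ := by
  obtain ⟨N, hN⟩ := exists_common_length m
  refine ⟨N, fun n p hp B hB => exists_block_circuit hm N _ fun k hk hkm =>
    hN N le_rfl k hk hkm _ (Unitary.star_mem (uMat_mem_unitaryGroup hk ?_ (hB k hk)))⟩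
  have hp7 : (7 : ℝ) ≤ p := by exact_mod_cast hp
  have hpi := Real.pi_pos
  have hx : Real.pi / p ≤ 1 / 2 := by
    rw [div_le_iff₀ (by linarith)]
    linarith [Real.pi_lt_d2]
  have hsin := (Real.sin_le (by positivity : 0 ≤ Real.pi / (p : ℝ)))
  have hsin0 := Real.sin_nonneg_of_nonneg_of_le_pi (by positivity : 0 ≤ Real.pi / (p : ℝ))
    (by linarith [Real.pi_gt_three])
  exact pow_lt_one₀ hsin0 (by linarith) (by omega)

theorem exists_adjoint_block_circuit {n m : ℕ} (hm : 1 ≤ m) (θ : ℝ) :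
    ∃ C : Circuit (Qubit n), C.IsOver (fun g => IsOneTwoUnitary g ∨ IsAdjointA m θ g) ∧
      C.length = 1 ∧
      ∀ ψ, C.run ψ = Layer.run (blockLayer n m fun k => (aMat k θ).conjTranspose) ψ := by
  refine ⟨[blockLayer n m fun k => (aMat k θ).conjTranspose], fun L hL => ?_, rfl, fun ψ => rfl⟩
  obtain rfl := List.mem_singleton.1 hL
  refine ⟨fun g hg => Or.inr ?_, List.pairwise_map.2 (blockWires_pairwise n m)⟩
  obtain ⟨b, hb, rfl⟩ := List.mem_map.1 hg
  exact ⟨blockSize_pos hm (List.mem_range.1 hb), min_le_left _ _, rfl⟩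

end Families

end ShallowSampling

end

theorem mainTheorem3 :
    -- the circuit of one- and two-qubit unitary gates, in the regime `p = Θ(n^c)`
    (∀ c : ℝ, 0 < c → c < 1 / 2 →
      ∃ D : ℕ, ∀ a b : ℝ, 0 < a → 0 < b →
      ∃ (K : ℝ) (n₀ : ℕ), ∀ n p : ℕ, n₀ ≤ n →
        a * (n : ℝ) ^ c ≤ (p : ℝ) → (p : ℝ) ≤ b * (n : ℝ) ^ c →
      ∀ (s : ZMod p) (B : ∀ k : ℕ, Finset (Fin k → Bool)), (∀ k, 1 ≤ k → IsHalf (B k)) →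
      ∃ prep main : Circuit (Qubit n),
        Circuit.IsOver IsOneTwoUnitary (prep ++ main) ∧
        Circuit.depth (prep ++ main) ≤ D ∧
        Circuit.run prep (zeroState (Qubit n)) = bpmState n ∧
        (∀ ψ : State (Qubit n),
          Circuit.run main ψ = Circuit.run (unitaryCircuit n ⌈2 / c + 1⌉₊ p s B) ψ) ∧
        IsProbDist (born (Circuit.run (prep ++ main) (zeroState (Qubit n)))) ∧
        tvDist (born (Circuit.run (prep ++ main) (zeroState (Qubit n)))) (targetDist n p s)
          ≤ 1 / 2 - 1 / Real.pi + K * (n : ℝ) ^ (-c)) ∧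
    -- the circuit with the non-unitary operations `A_{m,π/p}†`
    (∃ (D : ℕ) (K : ℝ), ∀ n p m : ℕ, 1 ≤ n → 1 ≤ p → p ≠ 2 → 1 ≤ m →
      ∀ s : ZMod p,
      ∃ prep main : Circuit (Qubit n),
        Circuit.IsOver (fun g => IsOneTwoUnitary g ∨ IsAdjointA m (Real.pi / (p : ℝ)) g)
          (prep ++ main) ∧
        Circuit.depth (prep ++ main) ≤ D ∧
        Circuit.run prep (zeroState (Qubit n)) = bpmState n ∧
        (∀ ψ : State (Qubit n),
          Circuit.run main ψ = Circuit.run (nonunitaryCircuit n m p s) ψ) ∧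
        IsProbDist (born (Circuit.run (prep ++ main) (zeroState (Qubit n)))) ∧
        tvDist (born (Circuit.run (prep ++ main) (zeroState (Qubit n)))) (targetDist n p s)
          ≤ 1 / 2 - 1 / Real.pi + 1 / (2 * (p : ℝ))
            + K * (p : ℝ) ^ (3 / 2 : ℝ) * Real.exp (-(n : ℝ) / (4 * (p : ℝ) ^ 2))) := by
  refine ⟨fun c hc hc2 => ?_, 9, Real.exp 4, fun n p m hn hp hp2 hm s => ?_⟩
  · have hm : 2 / c + 1 ≤ (⌈2 / c + 1⌉₊ : ℝ) := Nat.le_ceil _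
    have hm1 : 1 ≤ ⌈2 / c + 1⌉₊ := Nat.one_le_ceil_iff.2 (by positivity)
    obtain ⟨N, hN⟩ := exists_unitary_block_circuit hm1
    refine ⟨N + 8, fun a b ha hb => ?_⟩
    obtain ⟨K, n₀, hK⟩ := tvDist_unitary_le hc hc2 ha hb hm
    refine ⟨K, n₀, fun n p hn hap hpb s B hB => ?_⟩
    obtain ⟨hp7, htv⟩ := hK n p hn hap hpb s B hB
    obtain ⟨main, hover, hdepth, hrun⟩ := exists_main_circuit hm1 p s _ (fun _ h => h)
      (hN n p hp7 B hB)
    have hnorm : l2norm (Circuit.run (prepCircuit n ++ main) (zeroState (Qubit n))) = 1 := by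
      rw [l2norm_circuit_run _ hover, l2norm_zeroState]
    have hout : Circuit.run (prepCircuit n ++ main) (zeroState (Qubit n))
        = Circuit.run (unitaryCircuit n ⌈2 / c + 1⌉₊ p s B) (bpmState n) := by
      rw [Circuit.run_append, run_prepCircuit, hrun, unitaryCircuit]
    refine ⟨prepCircuit n, main, hover, hdepth.le, run_prepCircuit n, hrun,
      isProbDist_born_of_l2norm hnorm, ?_⟩
    rw [hout] at hnorm ⊢
    exact htv hnorm
  · obtain ⟨main, hover, hdepth, hrun⟩ := exists_main_circuit hm p s _ (fun _ h => Or.inl h)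
      (exists_adjoint_block_circuit (n := n) hm (Real.pi / p))
    have hout : Circuit.run (prepCircuit n ++ main) (zeroState (Qubit n))
        = Circuit.run (nonunitaryCircuit n m p s) (bpmState n) := by
      rw [Circuit.run_append, run_prepCircuit, hrun, nonunitaryCircuit]
    refine ⟨prepCircuit n, main, hover, hdepth.le, run_prepCircuit n, hrun, ?_, ?_⟩
    · rw [hout]
      exact isProbDist_nonunitary hm hp s
    · rw [hout]
      exact tvDist_nonunitary_le hn hm hp hp2 s
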